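/- Let $\alpha,\beta,\nu\in\mathbf R$ with $\nu>0$ and $\alpha/\beta<0$, let $\frac14\le s\le 1$, $b>\frac12$ and $K\in\mathbf R$. There is a constant $c>0$, depending only on $\alpha,\beta,\nu,s,b,K$, such that the following holds for every $N\ge 1$. Let $m=m_N:\mathbf R\to\mathbf R$ be smooth, even and nonincreasing in $|\xi|$, with $m(\xi)=1$ for $|\xi|\le N$, $m(\xi)=(N/|\xi|)^{1-s}$ for $|\xi|\ge 2N$ and $|m'|\le K/N$ (for instance $m_N(\xi)=m_1(\xi/N)$ with a fixed profile $m_1$ and $K=\sup|m_1'|$), and let $I=I_N$ be the Fourier multiplier $\widehat{If}=m\widehat f$. With $\langle x\rangle=(1+x^2)^{1/2}$ let $$\|u\|_{X^{\sigma,b}}=\|\langle\tau+\xi^2\rangle^b\langle\xi\rangle^\sigma\widehat u(\xi,\tau)\|_{L^2(\mathbf R^2)},\qquad \|v\|_{Y^{\sigma,b}}=\|\langle\tau+\nu\xi|\xi|\rangle^b\langle\xi\rangle^\sigma\widehat v(\xi,\tau)\|_{L^2(\mathbf R^2)},$$ and let $\|\cdot\|_{X^{\sigma,b}_\delta}$,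 $\|\cdot\|_{Y^{\sigma,b}_\delta}$ be the infima of these norms over all extensions of the given function from $[0,\delta]$ to $\mathbf R$. Let $$E(f,g)=\|f_x\|_{L^2}^2-\frac{\alpha\nu}{2\beta}\|D_x^{1/2}g\|_{L^2}^2+\alpha\int g|f|^2\,dx,\qquad L(f,g)=-\frac{\alpha}{2\beta}\|g\|_{L^2}^2-\Im\int f\,\overline{f_x}\,dx .$$ Let $\delta>0$, let $(u_0,v_0)\in H^s(\mathbf R)\times H^{s-\frac12}(\mathbf R)$, and let $(u,v)$, with $u$ complex-valued and $v$ real-valued, be a solution on $[0,\delta]$, with $u(0)=u_0$, $v(0)=v_0$, of (the Duhamel integral equations of) $$i\partial_tu+\partial_x^2u=\alpha uv,\qquad \partial_tv+\nu\partial_x|\partial_x|v=\beta\partial_x(|u|^2),$$ such that $Iu\in X^{1,b}_\delta$ and $Iv\in Y^{\frac12,b}_\delta$. Then $$|E(Iu(\delta),Iv(\delta))-E(Iu(0),Iv(0))|+|L(Iu(\delta),Iv(\delta))-L(Iu(0),Iv(0))|$$ $$\le cN^{-1}\left(\|Iu\|_{X^{1,b}_\delta}^2\|Iv\|_{Y^{\frac12,b}_\delta}+\|Iu\|_{X^{1,b}_\delta}^4+\|Iu\|_{X^{1,b}_\delta}^2\|Iv\|_{Y^{\frac12,b}_\delta}^2\right).$$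 -/

import Mathlib

open MeasureTheory Set
open scoped SchwartzMap FourierTransform ENNReal

noncomputable section

namespace SBO

/-! ### Functions representing tempered distributions, and the Fourier transform

The Fourier transform of a function `f` on the line is normalised as
`(2π)^(-1/2) ∫ exp(-i x ξ) f(x) dx`, so that it is unitary and `∂ₓ` becomes `i ξ`. -/

/-- The tempered distribution `T` is the function `F`. -/
def Represents (T : 𝓢'(ℝ, ℂ)) (F : ℝ → ℂ) : Prop :=
  ∀ φ : 𝓢(ℝ, ℂ), Integrable (fun x => φ x * F x) ∧ T φ = ∫ x, φ x * F x

open Classical in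
/-- The function (unique up to null sets) represented by the tempered distribution `T`, if `T` is
a function; otherwise `0`. -/
def toFun (T : 𝓢'(ℝ, ℂ)) : ℝ → ℂ :=
  if h : ∃ F, Represents T F then h.choose else 0

/-- The Fourier transform of `T`, in the normalisation above, is the function `F`.
(The transform `𝓕` has kernel `exp(-2π i x k)`, hence `𝓕 T k = √(2π) F (2π k)`.) -/
def HasFourier (T : 𝓢'(ℝ, ℂ)) (F : ℝ → ℂ) : Prop :=
  Represents (𝓕 T) (fun k => (√(2 * Real.pi) : ℂ) * F (2 * Real.pi * k))

open Classical in
/-- The Fourier transform (unique up to null sets) of the tempered distribution `T`, if it is a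
function; otherwise `0`. -/
def hat (T : 𝓢'(ℝ, ℂ)) : ℝ → ℂ :=
  if h : ∃ F, HasFourier T F then h.choose else 0

/-- A tempered distribution is real if it takes real values on real test functions. -/
def IsRealDistribution (T : 𝓢'(ℝ, ℂ)) : Prop :=
  ∀ φ : 𝓢(ℝ, ℂ), (∀ x, (φ x).im = 0) → (T φ).im = 0

/-- The Fourier transform of the product `f g`, as the convolution of the two transforms. -/
def prodHat (f g : 𝓢'(ℝ, ℂ)) (ξ : ℝ) : ℂ :=
  (√(2 * Real.pi) : ℂ)⁻¹ * ∫ η, hat f (ξ - η) * hat g η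

/-- The Fourier transform of `|f|² = f f̄`; the transform of `f̄` at `η` is the conjugate of
the transform of `f` at `-η`. -/
def absSqHat (f : 𝓢'(ℝ, ℂ)) (ξ : ℝ) : ℂ :=
  (√(2 * Real.pi) : ℂ)⁻¹ * ∫ η, hat f (ξ - η) * (starRingEnd ℂ) (hat f (-η))

/-! ### The Fourier restriction spaces -/

/-- The bracket `⟨x⟩ = (1 + x²)^(1/2)`. -/
def bracket (x : ℝ) : ℝ := √(1 + x ^ 2)

/-- `Ψ (ξ, τ)` is the space-time Fourier transform of the curve `ψ`: inversion in the time
frequency gives the Fourier transform of `ψ t` in space, for every time `t`. Among the functions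
`Ψ` of finite `X^{s,b}` norm with `b > 1/2`, this inversion integral converges absolutely for almost
every `ξ` and yields the continuous representative `t ↦ ψ t` of the space-time distribution. -/
def IsSpaceTimeFourier (ψ : ℝ → 𝓢'(ℝ, ℂ)) (Ψ : ℝ × ℝ → ℂ) : Prop :=
  AEStronglyMeasurable Ψ ∧
  ∀ t : ℝ, HasFourier (ψ t) (fun ξ =>
    (√(2 * Real.pi) : ℂ)⁻¹ * ∫ τ : ℝ, Complex.exp (Complex.I * (t * τ : ℝ)) * Ψ (ξ, τ))

/-- The norm `‖⟨τ + h(ξ)⟩^b ⟨ξ⟩^s Ψ‖` in `L²(ℝ²)`, for the dispersion relation `h`. -/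
def restrictionNorm (h : ℝ → ℝ) (s b : ℝ) (Ψ : ℝ × ℝ → ℂ) : ℝ≥0∞ :=
  eLpNorm (fun p : ℝ × ℝ =>
    ((bracket (p.2 + h p.1) ^ b * bracket p.1 ^ s : ℝ) : ℂ) * Ψ p) 2 volume

/-- The norm local in time: the infimum of the norms of all extensions `ψ` of the restriction of
`w` to `[0, δ]`. Used for `b > 1/2`. -/
def localNorm (h : ℝ → ℝ) (s b δ : ℝ) (w : ℝ → 𝓢'(ℝ, ℂ)) : ℝ≥0∞ :=
  ⨅ (ψ : ℝ → 𝓢'(ℝ, ℂ)) (Ψ : ℝ × ℝ → ℂ) (_ : IsSpaceTimeFourier ψ Ψ)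
    (_ : ∀ t ∈ Icc 0 δ, ψ t = w t), restrictionNorm h s b Ψ

/-- The norm of `X^{s,b}_δ` (Schrödinger: `τ + ξ²`). -/
def normX (s b δ : ℝ) (w : ℝ → 𝓢'(ℝ, ℂ)) : ℝ≥0∞ :=
  localNorm (fun ξ => ξ ^ 2) s b δ w

/-- The norm of `Y^{s,b}_δ` (Benjamin-Ono: `τ + ν ξ |ξ|`). -/
def normY (ν s b δ : ℝ) (w : ℝ → 𝓢'(ℝ, ℂ)) : ℝ≥0∞ :=
  localNorm (fun ξ => ν * ξ * |ξ|) s b δ w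

/-! ### The smoothing operator -/

/-- `m` is an admissible symbol `m_N`: smooth, even, nonincreasing in `|ξ|`, equal to `1` for
`|ξ| ≤ N` and to `(N/|ξ|)^(1-s)` for `|ξ| ≥ 2N`. The bound `K / N` on the derivative says that the
transition between the two regimes takes place at the scale `N`; for
`m_N(ξ) = m_1(ξ/N)` with a fixed `m_1` it holds with `K = sup |m_1'|` for all `N`. -/
structure IsSymbol (s N K : ℝ) (m : ℝ → ℝ) : Prop where
  smooth : ContDiff ℝ (⊤ : ℕ∞) m
  even : ∀ ξ, m (-ξ) = m ξ
  antitone : AntitoneOn m (Ici 0)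
  low : ∀ ξ, |ξ| ≤ N → m ξ = 1
  high : ∀ ξ, 2 * N ≤ |ξ| → m ξ = (N / |ξ|) ^ (1 - s)
  deriv_le : ∀ ξ, |deriv m ξ| ≤ K / N

/-- The operator `I` with symbol `m(ξ)`, `ξ = 2π k` being the angular frequency. -/
def smoothing (m : ℝ → ℝ) (f : 𝓢'(ℝ, ℂ)) : 𝓢'(ℝ, ℂ) :=
  TemperedDistribution.fourierMultiplierCLM ℂ (fun k : ℝ => (m (2 * Real.pi * k) : ℂ)) f

/-! ### The functionals -/

/-- `L(f, g) = -(α / 2β) ‖g‖² - Im ∫ f ∂ₓf̄ dx`. -/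
def functionalL (α β : ℝ) (f g : 𝓢'(ℝ, ℂ)) : ℝ :=
  -(α / (2 * β)) * (∫ x, ‖toFun g x‖ ^ 2)
    - (∫ x, toFun f x *
        (starRingEnd ℂ) (toFun (TemperedDistribution.derivCLM ℂ f) x)).im

/-- `E(f, g) = ‖∂ₓf‖² - (α ν / 2β) ‖D^{1/2} g‖² + α ∫ g |f|² dx`
(the last integral is real for real `g`). -/
def functionalE (α β ν : ℝ) (f g : 𝓢'(ℝ, ℂ)) : ℝ :=
  (∫ x, ‖toFun (TemperedDistribution.derivCLM ℂ f) x‖ ^ 2)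
    - α * ν / (2 * β) * (∫ ξ, |ξ| * ‖hat g ξ‖ ^ 2)
    + α * (∫ x, toFun g x * ((‖toFun f x‖ ^ 2 : ℝ) : ℂ)).re

/-! ### Local solutions -/

/-- `(u, v)` solves on `[0, δ]` the integral equations of
`i u_t + u_xx = α u v`, `v_t + ν ∂ₓ|∂ₓ| v = β ∂ₓ(|u|²)`, `u(0) = u₀`, `v(0) = v₀`,
with `v` real, `Iu ∈ X^{1,b}_δ` and `Iv ∈ Y^{1/2,b}_δ`, where `I` has the symbol `m`. -/
structure IsLocalSolution (α β ν s b : ℝ) (m : ℝ → ℝ) (δ : ℝ) (u₀ v₀ : 𝓢'(ℝ, ℂ))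
    (u v : ℝ → 𝓢'(ℝ, ℂ)) : Prop where
  data_u : TemperedDistribution.MemSobolev s 2 u₀
  data_v : TemperedDistribution.MemSobolev (s - 1 / 2) 2 v₀
  initial_u : u 0 = u₀
  initial_v : v 0 = v₀
  real_v : ∀ t ∈ Icc 0 δ, IsRealDistribution (v t)
  mem_X : normX 1 b δ (fun t => smoothing m (u t)) < ⊤
  mem_Y : normY ν (1 / 2) b δ (fun t => smoothing m (v t)) < ⊤
  duhamel_u : ∀ t ∈ Icc 0 δ, ∀ᵐ ξ : ℝ,
    hat (u t) ξ = Complex.exp (-Complex.I * (t * ξ ^ 2 : ℝ)) * hat u₀ ξ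
      - Complex.I * α * ∫ r in (0 : ℝ)..t,
          Complex.exp (-Complex.I * ((t - r) * ξ ^ 2 : ℝ)) * prodHat (u r) (v r) ξ
  duhamel_v : ∀ t ∈ Icc 0 δ, ∀ᵐ ξ : ℝ,
    hat (v t) ξ = Complex.exp (-Complex.I * (t * (ν * ξ * |ξ|) : ℝ)) * hat v₀ ξ
      + β * ∫ r in (0 : ℝ)..t,
          Complex.exp (-Complex.I * ((t - r) * (ν * ξ * |ξ|) : ℝ)) *
            (Complex.I * ξ * absSqHat (u r) ξ)

end SBO

end

/-! Everything is done on the Fourier side. Let `Ψ`, `Φ` be space-time transforms of extensions of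
Iu, Iv, so that `evolution Ψ ξ t` is the transform of Iu(t) at ξ. Because b > 1/2, this is bounded
in time by `majorant Ψ ξ`, which is finite for almost every ξ; by the Duhamel formula it is also
Lipschitz in time. So squares and triple products of these transforms can be differentiated in time
frequency by frequency, and the fundamental theorem of calculus gives exact formulas for the
increments.

Quadratic parts. Write z = x + y. All quadratic increments are integrals against one quantity,
`tri`: the imaginary part of the time integral of (Iu)^(x) (Iv)^(y) conj (Iu)^(z), divided by
m(x)m(y)m(z). As v is real, `tri` changes sign under (x, y) ↦ (x + y, -y), so a weight g(z) may be
replaced by half of g(z) - g(x). The coefficients of E and L make β cancel. For L the symbol is z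
m(z)² - x m(x)² - y m(y)². For E it is z² m(z)² - x² m(x)² - ν y|y| m(y)², from which the linear
part of the time derivative of ∫ Iv |Iu|² removes m(x)m(y)m(z)(z² - x² - ν y|y|). Both symbols then
vanish for m = 1 and split into three terms, each with a commutator such as m(z) - m(x)m(y).

Commutators. `abs_add_mul_abs_sub_le` and `sq_sub_mul_bracket_le` gain 1/N at the cost of
derivatives on the inputs. The condition s ≥ 1/4 enters through the almost monotonicity of |ξ|³
m(ξ)⁴ (`cube_mul_le`), needed when two high frequencies interact to give a low one.

Trilinear estimate. `lintegral_triple_le` bounds the integral of |y|⟨x⟩⟨z⟩ |triple| by the square of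
the X norm times the Y norm. Both Schrödinger factors are opened as superpositions of free waves.
For fixed modulations the time frequency seen by Iv is a constant plus 2xy + y², so the change of
variables in x has Jacobian 2|y|: this transversality gives half a derivative, and the Y norm gives
the other half. Only Plancherel in time is used for Iv, so the sharp restriction to [0, δ] costs
nothing and the constant does not depend on δ.

Quartic terms. The nonlinear part of the time derivative of ∫ Iv |Iu|² pairs I(uv) with Iu Iv and
∂ₓI(|u|²) with |Iu|². Replacing I(uv) by Iu Iv, or I(|u|²) by |Iu|², makes the real part vanish, so
only commutators remain (`enorm_re_quartic_le`). They are estimated with two factors uniform in time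
and two square integrable in time.

Two limits close the argument. The weight ξ² is unbounded, so the two halves of the symmetrised
integral are separated only after a truncation, removed by dominated convergence. The local norms
are infima, so the estimate is proved with norms enlarged by ε and then ε → 0. -/

noncomputable section

namespace SBO

/-! ### The bracket -/

theorem bracket_sq (x : ℝ) : bracket x ^ 2 = 1 + x ^ 2 := Real.sq_sqrt (by positivity)

theorem one_le_bracket (x : ℝ) : 1 ≤ bracket x := by
  rw [bracket, Real.one_le_sqrt]; nlinarith [sq_nonneg x]

theorem bracket_pos (x : ℝ) : 0 < bracket x := lt_of_lt_of_le one_pos (one_le_bracket x)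

theorem abs_le_bracket (x : ℝ) : |x| ≤ bracket x := by
  apply Real.le_sqrt_of_sq_le; rw [sq_abs]; linarith

theorem bracket_mono {x y : ℝ} (h : |x| ≤ |y|) : bracket x ≤ bracket y := by
  apply Real.sqrt_le_sqrt; nlinarith [sq_le_sq.mpr h]

theorem bracket_neg (x : ℝ) : bracket (-x) = bracket x := by simp [bracket]

theorem continuous_bracket : Continuous bracket := by unfold bracket; fun_prop

theorem bracket_add_le (x y : ℝ) : bracket (x + y) ≤ 2 * bracket x * bracket y := by
  apply Real.sqrt_le_iff.mpr
  refine ⟨by have := bracket_pos x; have := bracket_pos y; positivity, ?_⟩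
  rw [mul_pow, mul_pow, bracket_sq, bracket_sq]
  nlinarith [sq_nonneg (x - y), mul_nonneg (sq_nonneg x) (sq_nonneg y), sq_nonneg x, sq_nonneg y]

/-! ### Estimates for the symbol -/

namespace IsSymbol

variable {s N K : ℝ} {m : ℝ → ℝ}

theorem apply_abs (hm : IsSymbol s N K m) (x : ℝ) : m |x| = m x := by
  rcases abs_choice x with h | h <;> rw [h]
  exact hm.even x

theorem anti (hm : IsSymbol s N K m) {x y : ℝ} (h : |x| ≤ |y|) : m y ≤ m x := by
  rw [← hm.apply_abs x, ← hm.apply_abs y]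
  exact hm.antitone (abs_nonneg x) (abs_nonneg y) h

theorem le_one (hm : IsSymbol s N K m) (hN : 1 ≤ N) (x : ℝ) : m x ≤ 1 := by
  rw [← hm.low 0 (by simp; linarith)]
  exact hm.anti (by simp)

theorem half_le (hm : IsSymbol s N K m) (hs : 1 / 4 ≤ s) (hN : 1 ≤ N) {x : ℝ}
    (hx : |x| ≤ 2 * N) : 1 / 2 ≤ m x := by
  have h2 : |2 * N| = 2 * N := abs_of_nonneg (by linarith)
  refine le_trans ?_ (hm.anti (x := x) (y := 2 * N) (by rw [h2]; exact hx))
  rw [hm.high (2 * N) h2.ge, h2]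
  have : N / (2 * N) = 1 / 2 := by field_simp
  rw [this]
  calc (1 / 2 : ℝ) = (1 / 2 : ℝ) ^ (1 : ℝ) := by simp
    _ ≤ _ := Real.rpow_le_rpow_of_exponent_ge (by norm_num) (by norm_num) (by linarith)

theorem pos (hm : IsSymbol s N K m) (hs : 1 / 4 ≤ s) (hN : 1 ≤ N) (x : ℝ) : 0 < m x := by
  rcases le_total |x| (2 * N) with h | h
  · linarith [hm.half_le hs hN h]
  · rw [hm.high x h]
    have : 0 < |x| := by linarith
    positivity

/-- For |ξ| ≥ 2N the quantity |ξ|³ m⁴ is a constant times |ξ|^(3 - 4(1-s)), and this exponent is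
nonnegative exactly when s ≥ 1/4. The loss 16 = 2⁴ covers |ξ| ≤ 2N, where only 1/2 ≤ m ≤ 1 is known.
-/
theorem cube_mul_le (hm : IsSymbol s N K m) (hs : 1 / 4 ≤ s) (hN : 1 ≤ N)
    {x y : ℝ} (h : |x| ≤ |y|) : |x| ^ 3 * m x ^ 4 ≤ 16 * (|y| ^ 3 * m y ^ 4) := by
  have hx1 := hm.le_one hN x
  have hx0 := hm.pos hs hN x
  have hx4 : m x ^ 4 ≤ 1 := pow_le_one₀ hx0.le hx1
  have hx := abs_nonneg x
  have hxy3 : |x| ^ 3 ≤ |y| ^ 3 := pow_le_pow_left₀ hx h 3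
  rcases le_total |y| (2 * N) with hy | hy
  · have hy2 := hm.half_le hs hN hy
    have hy4 : (1 / 2 : ℝ) ^ 4 ≤ m y ^ 4 := pow_le_pow_left₀ (by norm_num) hy2 4
    have : 0 ≤ |y| ^ 3 := by positivity
    nlinarith [mul_le_mul hxy3 hx4 (by positivity) this]
  · have hy0 : 0 < |y| := by linarith
    have hpow : ∀ r : ℝ, 0 ≤ r → (r ^ (1 - s)) ^ 4 = r ^ (4 * (1 - s)) := by
      intro r hr
      rw [← Real.rpow_natCast, ← Real.rpow_mul hr]; congr 1; push_cast; ring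
    rw [hm.high y hy, hpow _ (by positivity)]
    rcases le_total |x| (2 * N) with h2 | h2
    · have : (N / |y|) ^ (3 : ℝ) ≤ (N / |y|) ^ (4 * (1 - s)) :=
        Real.rpow_le_rpow_of_exponent_ge (by positivity)
          (by rw [div_le_one hy0]; linarith) (by linarith)
      have h3 : |y| ^ 3 * (N / |y|) ^ (3 : ℝ) = N ^ 3 := by
        rw [show (3 : ℝ) = ((3 : ℕ) : ℝ) by norm_num, Real.rpow_natCast]; field_simp
      have h4 : |x| ^ 3 ≤ (2 * N) ^ 3 := pow_le_pow_left₀ hx h2 3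
      have h5 : |x| ^ 3 * m x ^ 4 ≤ |x| ^ 3 := mul_le_of_le_one_right (by positivity) hx4
      have h6 := mul_le_mul_of_nonneg_left this (by positivity : 0 ≤ |y| ^ 3)
      have : 0 < N ^ 3 := by positivity
      nlinarith
    · have hx0 : 0 < |x| := by linarith
      rw [hm.high x h2, hpow _ (by positivity)]
      have e : N / |x| = N / |y| * (|y| / |x|) := by field_simp
      rw [e, Real.mul_rpow (by positivity) (by positivity)]
      have h7 : (|y| / |x|) ^ (4 * (1 - s)) ≤ (|y| / |x|) ^ (3 : ℝ) :=
        Real.rpow_le_rpow_of_exponent_le (by rw [one_le_div hx0]; exact h) (by linarith)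
      rw [show (3 : ℝ) = ((3 : ℕ) : ℝ) by norm_num, Real.rpow_natCast] at h7
      have h8 : 0 ≤ (N / |y|) ^ (4 * (1 - s)) := by positivity
      have h9 : |x| ^ 3 * (|y| / |x|) ^ 3 = |y| ^ 3 := by field_simp
      calc _ ≤ |x| ^ 3 * ((N / |y|) ^ (4 * (1 - s)) * (|y| / |x|) ^ 3) := by gcongr
        _ = (|x| ^ 3 * (|y| / |x|) ^ 3) * (N / |y|) ^ (4 * (1 - s)) := by ring
        _ ≤ _ := by
          rw [h9]
          have : 0 ≤ |y| ^ 3 * (N / |y|) ^ (4 * (1 - s)) := by positivity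
          linarith

/-- The fourth root of `cube_mul_le` multiplied by |x| ≤ |y|; hence 2 = 16^(1/4). -/
theorem abs_mul_le (hm : IsSymbol s N K m) (hs : 1 / 4 ≤ s) (hN : 1 ≤ N)
    {x y : ℝ} (h : |x| ≤ |y|) : |x| * m x ≤ 2 * (|y| * m y) := by
  have := hm.cube_mul_le hs hN h
  have hx := hm.pos hs hN x
  have hy := hm.pos hs hN y
  refine le_of_pow_le_pow_left₀ (n := 4) (by norm_num) (by positivity) ?_
  calc (|x| * m x) ^ 4 = |x| * (|x| ^ 3 * m x ^ 4) := by ring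
    _ ≤ |y| * (16 * (|y| ^ 3 * m y ^ 4)) := by gcongr
    _ = _ := by ring

theorem half_le_bracket_mul (hm : IsSymbol s N K m) (hs : 1 / 4 ≤ s) (hN : 1 ≤ N)
    (x : ℝ) : 1 / 2 ≤ bracket x * m x := by
  rcases le_total |x| (2 * N) with h | h
  · nlinarith [hm.half_le hs hN h, one_le_bracket x]
  · have h2 : |2 * N| = 2 * N := abs_of_nonneg (by linarith)
    have := hm.abs_mul_le hs hN (x := 2 * N) (y := x) (by rw [h2]; exact h)
    rw [h2] at this
    have h3 := hm.half_le hs hN (x := 2 * N) h2.le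
    nlinarith [abs_le_bracket x, hm.pos hs hN x]

theorem const_nonneg (hm : IsSymbol s N K m) (hN : 1 ≤ N) : 0 ≤ K := by
  have := (abs_nonneg _).trans (hm.deriv_le 0)
  have h : K = K / N * N := by field_simp
  rw [h]; positivity

/-- For |z| ≤ 2N use |m'| ≤ K/N and m ≥ 1/2, which gives the part 4K of the constant. Beyond 2N, m
is a power and |z m'| = (1 - s) m ≤ m. -/
theorem abs_deriv_mul_le (hm : IsSymbol s N K m) (hs : 1 / 4 ≤ s) (hs1 : s ≤ 1) (hN : 1 ≤ N)
    (z : ℝ) : |deriv m z| * |z| ≤ (4 * K + 1) * m z := by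
  have hK := hm.const_nonneg hN
  have key : ∀ z : ℝ, 0 ≤ z → |deriv m z| * |z| ≤ (4 * K + 1) * m z := by
    intro z hz0
    rcases le_or_gt |z| (2 * N) with h | h
    · have h1 := hm.half_le hs hN h
      have h2 := hm.deriv_le z
      calc |deriv m z| * |z| ≤ K / N * (2 * N) := by gcongr
        _ = 2 * K := by field_simp
        _ ≤ _ := by nlinarith
    · rw [abs_of_nonneg hz0] at h
      have hz : 0 < z := by linarith
      have hd : HasDerivAt (fun x : ℝ => (N / x) ^ (1 - s))
          ((-(N / z ^ 2)) * (1 - s) * (N / z) ^ (1 - s - 1)) z := by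
        have h1 : HasDerivAt (fun x : ℝ => N / x) (-(N / z ^ 2)) z := by
          have := (hasDerivAt_inv hz.ne').const_mul N
          simpa [div_eq_mul_inv] using! this
        exact h1.rpow_const (Or.inl (by positivity))
      have he : m =ᶠ[nhds z] fun x : ℝ => (N / x) ^ (1 - s) := by
        filter_upwards [lt_mem_nhds h] with x hx
        rw [hm.high x (by rw [abs_of_pos (by linarith)]; exact hx.le), abs_of_pos (by linarith)]
      rw [he.deriv_eq, hd.deriv, he.self_of_nhds, Real.rpow_sub_one (by positivity)]
      have hp : 0 < (N / z) ^ (1 - s) := by positivity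
      have e : -(N / z ^ 2) * (1 - s) * ((N / z) ^ (1 - s) / (N / z)) =
          -((1 - s) * (N / z) ^ (1 - s) / z) := by field_simp
      rw [e, abs_neg, abs_of_nonneg (by have : 0 ≤ 1 - s := by linarith
                                        positivity), abs_of_pos hz]
      have : (1 - s) * (N / z) ^ (1 - s) / z * z = (1 - s) * (N / z) ^ (1 - s) := by field_simp
      rw [this]
      nlinarith
  rcases le_total 0 z with h | h
  · exact key z h
  · have h1 := key (-z) (by linarith)
    have h2 : deriv m (-z) = - deriv m z := by
      have : (fun x => m (-x)) = m := funext hm.even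
      have h3 := deriv_comp_neg m z
      rw [this] at h3
      rw [h3]; ring
    rwa [h2, abs_neg, abs_neg, hm.even] at h1

/-- The mean value theorem: every z between y and x has |z| ≥ |y|/2, so m(z) ≤ m(y/2) ≤ 4 m(y). The
factor 8 is 4 times the 2 from |y|/2. -/
theorem abs_sub_mul_le (hm : IsSymbol s N K m) (hs : 1 / 4 ≤ s) (hs1 : s ≤ 1) (hN : 1 ≤ N)
    {x y : ℝ} (h : |x - y| ≤ |y| / 2) :
    |m x - m y| * |y| ≤ 8 * (4 * K + 1) * m y * |x - y| := by
  have hK := hm.const_nonneg hN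
  rcases eq_or_ne y 0 with rfl | hy
  · have := hm.pos hs hN 0
    simp; positivity
  have hy0 : 0 < |y| := abs_pos.mpr hy
  have hdiff : Differentiable ℝ m := hm.smooth.differentiable (by simp)
  have hb : ∀ z ∈ uIcc y x, ‖deriv m z‖ ≤ 8 * (4 * K + 1) * m y / |y| := by
    intro z hz
    have h1 : |z - y| ≤ |x - y| := abs_sub_left_of_mem_uIcc hz
    have h2 : |y| / 2 ≤ |z| := by
      have := abs_sub_abs_le_abs_sub y z
      rw [abs_sub_comm] at this; linarith
    have h3 := hm.abs_deriv_mul_le hs hs1 hN z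
    have h4 : m z ≤ m (y / 2) := hm.anti (by rw [abs_div]; simpa using h2)
    have h5 := hm.abs_mul_le hs hN (x := y / 2) (y := y)
      (by rw [abs_div]; simp only [Nat.abs_ofNat]; linarith)
    rw [abs_div, Nat.abs_ofNat] at h5
    have h6 : m (y / 2) ≤ 4 * m y := by
      by_contra hc
      push Not at hc
      nlinarith
    rw [Real.norm_eq_abs, le_div_iff₀ hy0]
    have h7 : |deriv m z| * (|y| / 2) ≤ |deriv m z| * |z| := by gcongr
    have h8 : (4 * K + 1) * m z ≤ (4 * K + 1) * (4 * m y) := by gcongr; exact h4.trans h6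
    linarith
  have := Convex.norm_image_sub_le_of_norm_deriv_le (s := uIcc y x) (x := y) (y := x)
    (fun z _ => hdiff z) hb (convex_uIcc y x) left_mem_uIcc right_mem_uIcc
  rw [Real.norm_eq_abs, Real.norm_eq_abs] at this
  calc _ ≤ (8 * (4 * K + 1) * m y / |y| * |x - y|) * |y| := by gcongr
    _ = _ := by field_simp

/-- The constant in the first commutator estimate. -/
def commConst (K : ℝ) : ℝ := 32 * (4 * K + 1) + 48

theorem commConst_pos {K : ℝ} (hK : 0 ≤ K) : 0 < commConst K := by
  unfold commConst; positivity

/-- Order the frequencies so that |x| ≤ |y|. If |y| ≤ N/2 all symbols are 1 and the difference is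
zero. If |x| ≤ min(N, |y|/2) then m(x) = 1, and the mean value bound gains |x|/|y|, which with |y| >
N/2 yields 1/N. Otherwise |x| ≥ N/4, and no cancellation is needed because |x| m(x) ≥ N/8 already
pays for the factor N. -/
theorem abs_add_mul_abs_sub_le (hm : IsSymbol s N K m) (hs : 1 / 4 ≤ s) (hs1 : s ≤ 1)
    (hN : 1 ≤ N) (x y : ℝ) :
    |x + y| * |m (x + y) - m x * m y| ≤ commConst K / N * (|x| * |y| * (m x * m y)) := by
  wlog h : |x| ≤ |y| generalizing x y
  · have := this y x (le_of_not_ge h)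
    rw [add_comm x y, mul_comm (m x), mul_comm |x|]; exact this
  have hK := hm.const_nonneg hN
  have hx0 := hm.pos hs hN x
  have hy0 := hm.pos hs hN y
  have hz0 := hm.pos hs hN (x + y)
  have hz : |x + y| ≤ 2 * |y| := (abs_add_le x y).trans (by linarith)
  have hNpos : 0 < N := by linarith
  rw [div_mul_eq_mul_div, le_div_iff₀ hNpos]
  rcases le_or_gt |y| (N / 2) with hy | hy
  · rw [hm.low x (by linarith), hm.low y (by linarith), hm.low (x + y) (by linarith)]
    have := commConst_pos hK
    simp; positivity
  by_cases hc : |x| ≤ N ∧ |x| ≤ |y| / 2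
  · have h1 := hm.abs_sub_mul_le hs hs1 hN (x := x + y) (y := y) (by simpa using hc.2)
    rw [hm.low x hc.1, one_mul]
    simp only [add_sub_cancel_right] at h1
    have h2 : |x + y| * |m (x + y) - m y| ≤ 2 * (8 * (4 * K + 1) * m y * |x|) := by
      calc _ ≤ (2 * |y|) * |m (x + y) - m y| := by gcongr
        _ = 2 * (|m (x + y) - m y| * |y|) := by ring
        _ ≤ _ := by gcongr
    calc _ ≤ 2 * (8 * (4 * K + 1) * m y * |x|) * (2 * |y|) := by
            apply mul_le_mul h2 (by linarith) hNpos.le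
            positivity
      _ = 32 * (4 * K + 1) * (|x| * |y| * m y) := by ring
      _ ≤ _ := by unfold commConst; gcongr; linarith
  · have hx4 : N / 4 ≤ |x| := by
      by_contra hcon
      push Not at hcon
      exact hc ⟨by linarith, by linarith⟩
    have h1 := hm.abs_mul_le hs hN (x := x + y) (y := 2 * y) (by rw [abs_mul]; simpa using hz)
    have h2 : m (2 * y) ≤ m y := hm.anti (by rw [abs_mul]; simp only [Nat.abs_ofNat]; linarith [abs_nonneg y])
    rw [abs_mul, Nat.abs_ofNat] at h1
    have h3 := hm.abs_mul_le hs hN (x := N / 4) (y := x)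
      (by rw [abs_of_pos (by positivity)]; exact hx4)
    rw [hm.low (N / 4) (by rw [abs_of_pos (by positivity)]; linarith), abs_of_pos (by positivity)] at h3
    have hx1 := hm.le_one hN x
    have h4 : |m (x + y) - m x * m y| ≤ m (x + y) + m x * m y := by
      rw [abs_le]; constructor <;> nlinarith [mul_pos hx0 hy0]
    have hyy := abs_nonneg y
    have h5 : |x + y| * |m (x + y) - m x * m y| ≤ 6 * (|y| * m y) := by
      calc _ ≤ |x + y| * (m (x + y) + m x * m y) := by gcongr
        _ = |x + y| * m (x + y) + |x + y| * (m x * m y) := by ring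
        _ ≤ 2 * (2 * |y| * m y) + 2 * |y| * (1 * m y) := by
            refine add_le_add (h1.trans ?_) ?_
            · gcongr
            · gcongr
        _ = _ := by ring
    calc _ ≤ 6 * (|y| * m y) * (8 * (|x| * m x)) := by
          apply mul_le_mul h5 (by linarith) hNpos.le
          positivity
      _ = 48 * (|x| * |y| * (m x * m y)) := by ring
      _ ≤ _ := by unfold commConst; gcongr; nlinarith

/-- The constant in the second commutator estimate. -/
def commConst' (K : ℝ) : ℝ := 4 * commConst K + 512

theorem commConst'_pos {K : ℝ} (hK : 0 ≤ K) : 0 < commConst' K := by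
  have := commConst_pos hK
  unfold commConst'; positivity

/-- If |y| ≤ 4|x + y|, divide the first commutator estimate by |x + y|, since ⟨z⟩/z² ≤ 16 ⟨y⟩/y².
The hard case is two comparable high frequencies with a much lower sum z, where a division by |z| is
too expensive. There m(z)²⟨z⟩ is compared directly with the inputs: its square is at most a constant
times N⁻⁴ (|x|³ m(x)⁴)(|y|³ m(y)⁴), by the almost monotonicity of |ξ|³ m⁴. -/
theorem sq_sub_mul_bracket_le (hm : IsSymbol s N K m) (hs : 1 / 4 ≤ s) (hs1 : s ≤ 1)
    (hN : 1 ≤ N) (x y : ℝ) :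
    (m (x + y) - m x * m y) ^ 2 * bracket (x + y) ≤
      (commConst' K / N) ^ 2 * (bracket x ^ 2 * bracket y * (m x * m y) ^ 2) := by
  have hK := hm.const_nonneg hN
  have hC := commConst_pos hK
  have hx0 := hm.pos hs hN x
  have hy0 := hm.pos hs hN y
  have hz0 := hm.pos hs hN (x + y)
  have hNpos : 0 < N := by linarith
  have hbx := bracket_pos x
  have hby := bracket_pos y
  have hbz := bracket_pos (x + y)
  rcases le_or_gt |y| (4 * |x + y|) with hy | hy
  · have hA := hm.abs_add_mul_abs_sub_le hs hs1 hN x y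
    set z := x + y
    have h1 : bracket z * y ^ 2 ≤ 16 * (bracket y * z ^ 2) := by
      rw [← sq_abs y, ← sq_abs z]
      rcases le_total |z| |y| with h | h
      · have h2 := bracket_mono h
        have h3 : |y| ^ 2 ≤ 16 * |z| ^ 2 := by nlinarith [abs_nonneg y]
        nlinarith [mul_le_mul h2 h3 (by positivity) hby.le]
      · have h2 : bracket z * |y| ≤ bracket y * |z| := by
          refine le_of_pow_le_pow_left₀ (n := 2) (by norm_num) (by positivity) ?_
          rw [mul_pow, mul_pow, bracket_sq, bracket_sq, sq_abs, sq_abs]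
          nlinarith [sq_le_sq.mpr h]
        have h3 := abs_nonneg y
        have h4 := abs_nonneg z
        calc bracket z * |y| ^ 2 = bracket z * |y| * |y| := by ring
          _ ≤ bracket y * |z| * |z| := by gcongr
          _ ≤ _ := by nlinarith [mul_nonneg hby.le (sq_nonneg |z|)]
    rcases eq_or_ne z 0 with hz | hz
    · have hy' : y = 0 := by
        rw [hz, abs_zero, mul_zero] at hy; exact abs_eq_zero.mp (le_antisymm hy (abs_nonneg y))
      have hx' : x = 0 := by simpa [z, hy'] using hz
      rw [hz, hx', hy', hm.low 0 (by simpa using hNpos.le)]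
      have := bracket_pos 0
      rw [mul_one, sub_self, zero_pow two_ne_zero, zero_mul]
      positivity
    · have hzp : 0 < z ^ 2 := by positivity
      have h2 : (|z| * |m z - m x * m y|) ^ 2 ≤
          (commConst K / N * (|x| * |y| * (m x * m y))) ^ 2 := by gcongr
      rw [mul_pow, sq_abs, sq_abs, mul_pow, mul_pow, mul_pow, sq_abs, sq_abs] at h2
      have h3 : x ^ 2 ≤ bracket x ^ 2 := by rw [bracket_sq]; linarith
      refine le_of_mul_le_mul_left ?_ hzp
      calc z ^ 2 * ((m z - m x * m y) ^ 2 * bracket z)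
          = z ^ 2 * (m z - m x * m y) ^ 2 * bracket z := by ring
        _ ≤ (commConst K / N) ^ 2 * (x ^ 2 * y ^ 2 * (m x * m y) ^ 2) * bracket z := by gcongr
        _ = (commConst K / N) ^ 2 * (x ^ 2 * (bracket z * y ^ 2) * (m x * m y) ^ 2) := by ring
        _ ≤ (commConst K / N) ^ 2 * (bracket x ^ 2 * (16 * (bracket y * z ^ 2)) *
              (m x * m y) ^ 2) := by gcongr
        _ = z ^ 2 * ((4 * commConst K / N) ^ 2 * (bracket x ^ 2 * bracket y * (m x * m y) ^ 2)) := by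
            ring
        _ ≤ _ := by gcongr; unfold commConst'; linarith
  · have hxl : 3 / 4 * |y| ≤ |x| := by
      have := abs_sub_abs_le_abs_sub y (x + y)
      rw [show y - (x + y) = -x by ring, abs_neg] at this; linarith
    have hxu : |x| ≤ 5 / 4 * |y| := by
      have := abs_sub_abs_le_abs_sub x (x + y)
      rw [show x - (x + y) = -y by ring, abs_neg] at this; linarith
    set z := x + y
    rcases le_or_gt |y| (N / 2) with hyN | hyN
    · rw [hm.low x (by linarith), hm.low y (by linarith), hm.low z (by linarith)]
      rw [mul_one, sub_self, zero_pow two_ne_zero, zero_mul]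
      positivity
    have hypos : 0 < |y| := by linarith
    have hxpos : 0 < |x| := by linarith
    have hzx : |z| ≤ |x| := by linarith
    have hxN : |3 * N / 8| ≤ |x| := by rw [abs_of_pos (by positivity)]; linarith
    have hyN' : |N / 2| ≤ |y| := by rw [abs_of_pos (by positivity)]; exact hyN.le
    have qx := hm.cube_mul_le hs hN hxN
    have qy := hm.cube_mul_le hs hN hyN'
    rw [hm.low _ (by rw [abs_of_pos (by positivity)]; linarith), abs_of_pos (by positivity)] at qx qy
    set X := |x| ^ 3 * m x ^ 4
    set Y := |y| ^ 3 * m y ^ 4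
    have hX : 0 < X := by positivity
    have hY : 0 < Y := by positivity
    -- Any constant above 2 · (512/27) · 16 · 128 would do, where (8/3)³ = 512/27 and 2³ · 16 = 128
    -- come from the lower bounds 3N/8 and N/2 for |x| and |y|. The choice 131072 = 512²/2 leaves a
    -- perfect square after the further factor 2 below.
    have e1 : (m z ^ 2 * bracket z) ^ 2 ≤ (131072 / N ^ 4) * (X * Y) := by
      rw [mul_pow, bracket_sq, div_mul_eq_mul_div, le_div_iff₀ (by positivity)]
      rcases le_or_gt |z| N with hzN | hzN
      · have h1 := hm.le_one hN z
        have h2 : (m z ^ 2) ^ 2 ≤ 1 := pow_le_one₀ (by positivity) (pow_le_one₀ hz0.le h1)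
        have h3 : 1 + z ^ 2 ≤ 2 * N ^ 2 := by
          rw [← sq_abs z]; nlinarith [abs_nonneg z]
        have h4 : N ^ 3 ≤ 512 / 27 * 16 * X := by linear_combination (512 / 27) * qx
        have h5 : N ^ 3 ≤ 128 * Y := by linear_combination 8 * qy
        calc (m z ^ 2) ^ 2 * (1 + z ^ 2) * N ^ 4 ≤ 1 * (2 * N ^ 2) * N ^ 4 := by gcongr
          _ = 2 * N ^ 6 := by ring
          _ = 2 * (N ^ 3 * N ^ 3) := by ring
          _ ≤ 2 * ((512 / 27 * 16 * X) * (128 * Y)) := by gcongr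
          _ = 2 * (512 / 27 * 16 * 128) * (X * Y) := by ring
          _ ≤ _ := by gcongr; norm_num
      · have hzp : 0 < |z| := by linarith
        have qz := hm.cube_mul_le hs hN hzx
        have h3 : 1 + z ^ 2 ≤ 2 * |z| ^ 2 := by rw [← sq_abs z]; nlinarith
        have h5 : N ^ 3 ≤ 128 * Y := by linear_combination 8 * qy
        calc (m z ^ 2) ^ 2 * (1 + z ^ 2) * N ^ 4 ≤ (m z ^ 2) ^ 2 * (2 * |z| ^ 2) * N ^ 4 := by gcongr
          _ = 2 * (N * (m z ^ 4 * |z| ^ 2)) * N ^ 3 := by ring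
          _ ≤ 2 * (|z| * (m z ^ 4 * |z| ^ 2)) * N ^ 3 := by gcongr
          _ = 2 * (|z| ^ 3 * m z ^ 4) * N ^ 3 := by ring
          _ ≤ 2 * (16 * X) * (128 * Y) := by gcongr
          _ = 4096 * (X * Y) := by ring
          _ ≤ _ := by gcongr; norm_num
    have e2 : m z ^ 2 * bracket z ≤ 512 / N ^ 2 * (x ^ 2 * |y| * (m x * m y) ^ 2) := by
      refine le_of_pow_le_pow_left₀ (n := 2) (by norm_num) (by positivity) (e1.trans ?_)
      have h6 : |y| ≤ 4 / 3 * |x| := by linarith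
      calc 131072 / N ^ 4 * (X * Y) =
          131072 / N ^ 4 * (|x| ^ 3 * |y| ^ 2 * (m x * m y) ^ 4) * |y| := by simp only [X, Y]; ring
        _ ≤ 131072 / N ^ 4 * (|x| ^ 3 * |y| ^ 2 * (m x * m y) ^ 4) * (4 / 3 * |x|) := by gcongr
        _ = 4 / 3 * (131072 / N ^ 4 * (|x| ^ 4 * |y| ^ 2 * (m x * m y) ^ 4)) := by ring
        _ ≤ 2 * (131072 / N ^ 4 * (|x| ^ 4 * |y| ^ 2 * (m x * m y) ^ 4)) := by gcongr; norm_num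
        _ = _ := by rw [← sq_abs x]; ring
    have e3 : x ^ 2 * |y| ≤ bracket x ^ 2 * bracket y := by
      have := abs_le_bracket y
      have h3 : x ^ 2 ≤ bracket x ^ 2 := by rw [bracket_sq]; linarith
      gcongr
    have e4 : bracket z ≤ bracket y := bracket_mono (by linarith)
    have e5 : N ^ 2 ≤ 8 * bracket x ^ 2 := by
      rw [bracket_sq, ← sq_abs x]
      have : 3 / 8 * N ≤ |x| := by linarith
      have := pow_le_pow_left₀ (by positivity) this 2
      rw [mul_pow] at this
      linarith [sq_nonneg N]
    have e6 : (m x * m y) ^ 2 * bracket z ≤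
        8 / N ^ 2 * (bracket x ^ 2 * bracket y * (m x * m y) ^ 2) := by
      rw [div_mul_eq_mul_div, le_div_iff₀ (by positivity)]
      calc _ ≤ (m x * m y) ^ 2 * bracket y * (8 * bracket x ^ 2) := by gcongr
        _ = _ := by ring
    have hW : 0 < bracket x ^ 2 * bracket y * (m x * m y) ^ 2 := by positivity
    calc (m z - m x * m y) ^ 2 * bracket z
        ≤ (m z ^ 2 + (m x * m y) ^ 2) * bracket z := by
          have := mul_pos hz0 (mul_pos hx0 hy0)
          gcongr
          linear_combination 2 * this
      _ = m z ^ 2 * bracket z + (m x * m y) ^ 2 * bracket z := by ring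
      _ ≤ 512 / N ^ 2 * (bracket x ^ 2 * bracket y * (m x * m y) ^ 2) +
          8 / N ^ 2 * (bracket x ^ 2 * bracket y * (m x * m y) ^ 2) := by
          refine add_le_add (e2.trans ?_) e6
          gcongr
      _ = (520 / N ^ 2) * (bracket x ^ 2 * bracket y * (m x * m y) ^ 2) := by ring
      _ ≤ _ := by
          rw [div_pow]
          gcongr
          have : 512 ≤ commConst' K := by unfold commConst'; linarith
          calc (520 : ℝ) ≤ 512 ^ 2 := by norm_num
            _ ≤ _ := by gcongr

theorem abs_sub_mul_sqrt_le (hm : IsSymbol s N K m) (hs : 1 / 4 ≤ s) (hs1 : s ≤ 1)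
    (hN : 1 ≤ N) (x y : ℝ) :
    |m (x + y) - m x * m y| * √(bracket (x + y)) ≤
      commConst' K / N * (bracket x * √(bracket y) * (m x * m y)) := by
  have hC := commConst'_pos (hm.const_nonneg hN)
  have hx0 := hm.pos hs hN x
  have hy0 := hm.pos hs hN y
  have hbx := bracket_pos x
  have hby := bracket_pos y
  refine le_of_pow_le_pow_left₀ (n := 2) (by norm_num) (by positivity) ?_
  have := hm.sq_sub_mul_bracket_le hs hs1 hN x y
  rw [mul_pow, sq_abs, Real.sq_sqrt (bracket_pos _).le, mul_pow, mul_pow, mul_pow (bracket x),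
    Real.sq_sqrt hby.le]
  exact this

theorem abs_sub_le (hm : IsSymbol s N K m) (hs : 1 / 4 ≤ s) (hs1 : s ≤ 1)
    (hN : 1 ≤ N) (x y : ℝ) :
    |m (x + y) - m x * m y| ≤ commConst' K / N * (bracket x * bracket y * (m x * m y)) := by
  have hC := commConst'_pos (hm.const_nonneg hN)
  have hx0 := hm.pos hs hN x
  have hy0 := hm.pos hs hN y
  have hbx := bracket_pos x
  have hby := one_le_bracket y
  have h1 : 1 ≤ √(bracket (x + y)) := Real.one_le_sqrt.mpr (one_le_bracket _)
  have h2 : √(bracket y) ≤ bracket y := Real.sqrt_le_self_iff.mpr (Or.inr hby)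
  calc _ ≤ |m (x + y) - m x * m y| * √(bracket (x + y)) := le_mul_of_one_le_right (abs_nonneg _) h1
    _ ≤ _ := hm.abs_sub_mul_sqrt_le hs hs1 hN x y
    _ ≤ _ := by gcongr

end IsSymbol
end SBO
end

/-! ### Bounds for the symbols of the trilinear terms -/

noncomputable section

namespace SBO

/-- The weight `|y| ⟨x⟩ ⟨x + y⟩` of the trilinear estimate. -/
def triWeight (x y : ℝ) : ℝ := |y| * (bracket x * bracket (x + y))

theorem triWeight_nonneg (x y : ℝ) : 0 ≤ triWeight x y := by
  have := bracket_pos x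
  have := bracket_pos (x + y)
  unfold triWeight; positivity

theorem continuous_triWeight : Continuous fun p : ℝ × ℝ => triWeight p.1 p.2 := by
  have := continuous_bracket
  unfold triWeight
  fun_prop

/-- The product of the symbol at the three frequencies of a trilinear interaction. -/
def triSymbol (m : ℝ → ℝ) (x y : ℝ) : ℝ := m (x + y) * m x * m y

/-- The symbol of the trilinear part of the energy increment. -/
def energySymbol (ν : ℝ) (m : ℝ → ℝ) (x y : ℝ) : ℝ :=
  ((x + y) ^ 2 * m (x + y) ^ 2 - x ^ 2 * m x ^ 2) - ν * y * |y| * m y ^ 2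
    - triSymbol m x y * ((x + y) ^ 2 - x ^ 2 - ν * y * |y|)

/-- The symbol of the trilinear part of the increment of `L`. -/
def momentumSymbol (m : ℝ → ℝ) (x y : ℝ) : ℝ :=
  ((x + y) * m (x + y) ^ 2 - x * m x ^ 2) - y * m y ^ 2

namespace IsSymbol

variable {s N K : ℝ} {m : ℝ → ℝ}

theorem inv_le (hm : IsSymbol s N K m) (hs : 1 / 4 ≤ s) (hN : 1 ≤ N) (x : ℝ) :
    (m x)⁻¹ ≤ 2 * bracket x := by
  have := hm.half_le_bracket_mul hs hN x
  rw [inv_le_iff_one_le_mul₀ (hm.pos hs hN x)]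
  linarith

theorem triSymbol_pos (hm : IsSymbol s N K m) (hs : 1 / 4 ≤ s) (hN : 1 ≤ N) (x y : ℝ) :
    0 < triSymbol m x y := by
  have := hm.pos hs hN x
  have := hm.pos hs hN y
  have := hm.pos hs hN (x + y)
  unfold triSymbol; positivity

theorem comm_first (hm : IsSymbol s N K m) (hs : 1 / 4 ≤ s) (hs1 : s ≤ 1) (hN : 1 ≤ N)
    (x y : ℝ) : |x + y| * m (x + y) * |m (x + y) - m x * m y| ≤
      commConst K / N * (|x| * |y| * triSymbol m x y) := by
  have h := mul_le_mul_of_nonneg_left (hm.abs_add_mul_abs_sub_le hs hs1 hN x y)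
    (hm.pos hs hN (x + y)).le
  calc _ = m (x + y) * (|x + y| * |m (x + y) - m x * m y|) := by ring
    _ ≤ _ := h
    _ = _ := by unfold triSymbol; ring

/-- `comm_first` at the pair (x + y, -y), whose sum is x; the symbol is even. -/
theorem comm_second (hm : IsSymbol s N K m) (hs : 1 / 4 ≤ s) (hs1 : s ≤ 1) (hN : 1 ≤ N)
    (x y : ℝ) : |x| * m x * |m x - m (x + y) * m y| ≤
      commConst K / N * (|x + y| * |y| * triSymbol m x y) := by
  have h := hm.comm_first hs hs1 hN (x + y) (-y)
  simp only [add_neg_cancel_right, hm.even, abs_neg, triSymbol] at h ⊢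
  exact h.trans_eq (by ring)

theorem comm_third (hm : IsSymbol s N K m) (hs : 1 / 4 ≤ s) (hs1 : s ≤ 1) (hN : 1 ≤ N)
    (x y : ℝ) : |y| * m y * |m y - m (x + y) * m x| ≤
      commConst K / N * (|x + y| * |x| * triSymbol m x y) := by
  have h := hm.comm_second hs hs1 hN y x
  unfold triSymbol at h ⊢
  rw [add_comm y x] at h
  exact h.trans_eq (by ring)

theorem abs_mul_mul_le_triWeight (x y : ℝ) : |x + y| * |x| * |y| ≤ triWeight x y := by
  have h1 := abs_le_bracket x
  have h2 := abs_le_bracket (x + y)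
  have h3 := bracket_pos x
  have := mul_le_mul h1 h2 (abs_nonneg _) h3.le
  unfold triWeight
  nlinarith [mul_le_mul_of_nonneg_left this (abs_nonneg y)]

/-- Distributing the resonance term gives each of the three squares its own commutator. Of its two
frequency factors, one feeds the commutator estimate, which returns the other two frequencies; the
remaining one completes the symmetric product |x + y||x||y|. -/
theorem abs_energySymbol_le (hm : IsSymbol s N K m) (hs : 1 / 4 ≤ s) (hs1 : s ≤ 1) (hN : 1 ≤ N)
    {ν : ℝ} (hν : 0 ≤ ν) (x y : ℝ) :
    |energySymbol ν m x y| ≤ (2 + ν) * commConst K / N * (triWeight x y * triSymbol m x y) := by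
  have hC := commConst_pos (hm.const_nonneg hN)
  have hT := hm.triSymbol_pos hs hN x y
  have hNpos : 0 < N := by linarith
  have h1 := mul_le_mul_of_nonneg_left (hm.comm_first hs hs1 hN x y) (abs_nonneg (x + y))
  have h2 := mul_le_mul_of_nonneg_left (hm.comm_second hs hs1 hN x y) (abs_nonneg x)
  have h3 := mul_le_mul_of_nonneg_left (hm.comm_third hs hs1 hN x y)
    (mul_nonneg hν (abs_nonneg y))
  have p1 := hm.pos hs hN x
  have p2 := hm.pos hs hN y
  have p3 := hm.pos hs hN (x + y)
  have e : energySymbol ν m x y =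
      (x + y) * (x + y) * m (x + y) * (m (x + y) - m x * m y)
        - x * x * m x * (m x - m (x + y) * m y)
        - ν * y * |y| * m y * (m y - m (x + y) * m x) := by
    unfold energySymbol triSymbol; ring
  have hW := abs_mul_mul_le_triWeight x y
  rw [e]
  refine (abs_sub _ _).trans ((add_le_add_left (abs_sub _ _) _).trans ?_)
  simp only [abs_mul, abs_abs, abs_of_pos p1, abs_of_pos p2, abs_of_pos p3, abs_of_nonneg hν]
  calc _ ≤ (2 + ν) * commConst K / N * ((|x + y| * |x| * |y|) * triSymbol m x y) := by
        refine (add_le_add (add_le_add ?_ ?_) ?_).trans_eq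
          (b := |x + y| * (commConst K / N * (|x| * |y| * triSymbol m x y))
            + |x| * (commConst K / N * (|x + y| * |y| * triSymbol m x y))
            + ν * |y| * (commConst K / N * (|x + y| * |x| * triSymbol m x y))) (by ring)
        · exact le_trans (le_of_eq (by ring)) h1
        · exact le_trans (le_of_eq (by ring)) h2
        · exact le_trans (le_of_eq (by ring)) h3
    _ ≤ _ := by gcongr

/-- Since (x + y) - x - y = 0, a multiple of `triSymbol` can be subtracted at no cost, and three
commutators appear. The term with prefactor y must keep its |y|, which is part of `triWeight`, so it
uses `abs_sub_le`, the bound that consumes no derivative on the left. -/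
theorem abs_momentumSymbol_le (hm : IsSymbol s N K m) (hs : 1 / 4 ≤ s) (hs1 : s ≤ 1)
    (hN : 1 ≤ N) (x y : ℝ) :
    |momentumSymbol m x y| ≤
      (2 * commConst K + commConst' K) / N * (triWeight x y * triSymbol m x y) := by
  have hC := commConst_pos (hm.const_nonneg hN)
  have hC' := commConst'_pos (hm.const_nonneg hN)
  have hT := hm.triSymbol_pos hs hN x y
  have hNpos : 0 < N := by linarith
  have p1 := hm.pos hs hN x
  have p2 := hm.pos hs hN y
  have p3 := hm.pos hs hN (x + y)
  have h1 := hm.comm_first hs hs1 hN x y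
  have h2 := hm.comm_second hs hs1 hN x y
  have h3 := hm.abs_sub_le hs hs1 hN (x + y) (-x)
  simp only [add_neg_cancel_comm, hm.even, bracket_neg] at h3
  have h3' := mul_le_mul_of_nonneg_left h3 (mul_nonneg (abs_nonneg y) p2.le)
  have e : momentumSymbol m x y =
      (x + y) * m (x + y) * (m (x + y) - m x * m y)
        - x * m x * (m x - m (x + y) * m y) - y * m y * (m y - m (x + y) * m x) := by
    unfold momentumSymbol; ring
  have b1 := bracket_pos x
  have b2 := bracket_pos (x + y)
  have w1 : |x| * |y| ≤ triWeight x y := by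
    unfold triWeight
    have := mul_le_mul (abs_le_bracket x) (one_le_bracket (x + y)) zero_le_one b1.le
    nlinarith [mul_le_mul_of_nonneg_left this (abs_nonneg y)]
  have w2 : |x + y| * |y| ≤ triWeight x y := by
    unfold triWeight
    have := mul_le_mul (one_le_bracket x) (abs_le_bracket (x + y)) (abs_nonneg _) b1.le
    nlinarith [mul_le_mul_of_nonneg_left this (abs_nonneg y)]
  rw [e]
  refine (abs_sub _ _).trans ((add_le_add_left (abs_sub _ _) _).trans ?_)
  simp only [abs_mul, abs_of_pos p1, abs_of_pos p2, abs_of_pos p3]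
  calc _ ≤ commConst K / N * (triWeight x y * triSymbol m x y)
        + commConst K / N * (triWeight x y * triSymbol m x y)
        + commConst' K / N * (triWeight x y * triSymbol m x y) := by
        refine add_le_add (add_le_add (h1.trans ?_) (h2.trans ?_)) (h3'.trans_eq ?_)
        · gcongr
        · gcongr
        · unfold triWeight triSymbol; ring
    _ = _ := by ring

/-- The growing weight `x² m(x)²`. -/
theorem abs_sq_sub_sq_le (hm : IsSymbol s N K m) (hs : 1 / 4 ≤ s) (hs1 : s ≤ 1) (hN : 1 ≤ N)
    (x y : ℝ) : |(x + y) ^ 2 * m (x + y) ^ 2 - x ^ 2 * m x ^ 2| ≤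
      (2 * commConst K + 2) * (triWeight x y * triSymbol m x y) := by
  have hC := commConst_pos (hm.const_nonneg hN)
  have hT := hm.triSymbol_pos hs hN x y
  -- With ν = 0 the energy symbol is the present difference minus `triSymbol` times (x + y)² - x² =
  -- y(2x + y). No gain in N is needed here: the bound serves absolute convergence.
  have h := hm.abs_energySymbol_le hs hs1 hN le_rfl x y
  have hW := triWeight_nonneg x y
  have e : (x + y) ^ 2 * m (x + y) ^ 2 - x ^ 2 * m x ^ 2 =
      energySymbol 0 m x y + triSymbol m x y * ((x + y) ^ 2 - x ^ 2) := by
    unfold energySymbol; ring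
  have b1 := bracket_pos x
  have b2 := bracket_pos (x + y)
  have h2 : |(x + y) ^ 2 - x ^ 2| ≤ 2 * triWeight x y := by
    rw [show (x + y) ^ 2 - x ^ 2 = y * ((x + y) + x) by ring, abs_mul]
    unfold triWeight
    have h3 := abs_add_le (x + y) x
    have h4 := abs_le_bracket x
    have h5 := abs_le_bracket (x + y)
    have h6 : |x + y + x| ≤ 2 * (bracket x * bracket (x + y)) := by
      nlinarith [one_le_bracket x, one_le_bracket (x + y)]
    nlinarith [mul_le_mul_of_nonneg_left h6 (abs_nonneg y)]
  rw [e]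
  refine (abs_add_le _ _).trans ?_
  rw [abs_mul, abs_of_pos hT, add_mul]
  refine add_le_add (h.trans ?_) ?_
  · rw [add_zero]
    gcongr
    exact div_le_self (by positivity) hN
  · nlinarith

/-- One factor m(y) is split as its commutator with m(x + y) m(x) plus that product, and the
commutator bounds are used with 1/N ≤ 1. Multiplied by |y|, this puts the Benjamin-Ono part of the
energy within reach of the trilinear estimate. -/
theorem bracket_mul_sq_le (hm : IsSymbol s N K m) (hs : 1 / 4 ≤ s) (hs1 : s ≤ 1)
    (hN : 1 ≤ N) (x y : ℝ) : bracket y * m y ^ 2 ≤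
      (commConst K + commConst' K + 3) * (bracket x * bracket (x + y) * triSymbol m x y) := by
  have hC := commConst_pos (hm.const_nonneg hN)
  have hC' := commConst'_pos (hm.const_nonneg hN)
  have p1 := hm.pos hs hN x
  have p2 := hm.pos hs hN y
  have p3 := hm.pos hs hN (x + y)
  have b1 := one_le_bracket x
  have b2 := one_le_bracket (x + y)
  have h1 := hm.abs_add_mul_abs_sub_le hs hs1 hN (x + y) (-x)
  have h2 := hm.abs_sub_le hs hs1 hN (x + y) (-x)
  simp only [add_neg_cancel_comm, hm.even, bracket_neg, abs_neg] at h1 h2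
  set M := m (x + y) * m x
  have hM : 0 < M := mul_pos p3 p1
  have hB : 1 ≤ bracket x * bracket (x + y) := one_le_mul_of_one_le_of_one_le b1 b2
  have h3 : |x + y| * |x| ≤ bracket x * bracket (x + y) := by
    rw [mul_comm]
    exact mul_le_mul (abs_le_bracket _) (abs_le_bracket _) (abs_nonneg _) (by linarith)
  have h4 : |y| ≤ 2 * (bracket x * bracket (x + y)) := by
    have := abs_sub (x + y) x
    rw [add_sub_cancel_left] at this
    nlinarith [abs_le_bracket x, abs_le_bracket (x + y)]
  have h5 : |y| * m y ≤ (commConst K + 2) * (bracket x * bracket (x + y) * M) := by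
    calc |y| * m y ≤ |y| * (|m y - M| + M) := by gcongr; linarith [le_abs_self (m y - M)]
      _ = |y| * |m y - M| + |y| * M := by ring
      _ ≤ commConst K * (bracket x * bracket (x + y) * M)
          + 2 * (bracket x * bracket (x + y)) * M := by
          refine add_le_add (h1.trans ?_) (by gcongr)
          gcongr
          exact div_le_self hC.le hN
      _ = _ := by ring
  have h6 : m y ≤ (commConst' K + 1) * (bracket x * bracket (x + y) * M) := by
    calc m y ≤ |m y - M| + M := by linarith [le_abs_self (m y - M)]
      _ ≤ commConst' K * (bracket x * bracket (x + y) * M)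
          + (bracket x * bracket (x + y)) * M := by
          refine add_le_add (h2.trans ?_) (le_mul_of_one_le_left hM.le hB)
          rw [mul_comm (bracket (x + y))]
          gcongr
          exact div_le_self hC'.le hN
      _ = _ := by ring
  have h7 : bracket y ≤ |y| + 1 := by
    refine Real.sqrt_le_iff.mpr ⟨by positivity, ?_⟩
    nlinarith [sq_abs y, abs_nonneg y]
  calc bracket y * m y ^ 2 ≤ (|y| + 1) * m y ^ 2 := by gcongr
    _ = (|y| * m y + m y) * m y := by ring
    _ ≤ ((commConst K + 2) * (bracket x * bracket (x + y) * M) +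
          (commConst' K + 1) * (bracket x * bracket (x + y) * M)) * m y := by gcongr
    _ = _ := by unfold triSymbol; ring

/-- The same splitting. It makes ⟨ξ⟩^(1/2) m(ξ) (uv)^(ξ) bounded by the H¹ norm of Iu and the
H^(1/2) norm of Iv. -/
theorem mul_sqrt_le (hm : IsSymbol s N K m) (hs : 1 / 4 ≤ s) (hs1 : s ≤ 1) (hN : 1 ≤ N)
    (x y : ℝ) : m (x + y) * √(bracket (x + y)) ≤
      (commConst' K + 2) * (bracket x * √(bracket y) * (m x * m y)) := by
  have hC' := commConst'_pos (hm.const_nonneg hN)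
  have p1 := hm.pos hs hN x
  have p2 := hm.pos hs hN y
  have h := hm.abs_sub_mul_sqrt_le hs hs1 hN x y
  have b1 := bracket_pos x
  have b2 := bracket_pos y
  have h2 : √(bracket (x + y)) ≤ 2 * (bracket x * √(bracket y)) := by
    rw [Real.sqrt_le_iff]
    refine ⟨by positivity, (bracket_add_le x y).trans ?_⟩
    rw [mul_pow, mul_pow, Real.sq_sqrt b2.le]
    nlinarith [mul_pos b1 b2, mul_le_mul_of_nonneg_right (one_le_bracket x) (mul_pos b1 b2).le]
  calc _ ≤ (|m (x + y) - m x * m y| + m x * m y) * √(bracket (x + y)) := by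
        gcongr; linarith [le_abs_self (m (x + y) - m x * m y)]
    _ = |m (x + y) - m x * m y| * √(bracket (x + y)) + m x * m y * √(bracket (x + y)) := by ring
    _ ≤ commConst' K * (bracket x * √(bracket y) * (m x * m y)) +
        m x * m y * (2 * (bracket x * √(bracket y))) := by
        refine add_le_add (h.trans ?_) (by gcongr)
        gcongr
        exact div_le_self hC'.le hN
    _ = _ := by ring

/-- For |x| > N, almost monotonicity gives (x² m²)² = |x| · |x|³ m⁴ ≥ |x| N³/16. Hence x² m² tends
to infinity and is a usable truncation parameter. -/
theorem bounded_of_sq_mul_sq_le (hm : IsSymbol s N K m) (hs : 1 / 4 ≤ s) (hN : 1 ≤ N) {R : ℝ}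
    {x : ℝ} (hx : x ^ 2 * m x ^ 2 ≤ R) : |x| ≤ max N (16 * R ^ 2) := by
  by_contra hc
  push Not at hc
  obtain ⟨h1, h2⟩ := max_lt_iff.mp hc
  have hN1 : |N| = N := abs_of_pos (by linarith)
  have := hm.cube_mul_le hs hN (x := N) (y := x) (by rw [hN1]; exact h1.le)
  rw [hm.low N hN1.le, hN1] at this
  have h3 : |x| ^ 3 * m x ^ 4 * |x| ≤ R ^ 2 := by
    calc _ = (|x| ^ 2 * m x ^ 2) ^ 2 := by ring
      _ ≤ R ^ 2 := by rw [sq_abs]; gcongr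
  have h4 : (1 : ℝ) ≤ N ^ 3 := one_le_pow₀ hN
  have h5 : 0 < |x| := by linarith
  nlinarith

end IsSymbol
end SBO
end

noncomputable section

namespace SBO

/-! ### Functions representing a distribution -/

theorem Represents.locallyIntegrable {T : 𝓢'(ℝ, ℂ)} {F : ℝ → ℂ} (h : Represents T F) :
    LocallyIntegrable F := by
  rw [locallyIntegrable_iff]
  intro k hk
  obtain ⟨φ, hφ1, hφ0, hφ⟩ : ∃ φ : ℝ → ℝ, HasCompactSupport φ ∧ ContDiff ℝ (⊤ : ℕ∞) φ ∧
      ∀ x ∈ k, φ x = 1 := by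
    obtain ⟨r, hr⟩ := hk.isBounded.subset_closedBall (0 : ℝ)
    let B : ContDiffBump (0 : ℝ) := ⟨|r| + 1, |r| + 2, by positivity, by linarith⟩
    refine ⟨B, B.hasCompactSupport, B.contDiff, fun x hx => B.one_of_mem_closedBall ?_⟩
    exact Metric.closedBall_subset_closedBall (by simp only [B]; linarith [le_abs_self r]) (hr hx)
  have hc : ContDiff ℝ (⊤ : ℕ∞) (fun x => (φ x : ℂ)) := Complex.ofRealCLM.contDiff.comp hφ0
  have hs : HasCompactSupport (fun x => (φ x : ℂ)) :=
    hφ1.comp_left (g := Complex.ofReal) Complex.ofReal_zero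
  have := (h (hs.toSchwartzMap hc)).1.integrableOn (s := k)
  refine (integrableOn_congr_fun (fun x hx => ?_) hk.measurableSet).mp this
  simp [hφ x hx]

theorem Represents.ae_eq {T : 𝓢'(ℝ, ℂ)} {F G : ℝ → ℂ} (hF : Represents T F)
    (hG : Represents T G) : F =ᵐ[volume] G := by
  refine ae_eq_of_integral_contDiff_smul_eq hF.locallyIntegrable hG.locallyIntegrable ?_
  intro φ hφ hφc
  have hc : ContDiff ℝ (⊤ : ℕ∞) (fun x => (φ x : ℂ)) := Complex.ofRealCLM.contDiff.comp hφ
  have hs : HasCompactSupport (fun x => (φ x : ℂ)) :=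
    hφc.comp_left (g := Complex.ofReal) Complex.ofReal_zero
  have h1 := (hF (hs.toSchwartzMap hc)).2
  have h2 := (hG (hs.toSchwartzMap hc)).2
  simp only [Complex.real_smul]
  simpa using h1.symm.trans h2

theorem Represents.congr {T : 𝓢'(ℝ, ℂ)} {F G : ℝ → ℂ} (hF : Represents T F)
    (h : F =ᵐ[volume] G) : Represents T G := by
  intro φ
  have h2 : (fun x => φ x * F x) =ᵐ[volume] fun x => φ x * G x := by
    filter_upwards [h] with x hx; rw [hx]
  exact ⟨(hF φ).1.congr h2, (hF φ).2.trans (integral_congr_ae h2)⟩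

theorem Represents.toFun_ae {T : 𝓢'(ℝ, ℂ)} {F : ℝ → ℂ} (h : Represents T F) :
    toFun T =ᵐ[volume] F := by
  have hex : ∃ F, Represents T F := ⟨F, h⟩
  unfold toFun
  rw [dif_pos hex]
  exact hex.choose_spec.ae_eq h

theorem two_pi_ne_zero : 2 * Real.pi ≠ 0 := by positivity

theorem ae_comp_mul {p : ℝ → Prop} (h : ∀ᵐ x : ℝ, p x) {a : ℝ} (ha : a ≠ 0) :
    ∀ᵐ x : ℝ, p (a * x) := by
  have hq : Measure.QuasiMeasurePreserving (fun x : ℝ => a * x) volume volume := by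
    refine ⟨measurable_const_mul a, ?_⟩
    rw [Real.map_volume_mul_left ha]
    exact Measure.smul_absolutelyContinuous
  exact hq.ae h

theorem HasFourier.ae_eq {T : 𝓢'(ℝ, ℂ)} {F G : ℝ → ℂ} (hF : HasFourier T F)
    (hG : HasFourier T G) : F =ᵐ[volume] G := by
  have h := ae_comp_mul (Represents.ae_eq hF hG) (inv_ne_zero two_pi_ne_zero)
  filter_upwards [h] with x hx
  have hsq : (√(2 * Real.pi) : ℂ) ≠ 0 := by
    rw [Complex.ofReal_ne_zero]; positivity
  rw [mul_inv_cancel_left₀ two_pi_ne_zero] at hx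
  exact mul_left_cancel₀ hsq hx

theorem HasFourier.congr {T : 𝓢'(ℝ, ℂ)} {F G : ℝ → ℂ} (hF : HasFourier T F)
    (h : F =ᵐ[volume] G) : HasFourier T G := by
  refine Represents.congr hF ?_
  filter_upwards [ae_comp_mul h two_pi_ne_zero] with x hx
  rw [hx]

theorem HasFourier.hat_ae {T : 𝓢'(ℝ, ℂ)} {F : ℝ → ℂ} (h : HasFourier T F) :
    hat T =ᵐ[volume] F := by
  have hex : ∃ F, HasFourier T F := ⟨F, h⟩
  unfold hat
  rw [dif_pos hex]
  exact hex.choose_spec.ae_eq h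

/-! ### Multipliers -/

theorem Represents.smulLeft {T : 𝓢'(ℝ, ℂ)} {F : ℝ → ℂ} (h : Represents T F) {g : ℝ → ℂ}
    (hg : g.HasTemperateGrowth) :
    Represents (TemperedDistribution.smulLeftCLM ℂ g T) (fun x => g x * F x) := by
  intro φ
  have := h (SchwartzMap.smulLeftCLM ℂ g φ)
  simp only [SchwartzMap.smulLeftCLM_apply_apply hg, smul_eq_mul] at this
  rw [TemperedDistribution.smulLeftCLM_apply_apply]
  have e : (fun x => φ x * (g x * F x)) = fun x => g x * φ x * F x := by ext x; ring
  rw [e]; exact this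

/-- I is invertible on tempered distributions when m and 1/m are both tempered multipliers, so the
transform of u is recovered from that of Iu by division. -/
theorem HasFourier.of_smoothing {T : 𝓢'(ℝ, ℂ)} {m : ℝ → ℝ} {F : ℝ → ℂ} (hm0 : ∀ x, m x ≠ 0)
    (hm : (fun k : ℝ => (m (2 * Real.pi * k) : ℂ)).HasTemperateGrowth)
    (hm' : (fun k : ℝ => ((m (2 * Real.pi * k))⁻¹ : ℂ)).HasTemperateGrowth)
    (h : HasFourier (smoothing m T) F) : HasFourier T (fun ξ => (m ξ : ℂ)⁻¹ * F ξ) := by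
  unfold HasFourier smoothing at h
  rw [TemperedDistribution.fourierMultiplierCLM_apply, FourierTransform.fourier_fourierInv_eq] at h
  have h2 := h.smulLeft hm'
  rw [TemperedDistribution.smulLeftCLM_smulLeftCLM_apply hm hm'] at h2
  have e : ((fun k : ℝ => (m (2 * Real.pi * k) : ℂ)) * fun k : ℝ => ((m (2 * Real.pi * k))⁻¹ : ℂ)) =
      fun _ => (1 : ℂ) := by
    ext k; simp [hm0]
  rw [e, TemperedDistribution.smulLeftCLM_const, one_smul] at h2
  unfold HasFourier
  refine h2.congr (Filter.Eventually.of_forall fun x => ?_)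
  simp only
  ring

theorem HasFourier.deriv {T : 𝓢'(ℝ, ℂ)} {F : ℝ → ℂ} (h : HasFourier T F) :
    HasFourier (TemperedDistribution.derivCLM ℂ T) (fun ξ => Complex.I * ξ * F ξ) := by
  have hg : (fun k : ℝ => (2 * Real.pi * Complex.I : ℂ) * k).HasTemperateGrowth := by fun_prop
  have e : 𝓕 (TemperedDistribution.derivCLM ℂ T) =
      TemperedDistribution.smulLeftCLM ℂ (fun k : ℝ => (2 * Real.pi * Complex.I : ℂ) * k) (𝓕 T) := by
    ext φ
    rw [TemperedDistribution.smulLeftCLM_apply_apply, TemperedDistribution.fourier_apply,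
      TemperedDistribution.fourier_apply, TemperedDistribution.derivCLM_apply_apply]
    congr 1
    have h1 := SchwartzMap.lineDerivOp_fourier_eq φ (1 : ℝ)
    have h2 : SchwartzMap.derivCLM ℂ ℂ (𝓕 φ) = LineDeriv.lineDerivOp (1 : ℝ) (𝓕 φ) := by
      ext x
      rw [SchwartzMap.lineDerivOp_apply_eq_fderiv, SchwartzMap.derivCLM_apply]; simp
    rw [h2, h1, ← FourierTransform.fourier_neg]
    congr 1
    ext x
    have hi : (inner ℝ · (1 : ℝ) : ℝ → ℝ).HasTemperateGrowth := by fun_prop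
    rw [SchwartzMap.smulLeftCLM_apply_apply hg, neg_apply, smul_apply,
      SchwartzMap.smulLeftCLM_apply_apply hi]
    simp
    ring
  unfold HasFourier
  rw [e]
  refine (Represents.smulLeft h hg).congr (Filter.Eventually.of_forall fun x => ?_)
  push_cast
  ring

/-! ### Temperate growth of the symbol -/

/-- Smooth functions that are multiples of a power on each side of a compact interval are stable
under differentiation, so polynomial growth of the members of the class is enough. Two constants are
needed because the derivative changes sign on the left half-line. -/
theorem exists_iteratedDeriv_le_of_eq_rpow (n : ℕ) : ∀ (f : ℝ → ℝ) (N C C' r : ℝ), 0 < N →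
    ContDiff ℝ (⊤ : ℕ∞) f → (∀ x, N < x → f x = C * x ^ r) →
    (∀ x, x < -N → f x = C' * (-x) ^ r) →
    ∃ (k : ℕ) (D : ℝ), ∀ x, ‖iteratedDeriv n f x‖ ≤ D * (1 + ‖x‖) ^ k := by
  induction n with
  | zero =>
    intro f N C C' r hN hf h1 h2
    obtain ⟨A, hA⟩ := (isCompact_Icc (a := -N) (b := N)).exists_bound_of_continuousOn
      hf.continuous.continuousOn
    obtain ⟨k, hk⟩ := exists_nat_ge |r|
    have hA0 : 0 ≤ A := (norm_nonneg _).trans (hA 0 ⟨by linarith, hN.le⟩)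
    have hpow : ∀ x : ℝ, N < x → x ^ r ≤ (N ^ r + 1) * (1 + x) ^ k := by
      intro x hx
      have hx0 : 0 < x := hN.trans hx
      have hk1 : (1 : ℝ) ≤ (1 + x) ^ k := one_le_pow₀ (by linarith)
      rcases le_total 0 r with hr | hr
      · have h3 : x ^ r ≤ (1 + x) ^ k := by
          rw [← Real.rpow_natCast]
          exact (Real.rpow_le_rpow hx0.le (by linarith) hr).trans
            (Real.rpow_le_rpow_of_exponent_le (by linarith) ((le_abs_self r).trans hk))
        have : 0 < N ^ r := by positivity
        nlinarith
      · have h3 : x ^ r ≤ N ^ r := Real.rpow_le_rpow_of_nonpos hN hx.le hr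
        have : 0 < N ^ r := by positivity
        nlinarith
    refine ⟨k, A + (|C| + |C'|) * (N ^ r + 1), fun x => ?_⟩
    have hk1 : (1 : ℝ) ≤ (1 + ‖x‖) ^ k := one_le_pow₀ (by simp)
    have hNr : 0 < N ^ r := by positivity
    rw [iteratedDeriv_zero, add_mul]
    by_cases hx1 : N < x
    · rw [h1 x hx1, norm_mul, Real.norm_eq_abs, Real.norm_eq_abs, Real.norm_eq_abs,
        abs_of_pos (hN.trans hx1), abs_of_pos (Real.rpow_pos_of_pos (hN.trans hx1) r)] at *
      have := hpow x hx1
      calc |C| * x ^ r ≤ 0 + (|C| + 0) * ((N ^ r + 1) * (1 + x) ^ k) := by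
            rw [zero_add, add_zero]; gcongr
        _ ≤ A * (1 + x) ^ k + (|C| + |C'|) * ((N ^ r + 1) * (1 + x) ^ k) := by
            gcongr <;> positivity
        _ = _ := by ring
    by_cases hx2 : x < -N
    · have hx3 : N < -x := by linarith
      rw [h2 x hx2, norm_mul, Real.norm_eq_abs, Real.norm_eq_abs, Real.norm_eq_abs,
        abs_of_neg (by linarith : x < 0), abs_of_pos (Real.rpow_pos_of_pos (hN.trans hx3) r)] at *
      have := hpow (-x) hx3
      calc |C'| * (-x) ^ r ≤ 0 + (0 + |C'|) * ((N ^ r + 1) * (1 + -x) ^ k) := by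
            rw [zero_add, zero_add]; gcongr
        _ ≤ A * (1 + -x) ^ k + (|C| + |C'|) * ((N ^ r + 1) * (1 + -x) ^ k) := by
            have : 0 ≤ 1 + -x := by linarith
            gcongr <;> positivity
        _ = _ := by ring
    · push Not at hx1 hx2
      calc ‖f x‖ ≤ A * 1 := by rw [mul_one]; exact hA x ⟨hx2, hx1⟩
        _ ≤ A * (1 + ‖x‖) ^ k := by gcongr
        _ ≤ _ := le_add_of_nonneg_right (by positivity)
  | succ n ih =>
    intro f N C C' r hN hf h1 h2
    simp only [iteratedDeriv_succ']
    refine ih (deriv f) N (C * r) (-(C' * r)) (r - 1) hN ?_ (fun x hx => ?_) (fun x hx => ?_)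
    · exact (contDiff_infty_iff_deriv.mp hf).2
    · have he : f =ᶠ[nhds x] fun x => C * x ^ r := by
        filter_upwards [lt_mem_nhds hx] with y hy using h1 y hy
      have := (Real.hasDerivAt_rpow_const (x := x) (p := r)
        (Or.inl (hN.trans hx).ne')).const_mul C
      rw [he.deriv_eq, this.deriv]; ring
    · have he : f =ᶠ[nhds x] fun x => C' * (-x) ^ r := by
        filter_upwards [gt_mem_nhds hx] with y hy using h2 y hy
      have h3 := ((hasDerivAt_neg x).rpow_const (p := r) (Or.inl (by linarith))).const_mul C'
      rw [he.deriv_eq, h3.deriv]; ring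

theorem hasTemperateGrowth_of_eq_rpow {f : ℝ → ℝ} (hf : ContDiff ℝ (⊤ : ℕ∞) f) {N C r : ℝ}
    (hN : 0 < N) (h : ∀ x, N ≤ |x| → f x = C * |x| ^ r) : f.HasTemperateGrowth := by
  refine ⟨hf, fun n => ?_⟩
  simp only [norm_iteratedFDeriv_eq_norm_iteratedDeriv]
  refine exists_iteratedDeriv_le_of_eq_rpow n f N C C r hN hf (fun x hx => ?_) (fun x hx => ?_)
  · have := h x (hx.le.trans (le_abs_self x))
    rwa [abs_of_pos (hN.trans hx)] at this
  · have := h x (by rw [abs_of_neg (by linarith)]; linarith)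
    rwa [abs_of_neg (by linarith)] at this

namespace IsSymbol

variable {s N K : ℝ} {m : ℝ → ℝ}

theorem hasTemperateGrowth (hm : IsSymbol s N K m) (hN : 1 ≤ N) : m.HasTemperateGrowth := by
  refine hasTemperateGrowth_of_eq_rpow hm.smooth (N := 2 * N) (C := N ^ (1 - s)) (r := -(1 - s))
    (by linarith) ?_
  intro x hx
  have hx0 : 0 < |x| := by linarith
  rw [hm.high x hx, Real.div_rpow (by linarith) hx0.le, Real.rpow_neg hx0.le]; rfl

theorem hasTemperateGrowth_inv (hm : IsSymbol s N K m) (hs : 1 / 4 ≤ s) (hN : 1 ≤ N) :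
    (fun x => (m x)⁻¹).HasTemperateGrowth := by
  refine hasTemperateGrowth_of_eq_rpow (hm.smooth.inv fun x => (hm.pos hs hN x).ne')
    (N := 2 * N) (C := (N ^ (1 - s))⁻¹) (r := 1 - s) (by linarith) ?_
  intro x hx
  have hx0 : 0 < |x| := by linarith
  rw [hm.high x hx, Real.div_rpow (by linarith) hx0.le, inv_div, div_eq_inv_mul]

theorem hasFourier_of_smoothing (hm : IsSymbol s N K m) (hs : 1 / 4 ≤ s) (hN : 1 ≤ N)
    {T : 𝓢'(ℝ, ℂ)} {F : ℝ → ℂ} (h : HasFourier (smoothing m T) F) :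
    HasFourier T (fun ξ => (m ξ : ℂ)⁻¹ * F ξ) := by
  have hl : (fun k : ℝ => 2 * Real.pi * k).HasTemperateGrowth := by fun_prop
  refine h.of_smoothing (fun x => (hm.pos hs hN x).ne') ?_ ?_
  · exact Function.Complex.hasTemperateGrowth_ofReal.comp ((hm.hasTemperateGrowth hN).comp hl)
  · simp only [← Complex.ofReal_inv]
    exact Function.Complex.hasTemperateGrowth_ofReal.comp
      ((hm.hasTemperateGrowth_inv hs hN).comp hl)

end IsSymbol

/-! ### Real distributions -/

/-- Testing on the real functions φ + φ̄ and i(φ - φ̄) gives T(φ̄) = conj T(φ). Hence the conjugate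
reflection of the transform represents the same distribution, and representatives are unique almost
everywhere. -/
theorem IsRealDistribution.hat_neg {T : 𝓢'(ℝ, ℂ)} {F : ℝ → ℂ} (hT : IsRealDistribution T)
    (h : HasFourier T F) : ∀ᵐ ξ : ℝ, F (-ξ) = (starRingEnd ℂ) (F ξ) := by
  let conjS : 𝓢(ℝ, ℂ) → 𝓢(ℝ, ℂ) := fun φ =>
    SchwartzMap.postcompCLM (𝕜 := ℝ) (Complex.conjCLE : ℂ →L[ℝ] ℂ) φ
  let negS : 𝓢(ℝ, ℂ) → 𝓢(ℝ, ℂ) := fun φ =>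
    SchwartzMap.compCLMOfContinuousLinearEquiv ℂ (ContinuousLinearEquiv.neg ℝ : ℝ ≃L[ℝ] ℝ) φ
  have hconj : ∀ φ x, conjS φ x = (starRingEnd ℂ) (φ x) := fun φ x => by
    simp [conjS, SchwartzMap.postcompCLM_apply]
  have hneg : ∀ φ x, negS φ x = φ (-x) := fun φ x => by simp [negS]
  have hTc : ∀ φ, T (conjS φ) = (starRingEnd ℂ) (T φ) := by
    intro φ
    have h1 : (T (φ + conjS φ)).im = 0 := hT _ fun x => by simp [hconj]
    have h2 : (T (Complex.I • (φ - conjS φ))).im = 0 := hT _ fun x => by simp [hconj]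
    rw [map_add, Complex.add_im] at h1
    rw [map_smul, map_sub, smul_eq_mul] at h2
    simp only [Complex.mul_im, Complex.I_re, Complex.I_im, Complex.sub_re, Complex.sub_im,
      zero_mul, one_mul, zero_add] at h2
    apply Complex.ext
    · rw [Complex.conj_re]; linarith
    · rw [Complex.conj_im]; linarith
  have hF : ∀ φ : 𝓢(ℝ, ℂ), conjS (𝓕 φ) = 𝓕 (conjS (negS φ)) := by
    intro φ
    ext x
    rw [hconj, SchwartzMap.fourier_coe, SchwartzMap.fourier_coe, Real.fourier_eq', Real.fourier_eq',
      ← integral_conj, ← integral_neg_eq_self]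
    congr 1
    ext v
    rw [hconj, hneg, smul_eq_mul, smul_eq_mul, map_mul, ← Complex.exp_conj, map_mul,
      Complex.conj_ofReal, Complex.conj_I]
    simp
  set G : ℝ → ℂ := fun k => (√(2 * Real.pi) : ℂ) * F (2 * Real.pi * k)
  have hG : Represents (𝓕 T) G := h
  have hG2 : Represents (𝓕 T) (fun k => (starRingEnd ℂ) (G (-k))) := by
    intro φ
    have h1 := hG (conjS (negS φ))
    have e : ∀ x, φ x * (starRingEnd ℂ) (G (-x)) =
        (starRingEnd ℂ) ((conjS (negS φ)) (-x) * G (-x)) := by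
      intro x; simp [hconj, hneg]
    simp only [e]
    constructor
    · have := h1.1.comp_neg
      exact Complex.conjLIE.integrable_comp_iff.mpr this
    · rw [integral_conj, integral_neg_eq_self (fun x => (conjS (negS φ)) x * G x), ← h1.2,
        TemperedDistribution.fourier_apply, TemperedDistribution.fourier_apply, ← hF, hTc]
      simp
  have h3 := ae_comp_mul (hG.ae_eq hG2) (inv_ne_zero two_pi_ne_zero)
  filter_upwards [h3] with ξ hξ
  simp only [G] at hξ
  rw [mul_neg, mul_inv_cancel_left₀ two_pi_ne_zero, map_mul, Complex.conj_ofReal] at hξ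
  have hsq : (√(2 * Real.pi) : ℂ) ≠ 0 := by
    rw [Complex.ofReal_ne_zero]; positivity
  rw [mul_left_cancel₀ hsq hξ, Complex.conj_conj]

end SBO
end

noncomputable section

namespace SBO

/-! ### Square integrable Fourier transforms -/

theorem sqrt_two_pi_sq : (√(2 * Real.pi) : ℂ) * (√(2 * Real.pi) : ℂ) = 2 * Real.pi := by
  rw [← Complex.ofReal_mul, Real.mul_self_sqrt (by positivity)]; push_cast; rfl

theorem sqrt_two_pi_ne_zero : (√(2 * Real.pi) : ℂ) ≠ 0 := by
  rw [Complex.ofReal_ne_zero]; positivity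

theorem memLp_comp_mul {F : ℝ → ℂ} (hF : MemLp F 2) {a : ℝ} (ha : a ≠ 0) :
    MemLp (fun x => F (a * x)) 2 := by
  have h : MeasurableEmbedding (fun x : ℝ => a * x) :=
    (Homeomorph.mulLeft₀ a ha).measurableEmbedding
  have := (h.memLp_map_measure_iff (g := F) (p := 2) (μ := volume)).mp (by
    rw [Real.map_volume_mul_left ha]
    exact hF.smul_measure (by simp))
  exact this

theorem represents_lp (f : Lp ℂ 2 (volume : Measure ℝ)) :
    Represents (f : 𝓢'(ℝ, ℂ)) f := by
  intro φ
  refine ⟨(φ.memLp 2).integrable_mul (Lp.memLp f), ?_⟩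
  rw [Lp.toTemperedDistribution_apply]; rfl

/-- The distributional and the L² Fourier transforms agree, so T is an L² function and Plancherel
becomes available. -/
theorem HasFourier.exists_lp {T : 𝓢'(ℝ, ℂ)} {F : ℝ → ℂ} (h : HasFourier T F) (hF : MemLp F 2) :
    ∃ f : Lp ℂ 2 (volume : Measure ℝ), T = f ∧
      (𝓕 f : Lp ℂ 2 (volume : Measure ℝ)) =ᵐ[volume]
        fun k => (√(2 * Real.pi) : ℂ) * F (2 * Real.pi * k) := by
  have hg := (memLp_comp_mul hF two_pi_ne_zero).const_mul (√(2 * Real.pi) : ℂ)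
  have hG : 𝓕 T = (hg.toLp _ : Lp ℂ 2 (volume : Measure ℝ)) := by
    ext φ
    rw [(h φ).2, ((represents_lp (hg.toLp _)).congr hg.coeFn_toLp φ).2]
  refine ⟨𝓕⁻ (hg.toLp _), ?_, ?_⟩
  · rw [← Lp.fourierInv_toTemperedDistribution_eq, ← hG, FourierTransform.fourierInv_fourier_eq]
  · rw [FourierTransform.fourier_fourierInv_eq]
    exact hg.coeFn_toLp

theorem HasFourier.memLp_toFun {T : 𝓢'(ℝ, ℂ)} {F : ℝ → ℂ} (h : HasFourier T F)
    (hF : MemLp F 2) : MemLp (toFun T) 2 ∧ Represents T (toFun T) := by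
  obtain ⟨f, hf, -⟩ := h.exists_lp hF
  have hr := represents_lp f
  rw [← hf] at hr
  exact ⟨(Lp.memLp f).ae_eq hr.toFun_ae.symm, hr.congr hr.toFun_ae.symm⟩

theorem HasFourier.parseval {T₁ T₂ : 𝓢'(ℝ, ℂ)} {F₁ F₂ : ℝ → ℂ} (h₁ : HasFourier T₁ F₁)
    (h₂ : HasFourier T₂ F₂) (hF₁ : MemLp F₁ 2) (hF₂ : MemLp F₂ 2) :
    ∫ x, toFun T₁ x * (starRingEnd ℂ) (toFun T₂ x) = ∫ ξ, F₁ ξ * (starRingEnd ℂ) (F₂ ξ) := by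
  obtain ⟨f₁, hf₁, hg₁⟩ := h₁.exists_lp hF₁
  obtain ⟨f₂, hf₂, hg₂⟩ := h₂.exists_lp hF₂
  have hr₁ := (represents_lp f₁).toFun_ae
  have hr₂ := (represents_lp f₂).toFun_ae
  rw [← hf₁] at hr₁
  rw [← hf₂] at hr₂
  have h := Lp.inner_fourier_eq f₂ f₁
  rw [L2.inner_def, L2.inner_def] at h
  simp only [RCLike.inner_apply] at h
  calc _ = ∫ x, f₁ x * (starRingEnd ℂ) (f₂ x) := by
        refine integral_congr_ae ?_
        filter_upwards [hr₁, hr₂] with x h1 h2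
        rw [h1, h2]
    _ = _ := h.symm
    _ = ∫ k, (2 * Real.pi : ℂ) *
          (fun ξ => F₁ ξ * (starRingEnd ℂ) (F₂ ξ)) (2 * Real.pi * k) := by
        refine integral_congr_ae ?_
        filter_upwards [hg₁, hg₂] with x h1 h2
        rw [h1, h2, map_mul, Complex.conj_ofReal, ← sqrt_two_pi_sq]
        ring
    _ = _ := by
        rw [integral_const_mul, Measure.integral_comp_mul_left
          (fun ξ => F₁ ξ * (starRingEnd ℂ) (F₂ ξ)) (2 * Real.pi), abs_of_pos (by positivity),
          Complex.real_smul]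
        push_cast
        rw [mul_inv_cancel_left₀]
        exact_mod_cast two_pi_ne_zero

theorem HasFourier.integral_norm_sq {T : 𝓢'(ℝ, ℂ)} {F : ℝ → ℂ} (h : HasFourier T F)
    (hF : MemLp F 2) : ∫ x, ‖toFun T x‖ ^ 2 = ∫ ξ, ‖F ξ‖ ^ 2 := by
  have := h.parseval h hF hF
  simp only [Complex.mul_conj, Complex.normSq_eq_norm_sq] at this
  rw [integral_complex_ofReal, integral_complex_ofReal] at this
  exact_mod_cast this

/-- Fourier inversion for distributions with integrable transform. -/
theorem HasFourier.represents_of_integrable {T : 𝓢'(ℝ, ℂ)} {F : ℝ → ℂ} (h : HasFourier T F)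
    (hF : Integrable F) : Represents T (fun x =>
      (√(2 * Real.pi) : ℂ)⁻¹ * ∫ ξ : ℝ, Complex.exp (Complex.I * (x * ξ : ℝ)) * F ξ) := by
  set G : ℝ → ℂ := fun k => (√(2 * Real.pi) : ℂ) * F (2 * Real.pi * k)
  have hG : Integrable G := ((hF.comp_mul_left' two_pi_ne_zero).const_mul _)
  have e : ∀ x : ℝ, (√(2 * Real.pi) : ℂ)⁻¹ *
      ∫ ξ : ℝ, Complex.exp (Complex.I * (x * ξ : ℝ)) * F ξ = 𝓕 (fun k => G (-k)) x := by
    intro x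
    rw [Real.fourier_eq', ← integral_neg_eq_self
      (fun v : ℝ => Complex.exp (↑(-2 * Real.pi * inner ℝ v x) * Complex.I) • G (-v))]
    have : ∀ k : ℝ, Complex.exp (↑(-2 * Real.pi * inner ℝ (-k) x) * Complex.I) • G (- -k) =
        (√(2 * Real.pi) : ℂ) * (fun ξ : ℝ => Complex.exp (Complex.I * (x * ξ : ℝ)) * F ξ)
          (2 * Real.pi * k) := by
      intro k
      simp only [G, neg_neg, smul_eq_mul, RCLike.inner_apply, conj_trivial]
      rw [mul_left_comm]
      congr 3
      push_cast; ring
    rw [integral_congr_ae (Filter.Eventually.of_forall this), integral_const_mul,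
      Measure.integral_comp_mul_left (fun ξ : ℝ => Complex.exp (Complex.I * (x * ξ : ℝ)) * F ξ)
        (2 * Real.pi), abs_of_pos (by positivity),
      Complex.real_smul, ← mul_assoc]
    congr 1
    push_cast
    rw [← sqrt_two_pi_sq]
    field_simp [sqrt_two_pi_ne_zero]
  simp only [e]
  intro φ
  have hL : Continuous fun p : ℝ × ℝ => (innerₗ ℝ : ℝ →ₗ[ℝ] ℝ →ₗ[ℝ] ℝ) p.1 p.2 :=
    continuous_inner
  have hb : Continuous (𝓕 (fun k => G (-k))) :=
    VectorFourier.fourierIntegral_continuous Real.continuous_fourierChar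
      hL hG.comp_neg
  -- Inversion is proved by duality: the Fourier transform moves from the integrable function onto
  -- the test function.
  have hflip := VectorFourier.integral_fourierIntegral_smul_eq_flip (μ := volume) (ν := volume)
    (L := innerₗ ℝ) (f := (φ : ℝ → ℂ)) (g := fun k => G (-k)) Real.continuous_fourierChar
      hL φ.integrable hG.comp_neg
  constructor
  · refine Integrable.mul_bdd (c := ∫ k, ‖G (-k)‖) φ.integrable hb.aestronglyMeasurable
      (Filter.Eventually.of_forall fun x => ?_)
    exact VectorFourier.norm_fourierIntegral_le_integral_norm _ _ _ _ _
  · have h1 := (h (𝓕⁻ φ)).2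
    rw [TemperedDistribution.fourier_apply, FourierTransform.fourier_fourierInv_eq] at h1
    rw [h1]
    calc _ = ∫ k, 𝓕 (φ : ℝ → ℂ) k * G (-k) := by
          rw [← integral_neg_eq_self]
          congr 1
          ext k
          rw [SchwartzMap.fourierInv_coe, Real.fourierInv_eq_fourier_neg, neg_neg]
      _ = _ := hflip
      _ = _ := by
        rw [flip_innerₗ]
        rfl

/-- Multiplication by `exp(i b x)` translates the Fourier transform. -/
theorem HasFourier.modulate {T : 𝓢'(ℝ, ℂ)} {G g : ℝ → ℂ} (h : HasFourier T G)
    (hg : MemLp g 2) (hT : Represents T g) (b : ℝ) :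
    ∃ T' : 𝓢'(ℝ, ℂ), Represents T' (fun x => Complex.exp (Complex.I * (b * x : ℝ)) * g x) ∧
      HasFourier T' (fun ξ => G (ξ - b)) := by
  have hm : MemLp (fun x : ℝ => Complex.exp (Complex.I * (b * x : ℝ)) * g x) 2 := by
    refine hg.of_le (AEStronglyMeasurable.mul ?_ hg.1) (Filter.Eventually.of_forall fun x => ?_)
    · exact Continuous.aestronglyMeasurable (by fun_prop)
    · rw [norm_mul, mul_comm Complex.I, Complex.norm_exp_ofReal_mul_I, one_mul]
  have hr := (represents_lp (hm.toLp _)).congr hm.coeFn_toLp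
  refine ⟨(hm.toLp _ : Lp ℂ 2 (volume : Measure ℝ)), hr, ?_⟩
  intro φ
  set a := b / (2 * Real.pi)
  set ψ := SchwartzMap.compSubConstCLM ℂ (-a) φ
  -- On test functions the modulation is a translation by b/(2π), the frequency b in the units of
  -- the kernel exp(-2πi x k).
  have hψ : ∀ x : ℝ, Complex.exp (Complex.I * (b * x : ℝ)) * (𝓕 φ) x = (𝓕 ψ) x := by
    intro x
    rw [SchwartzMap.fourier_coe, SchwartzMap.fourier_coe, Real.fourier_eq', Real.fourier_eq',
      ← integral_const_mul]
    rw [← integral_sub_right_eq_self (fun v : ℝ =>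
      Complex.exp (↑(-2 * Real.pi * inner ℝ v x) * Complex.I) • ψ v) a]
    congr 1
    ext v
    simp only [ψ, SchwartzMap.compSubConstCLM_apply, smul_eq_mul, RCLike.inner_apply, conj_trivial,
      sub_neg_eq_add, sub_add_cancel]
    rw [← mul_assoc, ← Complex.exp_add]
    congr 2
    have : b = a * (2 * Real.pi) := by simp only [a]; field_simp
    rw [this]; push_cast; ring
  have h1 := h ψ
  have h2 := (hr (𝓕 φ)).2
  have h3 := (hT (𝓕 ψ)).2
  have e : (fun x => φ x * ((√(2 * Real.pi) : ℂ) * G (2 * Real.pi * x - b))) =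
      fun x => (fun k => ψ k * ((√(2 * Real.pi) : ℂ) * G (2 * Real.pi * k))) (x - a) := by
    ext x
    simp only [ψ, SchwartzMap.compSubConstCLM_apply, sub_neg_eq_add, sub_add_cancel]
    congr 3
    simp only [a]; field_simp
  rw [e]
  refine ⟨h1.1.comp_sub_right a, ?_⟩
  rw [integral_sub_right_eq_self (fun k => ψ k * ((√(2 * Real.pi) : ℂ) * G (2 * Real.pi * k))),
    ← h1.2, TemperedDistribution.fourier_apply, TemperedDistribution.fourier_apply, h2, h3]
  congr 1
  ext x
  rw [← hψ x]; ring

/-- One factor f is opened by the inversion formula, legitimate because F is integrable. For each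
frequency ξ the remaining integral of exp(ixξ) g f̄ is a Parseval pairing of the modulated g with f.
-/
theorem HasFourier.integral_mul_norm_sq {S T : 𝓢'(ℝ, ℂ)} {F G : ℝ → ℂ} (hS : HasFourier S F)
    (hT : HasFourier T G) (hF : MemLp F 2) (hF1 : Integrable F) (hG : MemLp G 2) :
    ∫ x, toFun T x * ((‖toFun S x‖ ^ 2 : ℝ) : ℂ) =
      (√(2 * Real.pi) : ℂ)⁻¹ *
        ∫ ξ, ∫ η, F ξ * G η * (starRingEnd ℂ) (F (ξ + η)) := by
  set f := toFun S
  set g := toFun T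
  obtain ⟨hf2, hfS⟩ := hS.memLp_toFun hF
  obtain ⟨hg2, hgT⟩ := hT.memLp_toFun hG
  have hinv := (hS.represents_of_integrable hF1).toFun_ae
  have hgf : Integrable (fun x => g x * (starRingEnd ℂ) (f x)) :=
    MemLp.integrable_mul (p := 2) (q := 2) hg2 hf2.star
  have hinner : ∀ ξ : ℝ, ∫ x : ℝ, Complex.exp (Complex.I * (x * ξ : ℝ)) *
      (g x * (starRingEnd ℂ) (f x)) = ∫ η, G η * (starRingEnd ℂ) (F (ξ + η)) := by
    intro ξ
    obtain ⟨T', hT'r, hT'⟩ := hT.modulate hg2 hgT ξ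
    have hG' : MemLp (fun η => G (η - ξ)) 2 :=
      hG.comp_measurePreserving (measurePreserving_sub_right volume ξ)
    have h1 := hT'.parseval hS hG' hF
    rw [← integral_sub_right_eq_self (fun η => G η * (starRingEnd ℂ) (F (ξ + η))) ξ]
    simp only [add_sub_cancel]
    rw [← h1]
    refine integral_congr_ae ?_
    filter_upwards [hT'r.toFun_ae] with x hx
    rw [hx, mul_comm x ξ]; ring
  calc ∫ x, g x * ((‖f x‖ ^ 2 : ℝ) : ℂ) = ∫ x, (√(2 * Real.pi) : ℂ)⁻¹ *
        ∫ ξ : ℝ, Complex.exp (Complex.I * (x * ξ : ℝ)) * F ξ * (g x * (starRingEnd ℂ) (f x)) := by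
        refine integral_congr_ae ?_
        filter_upwards [hinv] with x hx
        rw [integral_mul_const, ← mul_assoc]
        have : f x = _ := hx
        rw [← this, ← Complex.normSq_eq_norm_sq, Complex.normSq_eq_conj_mul_self]
        ring
    _ = (√(2 * Real.pi) : ℂ)⁻¹ * ∫ ξ : ℝ, ∫ x : ℝ,
          Complex.exp (Complex.I * (x * ξ : ℝ)) * F ξ * (g x * (starRingEnd ℂ) (f x)) := by
        rw [integral_const_mul, integral_integral_swap]
        have h1 : Integrable (fun p : ℝ × ℝ => (g p.1 * (starRingEnd ℂ) (f p.1)) * F p.2)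
            (volume.prod volume) := hgf.mul_prod hF1
        refine (h1.bdd_mul (c := 1) (f := fun p : ℝ × ℝ =>
          Complex.exp (Complex.I * (p.1 * p.2 : ℝ))) ?_ ?_).congr ?_
        · exact Continuous.aestronglyMeasurable (by fun_prop)
        · refine Filter.Eventually.of_forall fun p => ?_
          rw [mul_comm Complex.I, Complex.norm_exp_ofReal_mul_I]
        · refine Filter.Eventually.of_forall fun p => ?_
          simp only [Function.uncurry]; ring
    _ = _ := by
        congr 2
        ext ξ
        have : ∀ x : ℝ, Complex.exp (Complex.I * (x * ξ : ℝ)) * F ξ *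
            (g x * (starRingEnd ℂ) (f x)) = F ξ * (Complex.exp (Complex.I * (x * ξ : ℝ)) *
            (g x * (starRingEnd ℂ) (f x))) := fun x => by ring
        simp only [this, mul_assoc (F ξ)]
        rw [integral_const_mul, integral_const_mul, hinner]

end SBO
end

noncomputable section

namespace SBO

/-! ### Inequalities for integrals of nonnegative functions -/

theorem lintegral_mul_le_sqrt {X : Type*} [MeasurableSpace X] (μ : Measure X) {f g : X → ℝ≥0∞}
    (hf : AEMeasurable f μ) (hg : AEMeasurable g μ) :
    ∫⁻ x, f x * g x ∂μ ≤
      (∫⁻ x, f x ^ 2 ∂μ) ^ (1 / 2 : ℝ) * (∫⁻ x, g x ^ 2 ∂μ) ^ (1 / 2 : ℝ) := by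
  have := ENNReal.lintegral_mul_le_Lp_mul_Lq μ Real.HolderConjugate.two_two hf hg
  simpa using this

theorem rpow_half_sq (x : ℝ≥0∞) : (x ^ (1 / 2 : ℝ)) ^ 2 = x := by
  rw [← ENNReal.rpow_natCast, ← ENNReal.rpow_mul]; norm_num

theorem lintegral_mul_sq_le {X : Type*} [MeasurableSpace X] (μ : Measure X) {f g : X → ℝ≥0∞}
    (hf : AEMeasurable f μ) (hg : AEMeasurable g μ) :
    (∫⁻ x, f x * g x ∂μ) ^ 2 ≤ (∫⁻ x, f x ^ 2 ∂μ) * ∫⁻ x, g x ^ 2 ∂μ := by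
  refine (pow_le_pow_left' (lintegral_mul_le_sqrt μ hf hg) 2).trans_eq ?_
  rw [mul_pow, rpow_half_sq, rpow_half_sq]

/-! ### Inversion of the Fourier transform in one variable -/

/-- The inverse Fourier transform of an integrable function. -/
def fourierInversion (f : ℝ → ℂ) (x : ℝ) : ℂ :=
  (√(2 * Real.pi) : ℂ)⁻¹ * ∫ ξ : ℝ, Complex.exp (Complex.I * (x * ξ : ℝ)) * f ξ

theorem norm_exp_I_mul (x : ℝ) : ‖Complex.exp (Complex.I * (x : ℂ))‖ = 1 := by
  rw [mul_comm, Complex.norm_exp_ofReal_mul_I]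

theorem enorm_exp_I_mul (x : ℝ) : ‖Complex.exp (Complex.I * (x : ℂ))‖ₑ = 1 := by
  rw [← ofReal_norm, norm_exp_I_mul, ENNReal.ofReal_one]

theorem integrable_exp_mul_iff {f : ℝ → ℂ} (x : ℝ) :
    Integrable (fun ξ : ℝ => Complex.exp (Complex.I * (x * ξ : ℝ)) * f ξ) ↔ Integrable f := by
  have hmeas : ∀ x : ℝ, AEStronglyMeasurable (fun ξ : ℝ => Complex.exp (Complex.I * (x * ξ : ℝ))) :=
    fun x => Continuous.aestronglyMeasurable (by fun_prop)
  constructor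
  · intro h
    refine (h.bdd_mul (c := 1) (hmeas (-x)) (Filter.Eventually.of_forall fun ξ =>
      (norm_exp_I_mul _).le)).congr (Filter.Eventually.of_forall fun ξ => ?_)
    simp only
    rw [← mul_assoc, ← Complex.exp_add]
    push_cast
    rw [show Complex.I * (-(x : ℂ) * ξ) + Complex.I * (x * ξ) = 0 by ring, Complex.exp_zero, one_mul]
  · intro h
    exact h.bdd_mul (c := 1) (hmeas x) (Filter.Eventually.of_forall fun ξ => (norm_exp_I_mul _).le)

theorem fourierInversion_of_not_integrable {f : ℝ → ℂ} (hf : ¬ Integrable f) (x : ℝ) :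
    fourierInversion f x = 0 := by
  rw [fourierInversion, integral_undef (by rwa [integrable_exp_mul_iff]), mul_zero]

theorem one_le_sqrt_two_pi : 1 ≤ √(2 * Real.pi) := by
  rw [Real.one_le_sqrt]; linarith [Real.pi_gt_three]

theorem norm_inv_sqrt_two_pi_le : ‖(√(2 * Real.pi) : ℂ)⁻¹‖ ≤ 1 := by
  rw [norm_inv, Complex.norm_real, Real.norm_of_nonneg (by positivity)]
  exact inv_le_one_of_one_le₀ one_le_sqrt_two_pi

theorem enorm_inv_sqrt_two_pi_le : ‖(√(2 * Real.pi) : ℂ)⁻¹‖ₑ ≤ 1 := by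
  rw [← ofReal_norm]
  exact ENNReal.ofReal_le_one.mpr norm_inv_sqrt_two_pi_le

theorem enorm_const_mul_le (z : ℂ) : ‖(√(2 * Real.pi) : ℂ)⁻¹ * z‖ₑ ≤ ‖z‖ₑ := by
  rw [enorm_mul]; exact mul_le_of_le_one_left' enorm_inv_sqrt_two_pi_le

theorem enorm_fourierInversion_le (f : ℝ → ℂ) (x : ℝ) :
    ‖fourierInversion f x‖ₑ ≤ ∫⁻ ξ, ‖f ξ‖ₑ := by
  refine (enorm_const_mul_le _).trans ((enorm_integral_le_lintegral_enorm _).trans_eq ?_)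
  simp only [enorm_mul, enorm_exp_I_mul, one_mul]

theorem lintegral_sq_eq_ofReal {f : ℝ → ℂ} (hf : MemLp f 2) :
    ∫⁻ x, ‖f x‖ₑ ^ 2 = ENNReal.ofReal (∫ x, ‖f x‖ ^ 2) := by
  rw [ofReal_integral_eq_lintegral_ofReal (hf.integrable_norm_pow two_ne_zero)
    (Filter.Eventually.of_forall fun x => by positivity)]
  congr 1
  ext x
  rw [ENNReal.ofReal_pow (norm_nonneg _), ofReal_norm]

/-- Plancherel as an inequality valid for every measurable f: if f is not integrable the inversion
integral takes the default value 0, and if f is not square integrable the right-hand side is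
infinite. -/
theorem lintegral_fourierInversion_sq_le {f : ℝ → ℂ} (hm : AEStronglyMeasurable f) :
    ∫⁻ x, ‖fourierInversion f x‖ₑ ^ 2 ≤ ∫⁻ ξ, ‖f ξ‖ₑ ^ 2 := by
  by_cases hf : Integrable f
  swap
  · simp [fourierInversion_of_not_integrable hf]
  by_cases h2 : ∫⁻ ξ, ‖f ξ‖ₑ ^ 2 = ⊤
  · rw [h2]; exact le_top
  have hL : MemLp f 2 := by
    refine ⟨hm, ?_⟩
    rw [eLpNorm_lt_top_iff_lintegral_rpow_enorm_lt_top (by simp) (by simp)]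
    simpa using lt_top_iff_ne_top.mpr h2
  have hg := (memLp_comp_mul hL two_pi_ne_zero).const_mul (√(2 * Real.pi) : ℂ)
  set T : 𝓢'(ℝ, ℂ) := 𝓕⁻ ((hg.toLp _ : Lp ℂ 2 (volume : Measure ℝ)) : 𝓢'(ℝ, ℂ))
  have hT : HasFourier T f := by
    unfold HasFourier
    rw [FourierTransform.fourier_fourierInv_eq]
    exact (represents_lp (hg.toLp _)).congr hg.coeFn_toLp
  have h1 := (hT.represents_of_integrable hf).toFun_ae
  have h3 := hT.integral_norm_sq hL
  calc _ = ∫⁻ x, ‖toFun T x‖ₑ ^ 2 := by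
        refine lintegral_congr_ae ?_
        filter_upwards [h1] with x hx
        rw [hx]; rfl
    _ ≤ _ := by rw [lintegral_sq_eq_ofReal (hT.memLp_toFun hL).1, h3, lintegral_sq_eq_ofReal hL]

theorem continuous_fourierInversion {f : ℝ → ℂ} (hf : Integrable f) :
    Continuous (fourierInversion f) := by
  refine continuous_const.mul (continuous_of_dominated (bound := fun ξ => ‖f ξ‖) ?_ ?_ hf.norm ?_)
  · exact fun x => ((integrable_exp_mul_iff x).mpr hf).aestronglyMeasurable
  · refine fun x => Filter.Eventually.of_forall fun ξ => ?_
    rw [norm_mul, norm_exp_I_mul, one_mul]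
  · refine Filter.Eventually.of_forall fun ξ => ?_
    fun_prop

/-- The trilinear time integral, after opening two of the factors. -/
theorem enorm_integral_fourierInversion_mul_le {f g v : ℝ → ℂ} {S : Set ℝ}
    (hfm : AEStronglyMeasurable f) (hgm : AEStronglyMeasurable g)
    (hv : IntegrableOn v S) :
    ‖∫ t in S, fourierInversion f t * v t * (starRingEnd ℂ) (fourierInversion g t)‖ₑ ≤
      ∫⁻ a, ∫⁻ c, ‖f a‖ₑ * ‖g c‖ₑ *
        ‖∫ t in S, Complex.exp (Complex.I * ((a - c) * t : ℝ)) * v t‖ₑ := by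
  by_cases hf : Integrable f
  swap
  · simp [fourierInversion_of_not_integrable hf]
  by_cases hg : Integrable g
  swap
  · simp [fourierInversion_of_not_integrable hg]
  have hfg : Integrable (fun p : ℝ × ℝ => f p.1 * (starRingEnd ℂ) (g p.2))
      (volume.prod volume) := hf.mul_prod (Complex.conjLIE.integrable_comp_iff.mpr hg)
  set κ : ℂ := (√(2 * Real.pi) : ℂ)⁻¹
  have hexp : ∀ t : ℝ, fourierInversion f t * v t * (starRingEnd ℂ) (fourierInversion g t) =
      κ * (κ * ∫ p : ℝ × ℝ, Complex.exp (Complex.I * ((p.1 - p.2) * t : ℝ)) *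
        (v t * (f p.1 * (starRingEnd ℂ) (g p.2))) ∂(volume.prod volume)) := by
    intro t
    have h1 : (starRingEnd ℂ) (fourierInversion g t) =
        κ * ∫ c : ℝ, (starRingEnd ℂ) (Complex.exp (Complex.I * (t * c : ℝ)) * g c) := by
      rw [fourierInversion, map_mul, integral_conj, map_inv₀, Complex.conj_ofReal]
    have h2 := integral_prod_mul (μ := (volume : Measure ℝ)) (ν := (volume : Measure ℝ))
      (fun a : ℝ => Complex.exp (Complex.I * (t * a : ℝ)) * f a)
      (fun c : ℝ => (starRingEnd ℂ) (Complex.exp (Complex.I * (t * c : ℝ)) * g c))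
    have h3 : ∫ p : ℝ × ℝ, Complex.exp (Complex.I * ((p.1 - p.2) * t : ℝ)) *
        (v t * (f p.1 * (starRingEnd ℂ) (g p.2))) ∂(volume.prod volume) =
        v t * ∫ p : ℝ × ℝ, (Complex.exp (Complex.I * (t * p.1 : ℝ)) * f p.1) *
          (starRingEnd ℂ) (Complex.exp (Complex.I * (t * p.2 : ℝ)) * g p.2)
            ∂(volume.prod volume) := by
      rw [← integral_const_mul]
      congr 1
      ext p
      rw [map_mul, ← Complex.exp_conj, map_mul, Complex.conj_ofReal, Complex.conj_I]
      have : Complex.exp (Complex.I * ((p.1 - p.2) * t : ℝ)) =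
          Complex.exp (Complex.I * (t * p.1 : ℝ)) * Complex.exp (-Complex.I * (t * p.2 : ℝ)) := by
        rw [← Complex.exp_add]; congr 1; push_cast; ring
      rw [this]; ring
    rw [h3, h2, h1, fourierInversion]; ring
  simp only [hexp]
  rw [integral_const_mul, integral_const_mul, integral_integral_swap]
  · refine (enorm_const_mul_le _).trans ((enorm_const_mul_le _).trans
      ((enorm_integral_le_lintegral_enorm _).trans_eq ?_))
    have h4 : ∀ p : ℝ × ℝ, ‖∫ t in S, Complex.exp (Complex.I * ((p.1 - p.2) * t : ℝ)) *
        (v t * (f p.1 * (starRingEnd ℂ) (g p.2)))‖ₑ = ‖f p.1‖ₑ * ‖g p.2‖ₑ *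
        ‖∫ t in S, Complex.exp (Complex.I * ((p.1 - p.2) * t : ℝ)) * v t‖ₑ := by
      intro p
      simp only [← mul_assoc]
      rw [integral_mul_const, integral_mul_const, enorm_mul, enorm_mul, RCLike.enorm_conj]
      ring
    simp only [h4]
    rw [lintegral_prod]
    refine ((hfm.enorm.comp_fst).mul (hgm.enorm.comp_snd)).mul ?_
    have : Continuous fun σ : ℝ => ∫ t in S, Complex.exp (Complex.I * (σ * t : ℝ)) * v t := by
      refine continuous_of_dominated (bound := fun t => ‖v t‖) ?_ ?_ hv.norm ?_
      · exact fun x => (Continuous.aestronglyMeasurable (by fun_prop)).mul hv.1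
      · refine fun x => Filter.Eventually.of_forall fun ξ => ?_
        rw [norm_mul, norm_exp_I_mul, one_mul]
      · refine Filter.Eventually.of_forall fun ξ => ?_
        fun_prop
    exact (this.comp (continuous_fst.sub continuous_snd)).enorm.aemeasurable
  · have h5 : Integrable (fun q : ℝ × (ℝ × ℝ) => v q.1 * (f q.2.1 * (starRingEnd ℂ) (g q.2.2)))
        ((volume.restrict S).prod (volume.prod volume)) := Integrable.mul_prod hv hfg
    refine h5.bdd_mul (c := 1) (Continuous.aestronglyMeasurable (by fun_prop))
      (Filter.Eventually.of_forall fun q => (norm_exp_I_mul _).le)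

end SBO
end

noncomputable section

namespace SBO

/-! ### Weights -/

/-- The weight `⟨x⟩^σ` as an extended nonnegative number. -/
def weight (σ x : ℝ) : ℝ≥0∞ := ENNReal.ofReal (bracket x ^ σ)

theorem measurable_bracket : Measurable bracket := continuous_bracket.measurable

theorem measurable_weight (σ : ℝ) : Measurable (weight σ) := by
  unfold weight
  exact (measurable_bracket.pow_const σ).ennreal_ofReal

theorem weight_mul (σ σ' x : ℝ) : weight σ x * weight σ' x = weight (σ + σ') x := by
  unfold weight
  rw [Real.rpow_add (bracket_pos x), ENNReal.ofReal_mul (by have := bracket_pos x; positivity)]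

theorem weight_zero (x : ℝ) : weight 0 x = 1 := by simp [weight]

theorem weight_one (x : ℝ) : weight 1 x = ENNReal.ofReal (bracket x) := by simp [weight]

theorem weight_mul_neg (σ x : ℝ) : weight (-σ) x * weight σ x = 1 := by
  rw [weight_mul, neg_add_cancel, weight_zero]

theorem one_le_weight {σ : ℝ} (hσ : 0 ≤ σ) (x : ℝ) : 1 ≤ weight σ x := by
  unfold weight
  rw [ENNReal.one_le_ofReal]
  exact Real.one_le_rpow (one_le_bracket x) hσ

theorem weight_ne_top (σ x : ℝ) : weight σ x ≠ ⊤ := ENNReal.ofReal_ne_top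

theorem weight_neg (σ x : ℝ) : weight σ (-x) = weight σ x := by simp [weight, bracket_neg]

/-- The constant `∫ ⟨τ⟩^(-2b) dτ`. -/
def tailConst (b : ℝ) : ℝ≥0∞ := ∫⁻ τ, weight (-b) τ ^ 2

theorem tailConst_lt_top {b : ℝ} (hb : 1 / 2 < b) : tailConst b < ⊤ := by
  have h := (integrable_rpow_neg_one_add_norm_sq (E := ℝ) (μ := volume) (r := 2 * b)
    (by simp; linarith)).lintegral_lt_top
  refine lt_of_le_of_lt (lintegral_mono fun τ => ?_) h
  unfold weight
  rw [← ENNReal.ofReal_pow (by have := bracket_pos τ; positivity)]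
  refine ENNReal.ofReal_le_ofReal (le_of_eq ?_)
  rw [← Real.rpow_natCast, ← Real.rpow_mul (bracket_pos τ).le, bracket, Real.sqrt_eq_rpow,
    ← Real.rpow_mul (by positivity), Real.norm_eq_abs, sq_abs]
  congr 1
  push_cast; ring

/-! ### Evolutions given by their space-time Fourier transform -/

/-- The spatial Fourier transform at time `t` of the function with space-time transform `Ψ`. -/
def evolution (Ψ : ℝ × ℝ → ℂ) (ξ t : ℝ) : ℂ := fourierInversion (fun τ => Ψ (ξ, τ)) t

/-- The majorant of `evolution Ψ ξ` that is uniform in time. -/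
def majorant (Ψ : ℝ × ℝ → ℂ) (ξ : ℝ) : ℝ≥0∞ := ∫⁻ τ, ‖Ψ (ξ, τ)‖ₑ

theorem enorm_evolution_le (Ψ : ℝ × ℝ → ℂ) (ξ t : ℝ) : ‖evolution Ψ ξ t‖ₑ ≤ majorant Ψ ξ :=
  enorm_fourierInversion_le _ _

theorem measurable_majorant {Ψ : ℝ × ℝ → ℂ} (hΨ : Measurable Ψ) : Measurable (majorant Ψ) :=
  hΨ.enorm.lintegral_prod_right'

theorem measurable_evolution {Ψ : ℝ × ℝ → ℂ} (hΨ : Measurable Ψ) :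
    Measurable fun p : ℝ × ℝ => evolution Ψ p.1 p.2 := by
  unfold evolution fourierInversion
  refine Measurable.const_mul ?_ _
  have : Measurable fun q : (ℝ × ℝ) × ℝ =>
      Complex.exp (Complex.I * (q.1.2 * q.2 : ℝ)) * Ψ (q.1.1, q.2) := by
    refine Measurable.mul (Continuous.measurable (by fun_prop)) (hΨ.comp (by fun_prop))
  exact this.stronglyMeasurable.integral_prod_right'.measurable

theorem continuous_evolution {Ψ : ℝ × ℝ → ℂ} (hΨ : Measurable Ψ) {ξ : ℝ}
    (h : majorant Ψ ξ ≠ ⊤) : Continuous (evolution Ψ ξ) :=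
  continuous_fourierInversion
    ⟨(hΨ.comp measurable_prodMk_left).aestronglyMeasurable, lt_top_iff_ne_top.mpr h⟩

theorem restrictionNorm_sq {h : ℝ → ℝ} (hh : Measurable h) (σ b : ℝ) {Ψ : ℝ × ℝ → ℂ}
    (hΨ : Measurable Ψ) : restrictionNorm h σ b Ψ ^ 2 =
      ∫⁻ ξ, ∫⁻ τ, (weight b (τ + h ξ) * weight σ ξ * ‖Ψ (ξ, τ)‖ₑ) ^ 2 := by
  have hm : Measurable fun p : ℝ × ℝ => (weight b (p.2 + h p.1) * weight σ p.1 * ‖Ψ p‖ₑ) ^ 2 := by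
    have h1 := measurable_weight b
    have h2 := measurable_weight σ
    fun_prop
  rw [restrictionNorm, eLpNorm_eq_lintegral_rpow_enorm_toReal (by simp) (by simp)]
  simp only [ENNReal.toReal_ofNat, ENNReal.rpow_ofNat]
  rw [rpow_half_sq, Measure.volume_eq_prod, ← lintegral_prod _ hm.aemeasurable]
  congr 1
  ext p
  have := bracket_pos p.1
  have := bracket_pos (p.2 + h p.1)
  rw [enorm_mul, weight, weight, ← ENNReal.ofReal_mul (by positivity), ← ofReal_norm,
    Complex.norm_real, Real.norm_of_nonneg (by positivity)]

/-- Cauchy-Schwarz in τ against ⟨τ + h(ξ)⟩^(-b); the dispersion disappears by translation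
invariance. For b > 1/2 this is the embedding into bounded functions of time with values in H^σ, in
the stronger form with the supremum in time inside the frequency integral. -/
theorem lintegral_majorant_sq_le {h : ℝ → ℝ} (hh : Measurable h) (σ b : ℝ) {Ψ : ℝ × ℝ → ℂ}
    (hΨ : Measurable Ψ) : ∫⁻ ξ, (weight σ ξ * majorant Ψ ξ) ^ 2 ≤
      tailConst b * restrictionNorm h σ b Ψ ^ 2 := by
  have h1 := measurable_weight b
  have h2 := measurable_weight σ
  have h3 := measurable_weight (-b)
  rw [restrictionNorm_sq hh σ b hΨ, ← lintegral_const_mul]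
  swap
  · refine Measurable.lintegral_prod_right' (f := fun p : ℝ × ℝ =>
      (weight b (p.2 + h p.1) * weight σ p.1 * ‖Ψ p‖ₑ) ^ 2) ?_
    fun_prop
  refine lintegral_mono fun ξ => ?_
  have hΨξ : Measurable fun τ => Ψ (ξ, τ) := hΨ.comp measurable_prodMk_left
  have e : weight σ ξ * majorant Ψ ξ =
      ∫⁻ τ, weight (-b) (τ + h ξ) * (weight b (τ + h ξ) * weight σ ξ * ‖Ψ (ξ, τ)‖ₑ) := by
    rw [majorant, ← lintegral_const_mul _ hΨξ.enorm]
    congr 1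
    ext τ
    rw [← mul_assoc, ← mul_assoc, weight_mul_neg, one_mul]
  simp only
  rw [e]
  refine (lintegral_mul_sq_le _ (by fun_prop) (by fun_prop)).trans_eq ?_
  rw [lintegral_add_right_eq_self (fun τ => weight (-b) τ ^ 2)]
  rfl

/-- Plancherel in time and ⟨·⟩^b ≥ 1. Square integrability over the whole time line keeps powers of
δ out of the estimates. -/
theorem lintegral_evolution_sq_le {h : ℝ → ℝ} (hh : Measurable h) (σ : ℝ) {b : ℝ} (hb : 0 ≤ b)
    {Ψ : ℝ × ℝ → ℂ} (hΨ : Measurable Ψ) :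
    ∫⁻ ξ, ∫⁻ t, (weight σ ξ * ‖evolution Ψ ξ t‖ₑ) ^ 2 ≤ restrictionNorm h σ b Ψ ^ 2 := by
  rw [restrictionNorm_sq hh σ b hΨ]
  refine lintegral_mono fun ξ => ?_
  have hΨξ : Measurable fun τ => Ψ (ξ, τ) := hΨ.comp measurable_prodMk_left
  simp only [mul_pow]
  rw [lintegral_const_mul' _ _ (by simp [weight_ne_top])]
  refine (mul_le_mul_right (lintegral_fourierInversion_sq_le hΨξ.aestronglyMeasurable) _).trans ?_
  rw [← lintegral_const_mul' _ _ (by simp [weight_ne_top])]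
  refine lintegral_mono fun τ => ?_
  simp only
  gcongr
  exact le_mul_of_one_le_left' (one_le_pow₀ (one_le_weight hb _))

/-! ### The trilinear space-time estimate -/

theorem lintegral_comp_mul_left {F : ℝ → ℝ≥0∞} (hF : Measurable F) {c : ℝ} (hc : c ≠ 0) :
    ∫⁻ x, F (c * x) = ENNReal.ofReal |c⁻¹| * ∫⁻ x, F x := by
  rw [← lintegral_map hF (measurable_const_mul c), Real.map_volume_mul_left hc,
    lintegral_smul_measure]
  rfl

/-- Plancherel does not see the sharp cutoff to S. The factor 2π comes from the missing
normalisation of the integral. -/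
theorem lintegral_fourier_restrict_sq_le {v : ℝ → ℂ} {S : Set ℝ} (hS : MeasurableSet S)
    (hv : Measurable v) :
    ∫⁻ σ : ℝ, ‖∫ t in S, Complex.exp (Complex.I * (σ * t : ℝ)) * v t‖ₑ ^ 2 ≤
      ENNReal.ofReal (2 * Real.pi) * ∫⁻ t in S, ‖v t‖ₑ ^ 2 := by
  have h := lintegral_fourierInversion_sq_le (f := S.indicator v)
    (hv.indicator hS).aestronglyMeasurable
  have e1 : ∀ σ : ℝ, ‖∫ t in S, Complex.exp (Complex.I * (σ * t : ℝ)) * v t‖ₑ ^ 2 =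
      ENNReal.ofReal (2 * Real.pi) * ‖fourierInversion (S.indicator v) σ‖ₑ ^ 2 := by
    intro σ
    have : ∫ t in S, Complex.exp (Complex.I * (σ * t : ℝ)) * v t =
        (√(2 * Real.pi) : ℂ) * fourierInversion (S.indicator v) σ := by
      rw [fourierInversion, mul_inv_cancel_left₀ sqrt_two_pi_ne_zero, ← integral_indicator hS]
      congr 1
      ext t
      by_cases ht : t ∈ S <;> simp [ht]
    rw [this, enorm_mul, mul_pow]
    congr 1
    rw [← ofReal_norm, Complex.norm_real, Real.norm_of_nonneg (by positivity),
      ← ENNReal.ofReal_pow (by positivity), Real.sq_sqrt (by positivity)]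
  simp only [e1]
  rw [lintegral_const_mul' _ _ ENNReal.ofReal_ne_top]
  refine mul_le_mul_right (h.trans_eq ?_) _
  rw [← lintegral_indicator hS]
  congr 1
  ext t
  by_cases ht : t ∈ S <;> simp [ht]

/-- Cauchy-Schwarz and the change of variables `σ = a + 2 x y + y²` that expresses the
transversality of two Schrödinger waves whose frequencies differ by `y`. -/
theorem lintegral_transversal_le {f g : ℝ → ℝ≥0∞} {H : ℝ × ℝ → ℝ≥0∞} (hf : Measurable f)
    (hg : Measurable g) (hH : Measurable H) (a : ℝ) :
    ∫⁻ p : ℝ × ℝ, f p.1 * g (p.1 + p.2) *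
        (ENNReal.ofReal |p.2| * H (p.2, a + 2 * p.1 * p.2 + p.2 ^ 2)) ≤
      (∫⁻ x, f x ^ 2) ^ (1 / 2 : ℝ) * (∫⁻ x, g x ^ 2) ^ (1 / 2 : ℝ) *
        (∫⁻ y, ENNReal.ofReal |y| * ∫⁻ σ, H (y, σ) ^ 2) ^ (1 / 2 : ℝ) := by
  refine (lintegral_mul_le_sqrt volume (f := fun p : ℝ × ℝ => f p.1 * g (p.1 + p.2))
    (by fun_prop) (by fun_prop)).trans ?_
  rw [← ENNReal.mul_rpow_of_nonneg (∫⁻ x, f x ^ 2) _ (by norm_num)]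
  refine mul_le_mul' (ENNReal.rpow_le_rpow ?_ (by norm_num))
    (ENNReal.rpow_le_rpow ?_ (by norm_num))
  · simp only [mul_pow]
    rw [Measure.volume_eq_prod, lintegral_prod _ (by fun_prop)]
    rw [← lintegral_mul_const _ (by fun_prop)]
    refine lintegral_mono fun x => ?_
    simp only
    rw [lintegral_const_mul _ (by fun_prop), lintegral_add_left_eq_self (fun y => g y ^ 2)]
  · simp only [mul_pow]
    rw [Measure.volume_eq_prod, lintegral_prod_symm _ (by fun_prop)]
    refine lintegral_mono fun y => ?_
    simp only
    rw [lintegral_const_mul _ (by fun_prop)]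
    rcases eq_or_ne y 0 with rfl | hy
    · simp
    -- At fixed y ≠ 0 the map x ↦ a + 2xy + y² is affine with slope 2y. Against the factor |y|² its
    -- Jacobian leaves |y|/2.
    have h1 : ∫⁻ x : ℝ, H (y, a + 2 * x * y + y ^ 2) ^ 2 =
        ENNReal.ofReal |(2 * y)⁻¹| * ∫⁻ σ, H (y, σ) ^ 2 := by
      have hm : Measurable fun σ => H (y, σ) ^ 2 := by fun_prop
      rw [← lintegral_add_right_eq_self (fun σ => H (y, σ) ^ 2) (a + y ^ 2),
        ← lintegral_comp_mul_left (F := fun σ => H (y, σ + (a + y ^ 2)) ^ 2) (by fun_prop)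
        (c := 2 * y) (by positivity)]
      congr 1
      ext x
      congr 3
      ring
    rw [h1, ← mul_assoc]
    gcongr
    rw [← ENNReal.ofReal_pow (abs_nonneg _), ← ENNReal.ofReal_mul (by positivity)]
    refine ENNReal.ofReal_le_ofReal ?_
    rw [abs_inv, abs_mul, Nat.abs_ofNat]
    have : 0 < |y| := abs_pos.mpr hy
    have : |y| ^ 2 * (2 * |y|)⁻¹ = |y| / 2 := by field_simp
    rw [this]; linarith

/-- The Fourier transform in time of the restriction of an evolution to the times in `S`. -/
def timeTransform (Φ : ℝ × ℝ → ℂ) (S : Set ℝ) (p : ℝ × ℝ) : ℝ≥0∞ :=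
  ‖∫ t in S, Complex.exp (Complex.I * (p.2 * t : ℝ)) * evolution Φ p.1 t‖ₑ

theorem measurable_timeTransform {Φ : ℝ × ℝ → ℂ} (hΦ : Measurable Φ) (S : Set ℝ) :
    Measurable (timeTransform Φ S) := by
  have hev := measurable_evolution hΦ
  have h1 : Measurable fun q : (ℝ × ℝ) × ℝ => evolution Φ q.1.1 q.2 :=
    hev.comp (g := fun p : ℝ × ℝ => evolution Φ p.1 p.2)
      (f := fun q : (ℝ × ℝ) × ℝ => (q.1.1, q.2)) (by fun_prop)
  have h2 : Measurable fun q : (ℝ × ℝ) × ℝ => Complex.exp (Complex.I * (q.1.2 * q.2 : ℝ)) :=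
    Continuous.measurable (by fun_prop)
  exact (h2.mul h1).stronglyMeasurable.integral_prod_right'.measurable.enorm

theorem measurable_evolution_right {Φ : ℝ × ℝ → ℂ} (hΦ : Measurable Φ) (y : ℝ) :
    Measurable (evolution Φ y) :=
  Measurable.of_uncurry_left (f := evolution Φ) (measurable_evolution hΦ)

/-- The single factor |y| is at most the square of ⟨y⟩^(1/2), so the weight left by the transversal
change of variables is exactly the H^(1/2) regularity of Iv. -/
theorem lintegral_timeTransform_sq_le {Φ : ℝ × ℝ → ℂ} (hΦ : Measurable Φ)
    {h : ℝ → ℝ} (hh : Measurable h) {b : ℝ} (hb : 0 ≤ b) {S : Set ℝ} (hS : MeasurableSet S) :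
    ∫⁻ y, ENNReal.ofReal |y| * ∫⁻ σ, timeTransform Φ S (y, σ) ^ 2 ≤
      ENNReal.ofReal (2 * Real.pi) * restrictionNorm h (1 / 2) b Φ ^ 2 := by
  refine le_trans ?_ (mul_le_mul_right (lintegral_evolution_sq_le hh (1 / 2) hb hΦ) _)
  rw [← lintegral_const_mul' _ _ ENNReal.ofReal_ne_top]
  refine lintegral_mono fun y => ?_
  have h1 := lintegral_fourier_restrict_sq_le hS (measurable_evolution_right hΦ y)
  calc ENNReal.ofReal |y| * ∫⁻ σ, timeTransform Φ S (y, σ) ^ 2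
      ≤ ENNReal.ofReal |y| * (ENNReal.ofReal (2 * Real.pi) *
        ∫⁻ t in S, ‖evolution Φ y t‖ₑ ^ 2) := mul_le_mul_right h1 _
    _ ≤ ENNReal.ofReal |y| * (ENNReal.ofReal (2 * Real.pi) *
        ∫⁻ t, ‖evolution Φ y t‖ₑ ^ 2) :=
      mul_le_mul_right (mul_le_mul_right (setLIntegral_le_lintegral _ _) _) _
    _ = ENNReal.ofReal (2 * Real.pi) * (ENNReal.ofReal |y| *
        ∫⁻ t, ‖evolution Φ y t‖ₑ ^ 2) := by ring
    _ ≤ _ := by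
      simp only [mul_pow]
      rw [lintegral_const_mul' _ _ (by simp [weight_ne_top]), pow_two (weight _ _), weight_mul,
        add_halves, weight_one]
      gcongr
      exact abs_le_bracket y

/-- The weighted modulus of `Ψ`, in terms of the modulation `λ = τ + ξ²`. -/
def modulated (Ψ : ℝ × ℝ → ℂ) (p : ℝ × ℝ) : ℝ≥0∞ := weight 1 p.1 * ‖Ψ (p.1, p.2 - p.1 ^ 2)‖ₑ

theorem measurable_modulated {Ψ : ℝ × ℝ → ℂ} (hΨ : Measurable Ψ) : Measurable (modulated Ψ) := by
  have hw1 := measurable_weight 1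
  unfold modulated
  fun_prop

/-- Summation over the modulation l of free waves: Cauchy-Schwarz in l against ⟨l⟩^(-b), whose
square is integrable for b > 1/2. -/
theorem lintegral_modulated_le {Ψ : ℝ × ℝ → ℂ} (hΨ : Measurable Ψ) (b : ℝ) :
    (∫⁻ l, (∫⁻ x, modulated Ψ (x, l) ^ 2) ^ (1 / 2 : ℝ)) ^ 2 ≤
      tailConst b * restrictionNorm (fun ξ => ξ ^ 2) 1 b Ψ ^ 2 := by
  have hwb := measurable_weight b
  have hwb' := measurable_weight (-b)
  have hF := measurable_modulated hΨ
  set n : ℝ → ℝ≥0∞ := fun l => (∫⁻ x, modulated Ψ (x, l) ^ 2) ^ (1 / 2 : ℝ)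
  have hn0 : Measurable fun l => ∫⁻ x, modulated Ψ (x, l) ^ 2 :=
    Measurable.lintegral_prod_left' (f := fun p : ℝ × ℝ => modulated Ψ p ^ 2) (by fun_prop)
  have hn : Measurable n := hn0.pow_const _
  have e : ∀ l, n l = weight (-b) l * (weight b l * n l) := fun l => by
    rw [← mul_assoc, weight_mul_neg, one_mul]
  rw [lintegral_congr e]
  refine (lintegral_mul_sq_le _ (by fun_prop) (by fun_prop)).trans ?_
  refine mul_le_mul_right (le_of_eq ?_) _
  rw [restrictionNorm_sq (by fun_prop) 1 b hΨ]
  simp only [mul_pow, n, rpow_half_sq]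
  have e2 : ∀ l, weight b l ^ 2 * ∫⁻ x, modulated Ψ (x, l) ^ 2 =
      ∫⁻ x, weight b l ^ 2 * modulated Ψ (x, l) ^ 2 :=
    fun l => (lintegral_const_mul' _ _ (by simp [weight_ne_top])).symm
  simp only [e2]
  rw [lintegral_lintegral_swap (by fun_prop)]
  refine lintegral_congr fun x => ?_
  rw [← lintegral_add_right_eq_self _ (x ^ 2)]
  refine lintegral_congr fun l => ?_
  simp only [modulated, add_sub_cancel_right]
  ring

/-- The trilinear space-time integral at the frequencies `x`, `y` and `x + y`. -/
def triple (Ψ Φ : ℝ × ℝ → ℂ) (S : Set ℝ) (x y : ℝ) : ℂ :=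
  ∫ t in S, evolution Ψ x t * evolution Φ y t * (starRingEnd ℂ) (evolution Ψ (x + y) t)

theorem integrableOn_evolution {Φ : ℝ × ℝ → ℂ} (hΦ : Measurable Φ) {S : Set ℝ}
    (hS : volume S ≠ ⊤) {y : ℝ} (hy : majorant Φ y ≠ ⊤) : IntegrableOn (evolution Φ y) S := by
  refine Measure.integrableOn_of_bounded (M := (majorant Φ y).toReal) hS
    (measurable_evolution_right hΦ y).aestronglyMeasurable (Filter.Eventually.of_forall fun t => ?_)
  rw [← toReal_enorm]
  exact ENNReal.toReal_mono hy (enorm_evolution_le _ _ _)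

/-- Both Schrödinger factors are opened in their time frequencies a and c, written as l - x² and k -
(x + y)² with modulations l and k. The third factor is then tested at time frequency a - c = l - k +
2xy + y². -/
theorem weight_mul_enorm_triple_le {Ψ Φ : ℝ × ℝ → ℂ} (hΨ : Measurable Ψ) (hΦ : Measurable Φ)
    {S : Set ℝ} (hS : volume S ≠ ⊤) (x : ℝ) {y : ℝ} (hy : majorant Φ y ≠ ⊤) :
    ENNReal.ofReal (triWeight x y) * ‖triple Ψ Φ S x y‖ₑ ≤
      ∫⁻ q : ℝ × ℝ, modulated Ψ (x, q.1) * modulated Ψ (x + y, q.2) *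
        (ENNReal.ofReal |y| * timeTransform Φ S (y, q.1 - q.2 + 2 * x * y + y ^ 2)) := by
  have hH := measurable_timeTransform hΦ S
  have hΨx : Measurable fun τ => Ψ (x, τ) := hΨ.comp measurable_prodMk_left
  have hΨz : Measurable fun τ => Ψ (x + y, τ) := hΨ.comp measurable_prodMk_left
  have h1 := enorm_integral_fourierInversion_mul_le hΨx.aestronglyMeasurable
    hΨz.aestronglyMeasurable (integrableOn_evolution hΦ hS hy)
  have h2 : ∫⁻ a, ∫⁻ c, ‖Ψ (x, a)‖ₑ * ‖Ψ (x + y, c)‖ₑ * timeTransform Φ S (y, a - c) =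
      ∫⁻ q : ℝ × ℝ, ‖Ψ (x, q.1 - x ^ 2)‖ₑ * ‖Ψ (x + y, q.2 - (x + y) ^ 2)‖ₑ *
        timeTransform Φ S (y, q.1 - q.2 + 2 * x * y + y ^ 2) := by
    rw [Measure.volume_eq_prod, lintegral_prod _ (by fun_prop),
      ← lintegral_sub_right_eq_self _ (x ^ 2)]
    refine lintegral_congr fun l => ?_
    rw [← lintegral_sub_right_eq_self _ ((x + y) ^ 2)]
    refine lintegral_congr fun k => ?_
    simp only
    have : l - x ^ 2 - (k - (x + y) ^ 2) = l - k + 2 * x * y + y ^ 2 := by ring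
    rw [this]
  calc _ ≤ ENNReal.ofReal (triWeight x y) *
        ∫⁻ a, ∫⁻ c, ‖Ψ (x, a)‖ₑ * ‖Ψ (x + y, c)‖ₑ * timeTransform Φ S (y, a - c) :=
        mul_le_mul_right h1 _
    _ = _ := by
      rw [h2, ← lintegral_const_mul' _ _ ENNReal.ofReal_ne_top]
      refine lintegral_congr fun q => ?_
      simp only [modulated, triWeight, weight_one]
      rw [ENNReal.ofReal_mul (abs_nonneg _), ENNReal.ofReal_mul (bracket_pos _).le]
      ring

/-- Integrate over the frequencies first, at fixed modulations, by the transversality bound; then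
sum over both modulations using b > 1/2. Half of |y| is paid by the Jacobian and half by the norm of
Φ, while ⟨x⟩ and ⟨x + y⟩ are the H¹ weights of the two Schrödinger factors. The constant does not
depend on S. -/
theorem lintegral_triple_le {Ψ Φ : ℝ × ℝ → ℂ} (hΨ : Measurable Ψ) (hΦ : Measurable Φ)
    {h : ℝ → ℝ} (hh : Measurable h) {b : ℝ} (hb : 0 ≤ b) {S : Set ℝ} (hS : MeasurableSet S)
    (hSfin : volume S ≠ ⊤) (hΦfin : ∀ᵐ y, majorant Φ y ≠ ⊤) :
    ∫⁻ p : ℝ × ℝ, ENNReal.ofReal (triWeight p.1 p.2) * ‖triple Ψ Φ S p.1 p.2‖ₑ ≤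
      tailConst b * ENNReal.ofReal (2 * Real.pi) ^ (1 / 2 : ℝ) *
        (restrictionNorm (fun ξ => ξ ^ 2) 1 b Ψ ^ 2 * restrictionNorm h (1 / 2) b Φ) := by
  set A := restrictionNorm (fun ξ => ξ ^ 2) 1 b Ψ with hA
  set B := restrictionNorm h (1 / 2) b Φ
  have hF := measurable_modulated hΨ
  have hH := measurable_timeTransform hΦ S
  have hpoint : ∀ᵐ p : ℝ × ℝ, ENNReal.ofReal (triWeight p.1 p.2) * ‖triple Ψ Φ S p.1 p.2‖ₑ ≤
      ∫⁻ q : ℝ × ℝ, modulated Ψ (p.1, q.1) * modulated Ψ (p.1 + p.2, q.2) *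
        (ENNReal.ofReal |p.2| *
          timeTransform Φ S (p.2, q.1 - q.2 + 2 * p.1 * p.2 + p.2 ^ 2)) := by
    have hae : ∀ᵐ p : ℝ × ℝ, majorant Φ p.2 ≠ ⊤ := by
      rw [Measure.volume_eq_prod]
      exact Measure.quasiMeasurePreserving_snd.ae hΦfin
    filter_upwards [hae] with p hp
    exact weight_mul_enorm_triple_le hΨ hΦ hSfin p.1 hp
  refine (lintegral_mono_ae hpoint).trans ?_
  rw [lintegral_lintegral_swap (by fun_prop)]
  set n : ℝ → ℝ≥0∞ := fun l => (∫⁻ x, modulated Ψ (x, l) ^ 2) ^ (1 / 2 : ℝ)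
  have hn0 : Measurable fun l => ∫⁻ x, modulated Ψ (x, l) ^ 2 :=
    Measurable.lintegral_prod_left' (f := fun p : ℝ × ℝ => modulated Ψ p ^ 2) (by fun_prop)
  have hn : Measurable n := hn0.pow_const _
  calc _ ≤ ∫⁻ q : ℝ × ℝ, n q.1 * n q.2 * (ENNReal.ofReal (2 * Real.pi) * B ^ 2) ^ (1 / 2 : ℝ) := by
        refine lintegral_mono fun q => ?_
        refine (lintegral_transversal_le (f := fun x => modulated Ψ (x, q.1))
          (g := fun x => modulated Ψ (x, q.2))
          (by fun_prop) (by fun_prop) hH (q.1 - q.2)).trans ?_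
        exact mul_le_mul_right (ENNReal.rpow_le_rpow
          (lintegral_timeTransform_sq_le hΦ hh hb hS) (by norm_num)) _
    _ = (∫⁻ l, n l) ^ 2 * (ENNReal.ofReal (2 * Real.pi) * B ^ 2) ^ (1 / 2 : ℝ) := by
        rw [lintegral_mul_const _ (by fun_prop), Measure.volume_eq_prod,
          lintegral_prod_mul hn.aemeasurable hn.aemeasurable, pow_two (∫⁻ l, n l)]
    _ ≤ tailConst b * A ^ 2 * (ENNReal.ofReal (2 * Real.pi) * B ^ 2) ^ (1 / 2 : ℝ) :=
        mul_le_mul_left (lintegral_modulated_le hΨ b) _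
    _ = _ := by
        rw [ENNReal.mul_rpow_of_nonneg _ _ (by norm_num), ← ENNReal.rpow_natCast B,
          ← ENNReal.rpow_mul]
        norm_num
        ring

end SBO
end

noncomputable section

namespace SBO

/-! ### Weighted convolution estimates -/

/-- The norm of `⟨ξ⟩^σ f` in `L²`. -/
def weightedNorm (σ : ℝ) (f : ℝ → ℝ≥0∞) : ℝ≥0∞ := (∫⁻ ξ, (weight σ ξ * f ξ) ^ 2) ^ (1 / 2 : ℝ)

theorem lintegral_conv_eq {X : ℝ → ℝ → ℝ≥0∞} (hX : Measurable fun p : ℝ × ℝ => X p.1 p.2) :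
    ∫⁻ ξ, ∫⁻ η, X (ξ - η) η = ∫⁻ x, ∫⁻ y, X x y := by
  have h1 : Measurable fun p : ℝ × ℝ => X (p.1 - p.2) p.2 :=
    hX.comp (f := fun p : ℝ × ℝ => (p.1 - p.2, p.2)) (by fun_prop)
  rw [lintegral_lintegral_swap h1.aemeasurable, lintegral_lintegral_swap hX.aemeasurable]
  refine lintegral_congr fun η => ?_
  exact lintegral_sub_right_eq_self (fun x => X x η) η

/-- The weighted supremum bound for a bilinear convolution. -/
theorem mul_lintegral_conv_le {k : ℝ → ℝ} {κ : ℝ → ℝ → ℝ} {σ σ' C : ℝ} (hk : ∀ ξ, 0 ≤ k ξ)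
    (hC : 0 ≤ C) (h : ∀ x y, k (x + y) * κ x y ≤ C * (bracket x ^ σ * bracket y ^ σ'))
    {f g : ℝ → ℝ≥0∞} (hf : Measurable f) (hg : Measurable g) (ξ : ℝ) :
    ENNReal.ofReal (k ξ) * ∫⁻ η, ENNReal.ofReal (κ (ξ - η) η) * (f (ξ - η) * g η) ≤
      ENNReal.ofReal C * (weightedNorm σ f * weightedNorm σ' g) := by
  have hw := measurable_weight σ
  have hw' := measurable_weight σ'
  rw [← lintegral_const_mul' _ _ ENNReal.ofReal_ne_top]
  calc _ ≤ ∫⁻ η, ENNReal.ofReal C * ((weight σ (ξ - η) * f (ξ - η)) * (weight σ' η * g η)) := by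
        refine lintegral_mono fun η => ?_
        have := h (ξ - η) η
        rw [sub_add_cancel] at this
        simp only
        rw [← mul_assoc, ← ENNReal.ofReal_mul (hk ξ)]
        calc _ ≤ ENNReal.ofReal (C * (bracket (ξ - η) ^ σ * bracket η ^ σ')) *
              (f (ξ - η) * g η) := by gcongr
          _ = _ := by
            rw [ENNReal.ofReal_mul hC, ENNReal.ofReal_mul (by have := bracket_pos (ξ - η); positivity)]
            unfold weight
            ring
    _ ≤ _ := by
        rw [lintegral_const_mul' _ _ ENNReal.ofReal_ne_top]
        refine mul_le_mul_right ((lintegral_mul_le_sqrt volume (by fun_prop) (by fun_prop)).trans_eq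
          ?_) _
        rw [lintegral_sub_left_eq_self (fun x => (weight σ x * f x) ^ 2) ξ]
        rfl

theorem lintegral_le_weightedNorm {f : ℝ → ℝ≥0∞} (hf : Measurable f) :
    ∫⁻ ξ, f ξ ≤ tailConst 1 ^ (1 / 2 : ℝ) * weightedNorm 1 f := by
  have hw := measurable_weight 1
  have hw' := measurable_weight (-1)
  have e : ∀ ξ, f ξ = weight (-1) ξ * (weight 1 ξ * f ξ) := fun ξ => by
    rw [← mul_assoc, weight_mul_neg, one_mul]
  rw [lintegral_congr e]
  exact lintegral_mul_le_sqrt volume (by fun_prop) (by fun_prop)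

theorem lintegral_conv_le {f g : ℝ → ℝ≥0∞} (hf : Measurable f) (hg : Measurable g) :
    ∫⁻ ξ, ∫⁻ η, f (ξ - η) * g η ≤ tailConst 1 * (weightedNorm 1 f * weightedNorm 1 g) := by
  rw [lintegral_conv_eq (X := fun x y => f x * g y) (by fun_prop)]
  have e : ∀ x, ∫⁻ y, f x * g y = f x * ∫⁻ y, g y := fun x => lintegral_const_mul _ hg
  rw [lintegral_congr e, lintegral_mul_const _ hf]
  calc _ ≤ _ := mul_le_mul' (lintegral_le_weightedNorm hf) (lintegral_le_weightedNorm hg)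
    _ = (tailConst 1 ^ (1 / 2 : ℝ)) ^ 2 * (weightedNorm 1 f * weightedNorm 1 g) := by ring
    _ = _ := by rw [rpow_half_sq]

/-- Cauchy-Schwarz in the plane: the kernel ⟨x + y⟩^(-1/2) ⟨x⟩^(-1) ⟨y⟩^(-1/2) is square integrable,
because ∫ ⟨x + y⟩^(-1) ⟨y⟩^(-1) dy ≤ ∫ ⟨y⟩^(-2) dy for every x, and ⟨x⟩^(-2) is integrable. -/
theorem lintegral_weight_conv_le {f g : ℝ → ℝ≥0∞} (hf : Measurable f) (hg : Measurable g) :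
    ∫⁻ ξ, weight (-(1 / 2)) ξ * ∫⁻ η, f (ξ - η) * g η ≤
      tailConst 1 * (weightedNorm 1 f * weightedNorm (1 / 2) g) := by
  have hw := measurable_weight 1
  have hwh := measurable_weight (1 / 2)
  have hw' := measurable_weight (-1)
  have hwh' := measurable_weight (-(1 / 2))
  have e : ∀ ξ, weight (-(1 / 2)) ξ * ∫⁻ η, f (ξ - η) * g η =
      ∫⁻ η, (fun x y => weight (-(1 / 2)) (x + y) * (f x * g y)) (ξ - η) η := by
    intro ξ
    simp only [sub_add_cancel]
    rw [lintegral_const_mul' _ _ (weight_ne_top _ _)]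
  rw [lintegral_congr e, lintegral_conv_eq
    (X := fun x y => weight (-(1 / 2)) (x + y) * (f x * g y)) (by fun_prop)]
  have hm : Measurable fun p : ℝ × ℝ => weight (-(1 / 2)) (p.1 + p.2) * (f p.1 * g p.2) := by
    fun_prop
  rw [← lintegral_prod (fun p : ℝ × ℝ => weight (-(1 / 2)) (p.1 + p.2) * (f p.1 * g p.2))
    hm.aemeasurable]
  let k : ℝ × ℝ → ℝ≥0∞ := fun p =>
    weight (-(1 / 2)) (p.1 + p.2) * (weight (-1) p.1 * weight (-(1 / 2)) p.2)
  have hk : Measurable k := by fun_prop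
  have e2 : ∀ p : ℝ × ℝ, weight (-(1 / 2)) (p.1 + p.2) * (f p.1 * g p.2) =
      k p * ((weight 1 p.1 * f p.1) * (weight (1 / 2) p.2 * g p.2)) := by
    intro p
    calc _ = weight (-(1 / 2)) (p.1 + p.2) * ((weight (-1) p.1 * weight 1 p.1) *
          (weight (-(1 / 2)) p.2 * weight (1 / 2) p.2) * (f p.1 * g p.2)) := by
          rw [weight_mul_neg, weight_mul_neg, one_mul, one_mul]
      _ = _ := by simp only [k]; ring
  rw [lintegral_congr e2]
  refine (lintegral_mul_le_sqrt _ hk.aemeasurable (by fun_prop)).trans ?_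
  refine mul_le_mul' ?_ (le_of_eq ?_)
  · rw [← ENNReal.rpow_le_rpow_iff (z := 2) (by norm_num), ← ENNReal.rpow_mul]
    norm_num
    rw [lintegral_prod _ (by fun_prop)]
    have h1 : ∀ x, ∫⁻ y, k (x, y) ^ 2 ≤ weight (-1) x ^ 2 * tailConst 1 := by
      intro x
      have e3 : ∀ y, k (x, y) ^ 2 = weight (-1) x ^ 2 * (weight (-1) (x + y) * weight (-1) y) := by
        intro y
        simp only [k]
        rw [mul_pow, mul_pow, pow_two (weight (-(1 / 2)) (x + y)), pow_two (weight (-(1 / 2)) y),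
          weight_mul, weight_mul]
        norm_num
        ring
      rw [lintegral_congr e3, lintegral_const_mul' _ _ (by simp [weight_ne_top])]
      gcongr
      refine (lintegral_mul_le_sqrt volume (by fun_prop) (by fun_prop)).trans_eq ?_
      rw [lintegral_add_left_eq_self (fun y => weight (-1) y ^ 2), ← ENNReal.rpow_add_of_nonneg]
      · norm_num [tailConst]
      · norm_num
      · norm_num
    refine (lintegral_mono h1).trans_eq ?_
    rw [lintegral_mul_const _ (by fun_prop), pow_two]
    rfl
  · simp only [mul_pow]
    rw [lintegral_prod_mul (f := fun x => weight 1 x ^ 2 * f x ^ 2)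
      (g := fun y => weight (1 / 2) y ^ 2 * g y ^ 2) (by fun_prop) (by fun_prop),
      ENNReal.mul_rpow_of_nonneg _ _ (by norm_num)]
    simp only [weightedNorm, mul_pow]

/-! ### The nonlinear terms -/

/-- The transform of `u v` at time `t`, for `Iu` and `Iv` with the space-time transforms `Ψ`, `Φ`. -/
def prodTransform (m : ℝ → ℝ) (Ψ Φ : ℝ × ℝ → ℂ) (ξ t : ℝ) : ℂ :=
  (√(2 * Real.pi) : ℂ)⁻¹ *
    ∫ η, ((m (ξ - η) : ℂ)⁻¹ * evolution Ψ (ξ - η) t) * ((m η : ℂ)⁻¹ * evolution Φ η t)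

/-- The transform of `|u|²` at time `t`, for `Iu` with the space-time transform `Ψ`. -/
def absSqTransform (m : ℝ → ℝ) (Ψ : ℝ × ℝ → ℂ) (ξ t : ℝ) : ℂ :=
  (√(2 * Real.pi) : ℂ)⁻¹ *
    ∫ η, ((m (ξ - η) : ℂ)⁻¹ * evolution Ψ (ξ - η) t) *
      (starRingEnd ℂ) ((m (-η) : ℂ)⁻¹ * evolution Ψ (-η) t)

section Measurability

variable {m : ℝ → ℝ} {Ψ Φ : ℝ × ℝ → ℂ}

theorem measurable_evolution_comp {X : Type*} [MeasurableSpace X] (hΨ : Measurable Ψ)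
    {a c : X → ℝ} (ha : Measurable a) (hc : Measurable c) :
    Measurable fun q => evolution Ψ (a q) (c q) :=
  (measurable_evolution hΨ).comp (g := fun p : ℝ × ℝ => evolution Ψ p.1 p.2)
    (f := fun q => (a q, c q)) (ha.prodMk hc)

theorem measurable_prodTransform (hm : Measurable m) (hΨ : Measurable Ψ) (hΦ : Measurable Φ) :
    Measurable fun p : ℝ × ℝ => prodTransform m Ψ Φ p.1 p.2 := by
  have h1 : Measurable fun q : (ℝ × ℝ) × ℝ => evolution Ψ (q.1.1 - q.2) q.1.2 :=
    measurable_evolution_comp hΨ (by fun_prop) (by fun_prop)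
  have h2 : Measurable fun q : (ℝ × ℝ) × ℝ => evolution Φ q.2 q.1.2 :=
    measurable_evolution_comp hΦ (by fun_prop) (by fun_prop)
  have h3 : Measurable fun q : (ℝ × ℝ) × ℝ => ((m (q.1.1 - q.2) : ℂ)⁻¹ *
      evolution Ψ (q.1.1 - q.2) q.1.2) * ((m q.2 : ℂ)⁻¹ * evolution Φ q.2 q.1.2) := by
    fun_prop
  exact h3.stronglyMeasurable.integral_prod_right'.measurable.const_mul _

theorem measurable_absSqTransform (hm : Measurable m) (hΨ : Measurable Ψ) :
    Measurable fun p : ℝ × ℝ => absSqTransform m Ψ p.1 p.2 := by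
  have h1 : Measurable fun q : (ℝ × ℝ) × ℝ => evolution Ψ (q.1.1 - q.2) q.1.2 :=
    measurable_evolution_comp hΨ (by fun_prop) (by fun_prop)
  have h2 : Measurable fun q : (ℝ × ℝ) × ℝ => evolution Ψ (-q.2) q.1.2 :=
    measurable_evolution_comp hΨ (by fun_prop) (by fun_prop)
  have h3 : Measurable fun q : (ℝ × ℝ) × ℝ => ((m (q.1.1 - q.2) : ℂ)⁻¹ *
      evolution Ψ (q.1.1 - q.2) q.1.2) *
      (starRingEnd ℂ) ((m (-q.2) : ℂ)⁻¹ * evolution Ψ (-q.2) q.1.2) := by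
    have : Measurable (starRingEnd ℂ : ℂ → ℂ) := Complex.continuous_conj.measurable
    fun_prop
  exact h3.stronglyMeasurable.integral_prod_right'.measurable.const_mul _

end Measurability

end SBO
end

/-! ### Multilinear bounds for the nonlinear terms and their commutators -/

noncomputable section

namespace SBO

/-- The inequalities for the symbol that enter the estimates of the increments. -/
structure SymbolBounds (ν N C : ℝ) (m : ℝ → ℝ) : Prop where
  one_le : 1 ≤ N
  one_le_const : 1 ≤ C
  cont : Continuous m
  even : ∀ x, m (-x) = m x
  pos : ∀ x, 0 < m x
  le_one : ∀ x, m x ≤ 1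
  inv_le : ∀ x, (m x)⁻¹ ≤ 2 * bracket x
  mul_sqrt_le : ∀ x y,
    m (x + y) * √(bracket (x + y)) ≤ C * (bracket x * √(bracket y) * (m x * m y))
  sub_mul_sqrt_le : ∀ x y, |m (x + y) - m x * m y| * √(bracket (x + y)) ≤
    C / N * (bracket x * √(bracket y) * (m x * m y))
  add_mul_sub_le : ∀ x y, |x + y| * |m (x + y) - m x * m y| ≤
    C / N * (|x| * |y| * (m x * m y))
  bracket_mul_sq_le : ∀ x y, bracket y * m y ^ 2 ≤
    C * (bracket x * bracket (x + y) * triSymbol m x y)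
  sq_sub_sq_le : ∀ x y, |(x + y) ^ 2 * m (x + y) ^ 2 - x ^ 2 * m x ^ 2| ≤
    C * (triWeight x y * triSymbol m x y)
  energySymbol_le : ∀ x y, |energySymbol ν m x y| ≤ C / N * (triWeight x y * triSymbol m x y)
  momentumSymbol_le : ∀ x y, |momentumSymbol m x y| ≤ C / N * (triWeight x y * triSymbol m x y)
  bounded : ∀ R, ∃ M, ∀ x, x ^ 2 * m x ^ 2 ≤ R → |x| ≤ M

/-- The constant in `IsSymbol.symbolBounds`. -/
def symbolConst (ν K : ℝ) : ℝ :=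
  (2 + ν) * IsSymbol.commConst K + 2 * IsSymbol.commConst K + 2 * IsSymbol.commConst' K + 5

theorem IsSymbol.symbolBounds {s N K ν : ℝ} {m : ℝ → ℝ} (hm : IsSymbol s N K m) (hs : 1 / 4 ≤ s)
    (hs1 : s ≤ 1) (hN : 1 ≤ N) (hν : 0 ≤ ν) : SymbolBounds ν N (symbolConst ν K) m := by
  have hK := hm.const_nonneg hN
  have h1 := IsSymbol.commConst_pos hK
  have h2 := IsSymbol.commConst'_pos hK
  have h3 : 0 ≤ ν * IsSymbol.commConst K := by positivity
  have hN0 : 0 < N := by linarith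
  have hp := hm.pos hs hN
  have ht := hm.triSymbol_pos hs hN
  have hb := bracket_pos
  have hw := triWeight_nonneg
  have key : ∀ {a c d : ℝ}, 0 ≤ d → c ≤ symbolConst ν K → a ≤ c * d → a ≤ symbolConst ν K * d :=
    fun hd hc ha => ha.trans (mul_le_mul_of_nonneg_right hc hd)
  have keyN : ∀ {a c d : ℝ}, 0 ≤ d → c ≤ symbolConst ν K → a ≤ c / N * d →
      a ≤ symbolConst ν K / N * d :=
    fun hd hc ha => ha.trans (by gcongr)
  refine ⟨hN, ?_, hm.smooth.continuous, hm.even, hp, hm.le_one hN, hm.inv_le hs hN,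
    fun x y => key ?_ ?_ (hm.mul_sqrt_le hs hs1 hN x y),
    fun x y => keyN ?_ ?_ (hm.abs_sub_mul_sqrt_le hs hs1 hN x y),
    fun x y => keyN ?_ ?_ (hm.abs_add_mul_abs_sub_le hs hs1 hN x y),
    fun x y => key ?_ ?_ (hm.bracket_mul_sq_le hs hs1 hN x y),
    fun x y => key ?_ ?_ (hm.abs_sq_sub_sq_le hs hs1 hN x y),
    fun x y => keyN ?_ ?_ (hm.abs_energySymbol_le hs hs1 hN hν x y),
    fun x y => keyN ?_ ?_ (hm.abs_momentumSymbol_le hs hs1 hN x y),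
    fun R => ⟨_, fun x hx => hm.bounded_of_sq_mul_sq_le hs hN hx⟩⟩
  all_goals first
    | (unfold symbolConst; nlinarith)
    | (have := hp x; have := hp y; have := hb x; have := hb y; positivity)
    | (have := hb x; have := hb (x + y); have := ht x y; positivity)
    | (have := hw x y; have := ht x y; positivity)

namespace SymbolBounds

variable {ν N C : ℝ} {m : ℝ → ℝ}

theorem triSymbol_pos (hm : SymbolBounds ν N C m) (x y : ℝ) : 0 < triSymbol m x y :=
  mul_pos (mul_pos (hm.pos _) (hm.pos _)) (hm.pos _)

theorem const_pos (hm : SymbolBounds ν N C m) : 0 < C := by linarith [hm.one_le_const]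

theorem const_div_nonneg (hm : SymbolBounds ν N C m) : 0 ≤ C / N :=
  div_nonneg hm.const_pos.le (by linarith [hm.one_le])

/-- The commutator bound, with 1/N ≤ 1, plus the trivial bound for the product m(x) m(y). It keeps
the forcing ∂ₓI(|u|²) bounded in frequency. -/
theorem add_mul_le (hm : SymbolBounds ν N C m) (x y : ℝ) :
    |x + y| * m (x + y) ≤ (C + 2) * (bracket x * bracket y * (m x * m y)) := by
  have hp := mul_pos (hm.pos x) (hm.pos y)
  have h1 := hm.add_mul_sub_le x y
  have hx := abs_le_bracket x
  have hy := abs_le_bracket y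
  have hx1 := one_le_bracket x
  have hy1 := one_le_bracket y
  have hxy : |x| * |y| ≤ bracket x * bracket y :=
    mul_le_mul hx hy (abs_nonneg _) (bracket_pos _).le
  have h2 : C / N ≤ C := div_le_self hm.const_pos.le hm.one_le
  have h3 : |x + y| ≤ 2 * (bracket x * bracket y) := by
    refine (abs_add_le x y).trans ?_
    nlinarith
  have h4 : C / N * (|x| * |y| * (m x * m y)) ≤ C * (bracket x * bracket y * (m x * m y)) := by
    have := hm.const_pos
    have := bracket_pos x
    have := bracket_pos y
    gcongr
  have h5 : m (x + y) ≤ |m (x + y) - m x * m y| + m x * m y := by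
    linarith [le_abs_self (m (x + y) - m x * m y)]
  calc |x + y| * m (x + y) ≤ |x + y| * (|m (x + y) - m x * m y| + m x * m y) := by gcongr
    _ = |x + y| * |m (x + y) - m x * m y| + |x + y| * (m x * m y) := by ring
    _ ≤ C * (bracket x * bracket y * (m x * m y)) + 2 * (bracket x * bracket y) * (m x * m y) := by
        exact add_le_add (h1.trans h4) (mul_le_mul_of_nonneg_right h3 hp.le)
    _ = _ := by ring

theorem inv_mul_inv_le (hm : SymbolBounds ν N C m) (x y : ℝ) :
    (m x)⁻¹ * (m y)⁻¹ ≤ 4 * (bracket x * bracket y) := by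
  have h1 := hm.inv_le x
  have h2 := hm.inv_le y
  have h3 := inv_pos.mpr (hm.pos x)
  have h4 := inv_pos.mpr (hm.pos y)
  have := bracket_pos x
  calc _ ≤ (2 * bracket x) * (2 * bracket y) := by gcongr
    _ = _ := by ring

end SymbolBounds

theorem ne_top_of_mul_le {a c d : ℝ≥0∞} (ha : a ≠ 0) (h : a * c ≤ d) (hd : d ≠ ⊤) : c ≠ ⊤ := by
  rintro rfl
  rw [ENNReal.mul_top ha] at h
  exact hd (top_le_iff.mp h)

theorem sqrt_bracket (x : ℝ) : √(bracket x) = bracket x ^ (1 / 2 : ℝ) := Real.sqrt_eq_rpow _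

theorem weight_half (x : ℝ) : weight (1 / 2) x = ENNReal.ofReal (√(bracket x)) := by
  rw [sqrt_bracket]; rfl

theorem enorm_ofReal_complex (r : ℝ) : ‖(r : ℂ)‖ₑ = ENNReal.ofReal |r| := by
  rw [← ofReal_norm, Complex.norm_real, Real.norm_eq_abs]

/-! ### Convolutions of evolutions -/

section Convolution

variable {ν N C : ℝ} {m : ℝ → ℝ} {f g : ℝ → ℝ≥0∞} {Ψ Φ : ℝ × ℝ → ℂ}

theorem SymbolBounds.mul_lintegral_prod_le (hm : SymbolBounds ν N C m) (hf : Measurable f)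
    (hg : Measurable g) (ξ : ℝ) :
    ENNReal.ofReal (m ξ * √(bracket ξ)) *
        ∫⁻ η, ENNReal.ofReal ((m (ξ - η))⁻¹ * (m η)⁻¹) * (f (ξ - η) * g η) ≤
      ENNReal.ofReal C * (weightedNorm 1 f * weightedNorm (1 / 2) g) := by
  refine mul_lintegral_conv_le (k := fun ξ => m ξ * √(bracket ξ))
    (κ := fun x y => (m x)⁻¹ * (m y)⁻¹)
    (fun ξ => by have := hm.pos ξ; positivity) hm.const_pos.le (fun x y => ?_) hf hg ξ
  have hx := hm.pos x
  have hy := hm.pos y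
  rw [← sqrt_bracket, Real.rpow_one, ← mul_inv, ← div_eq_mul_inv, div_le_iff₀ (by positivity),
    mul_assoc]
  exact hm.mul_sqrt_le x y

theorem SymbolBounds.lintegral_absSq_le (hm : SymbolBounds ν N C m) (hf : Measurable f)
    (hg : Measurable g) (ξ : ℝ) :
    ∫⁻ η, ENNReal.ofReal ((m (ξ - η))⁻¹ * (m η)⁻¹) * (f (ξ - η) * g η) ≤
      ENNReal.ofReal 4 * (weightedNorm 1 f * weightedNorm 1 g) := by
  have := mul_lintegral_conv_le (k := fun _ => 1) (σ := 1) (σ' := 1) (C := 4)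
    (κ := fun x y => (m x)⁻¹ * (m y)⁻¹) (by simp) (by norm_num)
    (fun x y => by simpa using hm.inv_mul_inv_le x y) hf hg ξ
  simpa only [ENNReal.ofReal_one, one_mul] using this

theorem SymbolBounds.abs_mul_lintegral_absSq_le (hm : SymbolBounds ν N C m) (hf : Measurable f)
    (hg : Measurable g) (ξ : ℝ) :
    ENNReal.ofReal (|ξ| * m ξ) *
        ∫⁻ η, ENNReal.ofReal ((m (ξ - η))⁻¹ * (m η)⁻¹) * (f (ξ - η) * g η) ≤
      ENNReal.ofReal (C + 2) * (weightedNorm 1 f * weightedNorm 1 g) := by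
  refine mul_lintegral_conv_le (k := fun ξ => |ξ| * m ξ)
    (κ := fun x y => (m x)⁻¹ * (m y)⁻¹)
    (fun ξ => by have := hm.pos ξ; positivity) (by linarith [hm.const_pos]) (fun x y => ?_) hf hg ξ
  have hx := hm.pos x
  have hy := hm.pos y
  rw [Real.rpow_one, Real.rpow_one, ← mul_inv, ← div_eq_mul_inv, div_le_iff₀ (by positivity),
    mul_assoc]
  exact hm.add_mul_le x y

theorem lintegral_conv_le_weightedNorm (hf : Measurable f) (hg : Measurable g) (ξ : ℝ) :
    ∫⁻ η, f (ξ - η) * g η ≤ weightedNorm 1 f * weightedNorm (1 / 2) g := by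
  have := mul_lintegral_conv_le (k := fun _ => 1) (σ := 1) (σ' := 1 / 2) (C := 1)
    (κ := fun x y => 1) (by simp) (by norm_num)
    (fun x y => by
      have h1 := one_le_bracket x
      have h2 := Real.one_le_rpow (one_le_bracket y) (z := 1 / 2) (by norm_num)
      rw [Real.rpow_one]
      nlinarith) hf hg ξ
  simpa only [ENNReal.ofReal_one, one_mul] using this

theorem SymbolBounds.enorm_prodTransform_le (hm : SymbolBounds ν N C m) (ξ t : ℝ) :
    ‖prodTransform m Ψ Φ ξ t‖ₑ ≤ ∫⁻ η, ENNReal.ofReal ((m (ξ - η))⁻¹ * (m η)⁻¹) *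
      (majorant Ψ (ξ - η) * majorant Φ η) := by
  refine (enorm_const_mul_le _).trans ((enorm_integral_le_lintegral_enorm _).trans
    (lintegral_mono fun η => ?_))
  have h1 := hm.pos (ξ - η)
  have h2 := hm.pos η
  rw [enorm_mul, enorm_mul, enorm_mul, ← Complex.ofReal_inv, ← Complex.ofReal_inv,
    enorm_ofReal_complex, enorm_ofReal_complex, abs_of_pos (by positivity),
    abs_of_pos (by positivity), ENNReal.ofReal_mul (by positivity), mul_mul_mul_comm]
  gcongr <;> exact enorm_evolution_le _ _ _

theorem enorm_prodTransform_one_le (ξ t : ℝ) :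
    ‖prodTransform (fun _ => 1) Ψ Φ ξ t‖ₑ ≤ ∫⁻ η, majorant Ψ (ξ - η) * majorant Φ η := by
  refine (enorm_const_mul_le _).trans ((enorm_integral_le_lintegral_enorm _).trans
    (lintegral_mono fun η => ?_))
  simp only [enorm_mul, Complex.ofReal_one, inv_one, one_mul]
  gcongr <;> exact enorm_evolution_le _ _ _

theorem SymbolBounds.enorm_absSqTransform_le (hm : SymbolBounds ν N C m) (ξ t : ℝ) :
    ‖absSqTransform m Ψ ξ t‖ₑ ≤ ∫⁻ η, ENNReal.ofReal ((m (ξ - η))⁻¹ * (m η)⁻¹) *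
      (majorant Ψ (ξ - η) * majorant Ψ (-η)) := by
  refine (enorm_const_mul_le _).trans ((enorm_integral_le_lintegral_enorm _).trans
    (lintegral_mono fun η => ?_))
  have h1 := hm.pos (ξ - η)
  have h2 := hm.pos η
  rw [enorm_mul, RCLike.enorm_conj, enorm_mul, enorm_mul, hm.even, ← Complex.ofReal_inv,
    ← Complex.ofReal_inv,
    enorm_ofReal_complex, enorm_ofReal_complex, abs_of_pos (by positivity),
    abs_of_pos (by positivity), ENNReal.ofReal_mul (by positivity), mul_mul_mul_comm]
  gcongr <;> exact enorm_evolution_le _ _ _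

theorem enorm_absSqTransform_one_le (ξ t : ℝ) :
    ‖absSqTransform (fun _ => 1) Ψ ξ t‖ₑ ≤ ∫⁻ η, majorant Ψ (ξ - η) * majorant Ψ (-η) := by
  refine (enorm_const_mul_le _).trans ((enorm_integral_le_lintegral_enorm _).trans
    (lintegral_mono fun η => ?_))
  simp only [enorm_mul, Complex.ofReal_one, inv_one, one_mul, RCLike.enorm_conj]
  gcongr <;> exact enorm_evolution_le _ _ _

theorem weightedNorm_comp_neg (σ : ℝ) (f : ℝ → ℝ≥0∞) :
    weightedNorm σ (fun ξ => f (-ξ)) = weightedNorm σ f := by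
  unfold weightedNorm
  rw [← lintegral_neg_eq_self]
  simp only [neg_neg, weight_neg]

/-- The commutator of the multiplier with the product. -/
theorem SymbolBounds.enorm_prodTransform_sub_le (hm : SymbolBounds ν N C m) (hΨ : Measurable Ψ)
    (hΦ : Measurable Φ) (hΨf : weightedNorm 1 (majorant Ψ) ≠ ⊤)
    (hΦf : weightedNorm (1 / 2) (majorant Φ) ≠ ⊤) (ξ t : ℝ) :
    weight (1 / 2) ξ * ‖m ξ * prodTransform m Ψ Φ ξ t - prodTransform (fun _ => 1) Ψ Φ ξ t‖ₑ ≤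
      ENNReal.ofReal (C / N) * (weightedNorm 1 (fun ξ => ‖evolution Ψ ξ t‖ₑ) *
        weightedNorm (1 / 2) (fun ξ => ‖evolution Φ ξ t‖ₑ)) := by
  have hmm := hm.cont.measurable
  have h1 : Measurable fun η => evolution Ψ (ξ - η) t :=
    measurable_evolution_comp hΨ (by fun_prop) (by fun_prop)
  have h2 : Measurable fun η => evolution Φ η t :=
    measurable_evolution_comp hΦ (by fun_prop) (by fun_prop)
  have h1' : Measurable fun η => evolution Ψ η t :=
    measurable_evolution_comp hΨ (by fun_prop) (by fun_prop)
  -- The two convolution integrals must converge separately before they are subtracted under one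
  -- integral sign. Convergence follows from the uniform bound `mul_lintegral_prod_le`, whose
  -- prefactor m(ξ)⟨ξ⟩^(1/2) is not zero.
  have hP : Integrable fun η =>
      ((m (ξ - η) : ℂ)⁻¹ * evolution Ψ (ξ - η) t) * ((m η : ℂ)⁻¹ * evolution Φ η t) := by
    refine ⟨Measurable.aestronglyMeasurable (by fun_prop), ?_⟩
    have hk : ENNReal.ofReal (m ξ * √(bracket ξ)) ≠ 0 := by
      have := hm.pos ξ
      have := bracket_pos ξ
      rw [Ne, ENNReal.ofReal_eq_zero, not_le]; positivity
    refine lt_of_le_of_lt (lintegral_mono fun η => ?_)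
      (lt_top_iff_ne_top.mpr (ne_top_of_mul_le hk
        (hm.mul_lintegral_prod_le (measurable_majorant hΨ) (measurable_majorant hΦ) ξ)
        (ENNReal.mul_ne_top ENNReal.ofReal_ne_top (ENNReal.mul_ne_top hΨf hΦf))))
    have h1 := hm.pos (ξ - η)
    have h2 := hm.pos η
    rw [enorm_mul, enorm_mul, enorm_mul, ← Complex.ofReal_inv, ← Complex.ofReal_inv,
      enorm_ofReal_complex, enorm_ofReal_complex, abs_of_pos (by positivity),
      abs_of_pos (by positivity), ENNReal.ofReal_mul (by positivity), mul_mul_mul_comm]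
    gcongr <;> exact enorm_evolution_le _ _ _
  have hD : Integrable fun η => evolution Ψ (ξ - η) t * evolution Φ η t := by
    refine ⟨Measurable.aestronglyMeasurable (by fun_prop), ?_⟩
    refine lt_of_le_of_lt (lintegral_mono fun η => ?_)
      (lt_top_iff_ne_top.mpr (ne_top_of_le_ne_top (ENNReal.mul_ne_top hΨf hΦf)
        (lintegral_conv_le_weightedNorm (measurable_majorant hΨ) (measurable_majorant hΦ) ξ)))
    rw [enorm_mul]
    gcongr <;> exact enorm_evolution_le _ _ _
  have e : m ξ * prodTransform m Ψ Φ ξ t - prodTransform (fun _ => 1) Ψ Φ ξ t =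
      (√(2 * Real.pi) : ℂ)⁻¹ * ∫ η, ((m ξ - m (ξ - η) * m η) * ((m (ξ - η))⁻¹ * (m η)⁻¹) : ℝ) *
        (evolution Ψ (ξ - η) t * evolution Φ η t) := by
    simp only [prodTransform, Complex.ofReal_one, inv_one, one_mul]
    rw [← mul_assoc, mul_comm (m ξ : ℂ), mul_assoc, ← mul_sub, ← integral_const_mul,
      ← integral_sub (hP.const_mul _) hD]
    congr 2
    ext η
    have h3 : (m (ξ - η) : ℂ) ≠ 0 := by exact_mod_cast (hm.pos _).ne'
    have h4 : (m η : ℂ) ≠ 0 := by exact_mod_cast (hm.pos _).ne'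
    push_cast
    field_simp
  rw [e, weight_half]
  calc _ ≤ ENNReal.ofReal (√(bracket ξ)) *
        ∫⁻ η, ENNReal.ofReal (|m ξ - m (ξ - η) * m η| * ((m (ξ - η))⁻¹ * (m η)⁻¹)) *
          (‖evolution Ψ (ξ - η) t‖ₑ * ‖evolution Φ η t‖ₑ) := by
        refine mul_le_mul_right ((enorm_const_mul_le _).trans
          ((enorm_integral_le_lintegral_enorm _).trans (lintegral_mono fun η => ?_))) _
        have h1 := hm.pos (ξ - η)
        have h2 := hm.pos η
        rw [enorm_mul, enorm_mul, enorm_ofReal_complex, abs_mul,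
          abs_of_pos (a := (m (ξ - η))⁻¹ * (m η)⁻¹) (by positivity)]
    _ ≤ _ := by
        have := mul_lintegral_conv_le (k := fun ξ => √(bracket ξ))
          (κ := fun x y => |m (x + y) - m x * m y| * ((m x)⁻¹ * (m y)⁻¹)) (σ := 1) (σ' := 1 / 2)
          (fun ξ => by positivity) hm.const_div_nonneg (fun x y => by
            have hx := hm.pos x
            have hy := hm.pos y
            rw [← sqrt_bracket, Real.rpow_one, ← mul_inv, ← mul_assoc, ← div_eq_mul_inv,
              div_le_iff₀ (by positivity), mul_assoc (C / N), mul_comm (√_)]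
            exact hm.sub_mul_sqrt_le x y) (f := fun ξ => ‖evolution Ψ ξ t‖ₑ)
          (g := fun ξ => ‖evolution Φ ξ t‖ₑ) h1'.enorm h2.enorm ξ
        simpa only [sub_add_cancel] using this

theorem SymbolBounds.enorm_absSqTransform_sub_le (hm : SymbolBounds ν N C m) (hΨ : Measurable Ψ)
    (hΨf : weightedNorm 1 (majorant Ψ) ≠ ⊤) (ξ t : ℝ) :
    ENNReal.ofReal |ξ| *
        ‖m ξ * absSqTransform m Ψ ξ t - absSqTransform (fun _ => 1) Ψ ξ t‖ₑ ≤
      ENNReal.ofReal (C / N) * weightedNorm 1 (fun ξ => ‖evolution Ψ ξ t‖ₑ) ^ 2 := by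
  have hmm := hm.cont.measurable
  have h1 : Measurable fun η => evolution Ψ (ξ - η) t :=
    measurable_evolution_comp hΨ (by fun_prop) (by fun_prop)
  have h2 : Measurable fun η => evolution Ψ (-η) t :=
    measurable_evolution_comp hΨ (by fun_prop) (by fun_prop)
  have h1' : Measurable fun η => evolution Ψ η t :=
    measurable_evolution_comp hΨ (by fun_prop) (by fun_prop)
  have hconj : Measurable (starRingEnd ℂ : ℂ → ℂ) := Complex.continuous_conj.measurable
  have hM := measurable_majorant hΨ
  have hP : Integrable fun η => ((m (ξ - η) : ℂ)⁻¹ * evolution Ψ (ξ - η) t) *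
      (starRingEnd ℂ) ((m (-η) : ℂ)⁻¹ * evolution Ψ (-η) t) := by
    refine ⟨Measurable.aestronglyMeasurable (by fun_prop), ?_⟩
    refine lt_of_le_of_lt (lintegral_mono fun η => ?_)
      (lt_top_iff_ne_top.mpr (ne_top_of_le_ne_top
        (ENNReal.mul_ne_top ENNReal.ofReal_ne_top (ENNReal.mul_ne_top hΨf ?_))
        (hm.lintegral_absSq_le hM (g := fun η => majorant Ψ (-η)) (by fun_prop) ξ)))
    swap
    · rw [weightedNorm_comp_neg]; exact hΨf
    have h1 := hm.pos (ξ - η)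
    have h2 := hm.pos η
    rw [enorm_mul, RCLike.enorm_conj, enorm_mul, enorm_mul, hm.even, ← Complex.ofReal_inv,
      ← Complex.ofReal_inv,
      enorm_ofReal_complex, enorm_ofReal_complex, abs_of_pos (by positivity),
      abs_of_pos (by positivity), ENNReal.ofReal_mul (by positivity), mul_mul_mul_comm]
    gcongr <;> exact enorm_evolution_le _ _ _
  -- Since m ≤ 1, dividing by the symbols only enlarges the integrand, so the previous integrability
  -- dominates this one.
  have hD : Integrable fun η => evolution Ψ (ξ - η) t * (starRingEnd ℂ) (evolution Ψ (-η) t) := by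
    refine (hP.norm.const_mul 1).mono' (Measurable.aestronglyMeasurable (by fun_prop))
      (Filter.Eventually.of_forall fun η => ?_)
    have h3 : (1 : ℝ) ≤ (m (ξ - η))⁻¹ := (one_le_inv₀ (hm.pos _)).mpr (hm.le_one _)
    have h4 : (1 : ℝ) ≤ (m (-η))⁻¹ := (one_le_inv₀ (hm.pos _)).mpr (hm.le_one _)
    simp only [norm_mul, RCLike.norm_conj, one_mul, norm_inv, Complex.norm_real,
      Real.norm_of_nonneg (hm.pos _).le]
    gcongr
    · exact le_mul_of_one_le_left (norm_nonneg _) h3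
    · exact le_mul_of_one_le_left (norm_nonneg _) h4
  have e : m ξ * absSqTransform m Ψ ξ t - absSqTransform (fun _ => 1) Ψ ξ t =
      (√(2 * Real.pi) : ℂ)⁻¹ * ∫ η, ((m ξ - m (ξ - η) * m η) * ((m (ξ - η))⁻¹ * (m η)⁻¹) : ℝ) *
        (evolution Ψ (ξ - η) t * (starRingEnd ℂ) (evolution Ψ (-η) t)) := by
    simp only [absSqTransform, Complex.ofReal_one, inv_one, one_mul]
    rw [← mul_assoc, mul_comm (m ξ : ℂ), mul_assoc, ← mul_sub, ← integral_const_mul,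
      ← integral_sub (hP.const_mul _) hD]
    congr 2
    ext η
    have h3 : (m (ξ - η) : ℂ) ≠ 0 := by exact_mod_cast (hm.pos _).ne'
    have h4 : (m η : ℂ) ≠ 0 := by exact_mod_cast (hm.pos _).ne'
    rw [map_mul, map_inv₀, Complex.conj_ofReal, hm.even]
    push_cast
    field_simp
  rw [e]
  calc _ ≤ ENNReal.ofReal |ξ| *
        ∫⁻ η, ENNReal.ofReal (|m ξ - m (ξ - η) * m η| * ((m (ξ - η))⁻¹ * (m η)⁻¹)) *
          (‖evolution Ψ (ξ - η) t‖ₑ * ‖evolution Ψ (-η) t‖ₑ) := by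
        refine mul_le_mul_right ((enorm_const_mul_le _).trans
          ((enorm_integral_le_lintegral_enorm _).trans (lintegral_mono fun η => ?_))) _
        have h1 := hm.pos (ξ - η)
        have h2 := hm.pos η
        rw [enorm_mul, enorm_mul, enorm_ofReal_complex, abs_mul, RCLike.enorm_conj,
          abs_of_pos (a := (m (ξ - η))⁻¹ * (m η)⁻¹) (by positivity)]
    _ ≤ _ := by
        have := mul_lintegral_conv_le (k := fun ξ => |ξ|)
          (κ := fun x y => |m (x + y) - m x * m y| * ((m x)⁻¹ * (m y)⁻¹)) (σ := 1) (σ' := 1)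
          (fun ξ => by positivity) hm.const_div_nonneg (fun x y => by
            have hx := hm.pos x
            have hy := hm.pos y
            have hb := bracket_pos x
            rw [Real.rpow_one, Real.rpow_one, ← mul_inv, ← mul_assoc, ← div_eq_mul_inv,
              div_le_iff₀ (by positivity), mul_assoc (C / N)]
            refine (hm.add_mul_sub_le x y).trans ?_
            have := hm.const_div_nonneg
            gcongr <;> exact abs_le_bracket _) (f := fun ξ => ‖evolution Ψ ξ t‖ₑ)
          (g := fun ξ => ‖evolution Ψ (-ξ) t‖ₑ) h1'.enorm h2.enorm ξ
        rw [weightedNorm_comp_neg 1 (fun ξ => ‖evolution Ψ ξ t‖ₑ)] at this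
        simpa only [sub_add_cancel, ← pow_two] using this

end Convolution

/-! ### The quadrilinear estimates -/

section Quadrilinear

variable {ν N C b : ℝ} {m h : ℝ → ℝ} {Ψ Φ : ℝ × ℝ → ℂ}

theorem weightedNorm_majorant_le (hh : Measurable h) (σ b : ℝ) (hΨ : Measurable Ψ) :
    weightedNorm σ (majorant Ψ) ≤ tailConst b ^ (1 / 2 : ℝ) * restrictionNorm h σ b Ψ := by
  have := ENNReal.rpow_le_rpow (lintegral_majorant_sq_le hh σ b hΨ) (z := 1 / 2) (by norm_num)
  refine this.trans_eq ?_
  rw [ENNReal.mul_rpow_of_nonneg _ _ (by norm_num), ← ENNReal.rpow_natCast, ← ENNReal.rpow_mul]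
  norm_num

theorem measurable_weightedNorm_evolution (σ : ℝ) (hΨ : Measurable Ψ) :
    Measurable fun t => weightedNorm σ (fun ξ => ‖evolution Ψ ξ t‖ₑ) := by
  have hw := measurable_weight σ
  have h1 : Measurable fun p : ℝ × ℝ => (weight σ p.2 * ‖evolution Ψ p.2 p.1‖ₑ) ^ 2 := by
    have : Measurable fun p : ℝ × ℝ => evolution Ψ p.2 p.1 :=
      measurable_evolution_comp hΨ (by fun_prop) (by fun_prop)
    fun_prop
  exact h1.lintegral_prod_right'.pow_const _

theorem lintegral_weightedNorm_evolution_sq_le (hh : Measurable h) (σ : ℝ) (hb : 0 ≤ b)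
    (hΨ : Measurable Ψ) :
    ∫⁻ t, weightedNorm σ (fun ξ => ‖evolution Ψ ξ t‖ₑ) ^ 2 ≤ restrictionNorm h σ b Ψ ^ 2 := by
  have hw := measurable_weight σ
  refine le_trans (le_of_eq ?_) (lintegral_evolution_sq_le hh σ hb hΨ)
  simp only [weightedNorm, rpow_half_sq]
  have h1 : Measurable fun p : ℝ × ℝ => (weight σ p.2 * ‖evolution Ψ p.2 p.1‖ₑ) ^ 2 := by
    have : Measurable fun p : ℝ × ℝ => evolution Ψ p.2 p.1 :=
      measurable_evolution_comp hΨ (by fun_prop) (by fun_prop)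
    fun_prop
  rw [lintegral_lintegral_swap (f := fun t ξ => (weight σ ξ * ‖evolution Ψ ξ t‖ₑ) ^ 2)
    h1.aemeasurable]

/-- At each time, ⟨ξ⟩^(1/2) goes to the commutator, which is then bounded in ξ by C/N times the
norms of Iu(t) and Iv(t); ⟨ξ⟩^(-1/2) goes to the product, which becomes integrable in ξ uniformly in
t. In time, the two norms are paired in L², so no power of δ is lost. -/
theorem SymbolBounds.lintegral_prod_commutator_le (hm : SymbolBounds ν N C m)
    (hh : Measurable h) (hb : 1 / 2 < b) (hΨ : Measurable Ψ) (hΦ : Measurable Φ)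
    (hΨf : restrictionNorm (fun ξ => ξ ^ 2) 1 b Ψ ≠ ⊤) (hΦf : restrictionNorm h (1 / 2) b Φ ≠ ⊤)
    (S : Set ℝ) :
    ∫⁻ t in S, ∫⁻ ξ, ‖prodTransform (fun _ => 1) Ψ Φ ξ t‖ₑ *
        ‖m ξ * prodTransform m Ψ Φ ξ t - prodTransform (fun _ => 1) Ψ Φ ξ t‖ₑ ≤
      ENNReal.ofReal (C / N) * (tailConst 1 * tailConst b) *
        (restrictionNorm (fun ξ => ξ ^ 2) 1 b Ψ ^ 2 * restrictionNorm h (1 / 2) b Φ ^ 2) := by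
  set A := restrictionNorm (fun ξ => ξ ^ 2) 1 b Ψ
  set B := restrictionNorm h (1 / 2) b Φ
  have hT := (tailConst_lt_top hb).ne
  have hT' : tailConst b ^ (1 / 2 : ℝ) ≠ ⊤ := ENNReal.rpow_ne_top_of_nonneg (by norm_num) hT
  have hM := measurable_majorant hΨ
  have hM' := measurable_majorant hΦ
  have hΨn : weightedNorm 1 (majorant Ψ) ≤ tailConst b ^ (1 / 2 : ℝ) * A :=
    weightedNorm_majorant_le (by fun_prop) 1 b hΨ
  have hΦn : weightedNorm (1 / 2) (majorant Φ) ≤ tailConst b ^ (1 / 2 : ℝ) * B :=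
    weightedNorm_majorant_le hh (1 / 2) b hΦ
  set w : ℝ → ℝ≥0∞ := fun t => weightedNorm 1 (fun ξ => ‖evolution Ψ ξ t‖ₑ) *
    weightedNorm (1 / 2) (fun ξ => ‖evolution Φ ξ t‖ₑ)
  have hw : ∫⁻ t in S, w t ≤ A * B := by
    refine (setLIntegral_le_lintegral _ _).trans ((lintegral_mul_le_sqrt volume
      (measurable_weightedNorm_evolution 1 hΨ).aemeasurable
      (measurable_weightedNorm_evolution (1 / 2) hΦ).aemeasurable).trans ?_)
    have e : ∀ X : ℝ≥0∞, X = (X ^ 2) ^ (1 / 2 : ℝ) := fun X => by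
      rw [← ENNReal.rpow_natCast, ← ENNReal.rpow_mul]; norm_num
    rw [e A, e B]
    gcongr
    · exact lintegral_weightedNorm_evolution_sq_le (by fun_prop) 1 (by linarith) hΨ
    · exact lintegral_weightedNorm_evolution_sq_le hh _ (by linarith) hΦ
  have hmw : Measurable w :=
    (measurable_weightedNorm_evolution 1 hΨ).mul (measurable_weightedNorm_evolution (1 / 2) hΦ)
  have hpt : ∀ t, ∫⁻ ξ, ‖prodTransform (fun _ => 1) Ψ Φ ξ t‖ₑ *
        ‖m ξ * prodTransform m Ψ Φ ξ t - prodTransform (fun _ => 1) Ψ Φ ξ t‖ₑ ≤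
      (tailConst 1 * (weightedNorm 1 (majorant Ψ) * weightedNorm (1 / 2) (majorant Φ))) *
        (ENNReal.ofReal (C / N) * w t) := by
    intro t
    have hconv : Measurable fun ξ => ∫⁻ η, majorant Ψ (ξ - η) * majorant Φ η :=
      Measurable.lintegral_prod_right' (f := fun p : ℝ × ℝ => majorant Ψ (p.1 - p.2) *
        majorant Φ p.2) (by fun_prop)
    have hwt := measurable_weight (-(1 / 2))
    calc _ ≤ ∫⁻ ξ, (weight (-(1 / 2)) ξ * ∫⁻ η, majorant Ψ (ξ - η) * majorant Φ η) *
          (ENNReal.ofReal (C / N) * w t) := by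
          refine lintegral_mono fun ξ => ?_
          simp only
          rw [← one_mul (‖prodTransform (fun _ => 1) Ψ Φ ξ t‖ₑ), ← weight_mul_neg (1 / 2) ξ]
          calc _ = (weight (-(1 / 2)) ξ * ‖prodTransform (fun _ => 1) Ψ Φ ξ t‖ₑ) *
                (weight (1 / 2) ξ *
                ‖m ξ * prodTransform m Ψ Φ ξ t - prodTransform (fun _ => 1) Ψ Φ ξ t‖ₑ) := by ring
            _ ≤ _ := by
              refine mul_le_mul' (mul_le_mul_right (enorm_prodTransform_one_le ξ t) _) ?_
              exact hm.enorm_prodTransform_sub_le hΨ hΦ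
                  (ne_top_of_le_ne_top (ENNReal.mul_ne_top hT' hΨf) hΨn)
                  (ne_top_of_le_ne_top (ENNReal.mul_ne_top hT' hΦf) hΦn) ξ t
      _ ≤ _ := by
          rw [lintegral_mul_const _ (by fun_prop)]
          gcongr
          exact lintegral_weight_conv_le hM hM'
  refine (lintegral_mono hpt).trans ?_
  rw [lintegral_const_mul _ (by fun_prop), lintegral_const_mul _ hmw]
  calc _ ≤ (tailConst 1 * ((tailConst b ^ (1 / 2 : ℝ) * A) * (tailConst b ^ (1 / 2 : ℝ) * B))) *
        (ENNReal.ofReal (C / N) * (A * B)) := by gcongr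
    _ = ENNReal.ofReal (C / N) * (tailConst 1 * (tailConst b ^ (1 / 2 : ℝ)) ^ 2) *
        (A ^ 2 * B ^ 2) := by ring
    _ = _ := by rw [rpow_half_sq]

/-- The derivative |ξ| is absorbed entirely by the commutator; the transform of |Iu|² is integrable
in ξ without a weight, as the convolution of two integrable functions. -/
theorem SymbolBounds.lintegral_absSq_commutator_le (hm : SymbolBounds ν N C m)
    (hb : 1 / 2 < b) (hΨ : Measurable Ψ)
    (hΨf : restrictionNorm (fun ξ => ξ ^ 2) 1 b Ψ ≠ ⊤) (S : Set ℝ) :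
    ∫⁻ t in S, ∫⁻ ξ, ‖absSqTransform (fun _ => 1) Ψ ξ t‖ₑ * (ENNReal.ofReal |ξ| *
        ‖m ξ * absSqTransform m Ψ ξ t - absSqTransform (fun _ => 1) Ψ ξ t‖ₑ) ≤
      ENNReal.ofReal (C / N) * (tailConst 1 * tailConst b) *
        restrictionNorm (fun ξ => ξ ^ 2) 1 b Ψ ^ 4 := by
  set A := restrictionNorm (fun ξ => ξ ^ 2) 1 b Ψ
  have hT := (tailConst_lt_top hb).ne
  have hT' : tailConst b ^ (1 / 2 : ℝ) ≠ ⊤ := ENNReal.rpow_ne_top_of_nonneg (by norm_num) hT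
  have hM := measurable_majorant hΨ
  have hΨn : weightedNorm 1 (majorant Ψ) ≤ tailConst b ^ (1 / 2 : ℝ) * A :=
    weightedNorm_majorant_le (by fun_prop) 1 b hΨ
  set w : ℝ → ℝ≥0∞ := fun t => weightedNorm 1 (fun ξ => ‖evolution Ψ ξ t‖ₑ) ^ 2
  have hw : ∫⁻ t in S, w t ≤ A ^ 2 := (setLIntegral_le_lintegral _ _).trans
    (lintegral_weightedNorm_evolution_sq_le (by fun_prop) 1 (by linarith) hΨ)
  have hmw : Measurable w := (measurable_weightedNorm_evolution 1 hΨ).pow_const _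
  have hpt : ∀ t, ∫⁻ ξ, ‖absSqTransform (fun _ => 1) Ψ ξ t‖ₑ * (ENNReal.ofReal |ξ| *
        ‖m ξ * absSqTransform m Ψ ξ t - absSqTransform (fun _ => 1) Ψ ξ t‖ₑ) ≤
      (tailConst 1 * (weightedNorm 1 (majorant Ψ) * weightedNorm 1 (majorant Ψ))) *
        (ENNReal.ofReal (C / N) * w t) := by
    intro t
    have hconv : Measurable fun ξ => ∫⁻ η, majorant Ψ (ξ - η) * majorant Ψ (-η) :=
      Measurable.lintegral_prod_right' (f := fun p : ℝ × ℝ => majorant Ψ (p.1 - p.2) *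
        majorant Ψ (-p.2)) (by fun_prop)
    calc _ ≤ ∫⁻ ξ, (∫⁻ η, majorant Ψ (ξ - η) * majorant Ψ (-η)) *
          (ENNReal.ofReal (C / N) * w t) := by
          refine lintegral_mono fun ξ => ?_
          simp only
          refine mul_le_mul' (enorm_absSqTransform_one_le ξ t) ?_
          exact hm.enorm_absSqTransform_sub_le hΨ
              (ne_top_of_le_ne_top (ENNReal.mul_ne_top hT' hΨf) hΨn) ξ t
      _ ≤ _ := by
          rw [lintegral_mul_const _ (by fun_prop)]
          gcongr
          refine (lintegral_conv_le hM (g := fun η => majorant Ψ (-η)) (by fun_prop)).trans_eq ?_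
          rw [weightedNorm_comp_neg]
  refine (lintegral_mono hpt).trans ?_
  rw [lintegral_const_mul _ (by fun_prop), lintegral_const_mul _ hmw]
  calc _ ≤ (tailConst 1 * ((tailConst b ^ (1 / 2 : ℝ) * A) * (tailConst b ^ (1 / 2 : ℝ) * A))) *
        (ENNReal.ofReal (C / N) * A ^ 2) := by gcongr
    _ = ENNReal.ofReal (C / N) * (tailConst 1 * (tailConst b ^ (1 / 2 : ℝ)) ^ 2) * A ^ 4 := by ring
    _ = _ := by rw [rpow_half_sq]

end Quadrilinear

end SBO
end

noncomputable section

namespace SBO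

/-! ### Lipschitz curves and their derivatives -/

/-- The curve `x` is Lipschitz on `[0, δ]` with derivative `f` almost everywhere. -/
def HasAEDeriv (δ : ℝ) (x f : ℝ → ℂ) : Prop :=
  (∃ L, LipschitzOnWith L x (Icc 0 δ)) ∧ ∀ᵐ t, t ∈ Ioo 0 δ → HasDerivAt x (f t) t

namespace HasAEDeriv

variable {δ : ℝ} {x y f g : ℝ → ℂ}

theorem exists_norm_le (hx : HasAEDeriv δ x f) : ∃ M, ∀ t ∈ Icc 0 δ, ‖x t‖ ≤ M := by
  obtain ⟨⟨L, hL⟩, -⟩ := hx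
  exact isCompact_Icc.exists_bound_of_continuousOn hL.continuousOn

theorem mul (hx : HasAEDeriv δ x f) (hy : HasAEDeriv δ y g) :
    HasAEDeriv δ (fun t => x t * y t) (fun t => f t * y t + x t * g t) := by
  obtain ⟨M, hM⟩ := hx.exists_norm_le
  obtain ⟨M', hM'⟩ := hy.exists_norm_le
  obtain ⟨⟨L, hL⟩, hx'⟩ := hx
  obtain ⟨⟨L', hL'⟩, hy'⟩ := hy
  refine ⟨⟨L * M'.toNNReal + M.toNNReal * L', ?_⟩, ?_⟩
  · refine LipschitzOnWith.of_dist_le_mul fun s hs t ht => ?_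
    have h1 := hL.dist_le_mul s hs t ht
    have h2 := hL'.dist_le_mul s hs t ht
    rw [dist_eq_norm] at h1 h2 ⊢
    have e : x s * y s - x t * y t = (x s - x t) * y s + x t * (y s - y t) := by ring
    rw [e]
    refine (norm_add_le _ _).trans ?_
    rw [norm_mul, norm_mul]
    have h3 := (hM' s hs).trans (Real.le_coe_toNNReal M')
    have h4 := (hM t ht).trans (Real.le_coe_toNNReal M)
    push_cast
    calc _ ≤ (L * dist s t) * M'.toNNReal + M.toNNReal * (L' * dist s t) := by gcongr
      _ = _ := by ring
  · filter_upwards [hx', hy'] with t h1 h2 ht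
    exact (h1 ht).mul (h2 ht)

theorem conj (hx : HasAEDeriv δ x f) :
    HasAEDeriv δ (fun t => (starRingEnd ℂ) (x t)) (fun t => (starRingEnd ℂ) (f t)) := by
  obtain ⟨⟨L, hL⟩, hx'⟩ := hx
  refine ⟨⟨L, LipschitzOnWith.of_dist_le_mul fun s hs t ht => ?_⟩, ?_⟩
  · have := hL.dist_le_mul s hs t ht
    rwa [dist_eq_norm, ← map_sub, RCLike.norm_conj, ← dist_eq_norm]
  · filter_upwards [hx'] with t h1 ht
    exact (h1 ht).star

theorem congr (hx : HasAEDeriv δ x f) (h : ∀ t ∈ Icc 0 δ, y t = x t) : HasAEDeriv δ y f := by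
  obtain ⟨⟨L, hL⟩, hx'⟩ := hx
  refine ⟨⟨L, fun s hs t ht => by rw [h s hs, h t ht]; exact hL hs ht⟩, ?_⟩
  filter_upwards [hx'] with t h1 ht
  exact (h1 ht).congr_of_eventuallyEq (Filter.eventuallyEq_of_mem (Icc_mem_nhds ht.1 ht.2) h)

theorem of_hasDerivAt {L : ℝ} (h : ∀ t, HasDerivAt x (f t) t) (hL : ∀ t, ‖f t‖ ≤ L) :
    HasAEDeriv δ x f := by
  refine ⟨⟨L.toNNReal, ?_⟩, Filter.Eventually.of_forall fun t _ => h t⟩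
  refine (Convex.lipschitzOnWith_of_nnnorm_hasDerivWithin_le (convex_Icc 0 δ)
    (fun t _ => (h t).hasDerivWithinAt) fun t _ => ?_)
  rw [← NNReal.coe_le_coe, coe_nnnorm]
  exact (hL t).trans (Real.le_coe_toNNReal L)

theorem of_integral {M : ℝ} (hf : IntervalIntegrable f volume 0 δ)
    (hM : ∀ t ∈ Icc 0 δ, ‖f t‖ ≤ M) (hδ : 0 ≤ δ) :
    HasAEDeriv δ (fun t => ∫ r in (0 : ℝ)..t, f r) f := by
  have hsub : ∀ {s t}, s ∈ Icc 0 δ → t ∈ Icc 0 δ → IntervalIntegrable f volume s t :=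
    fun hs ht => hf.mono_set (by
      rw [uIcc_of_le hδ]
      exact uIcc_subset_Icc hs ht)
  refine ⟨⟨M.toNNReal, LipschitzOnWith.of_dist_le_mul fun s hs t ht => ?_⟩, ?_⟩
  · have h0 : (0 : ℝ) ∈ Icc 0 δ := ⟨le_rfl, hδ⟩
    rw [dist_eq_norm, intervalIntegral.integral_interval_sub_left (hsub h0 hs) (hsub h0 ht),
      dist_comm, Real.dist_eq, abs_sub_comm]
    refine intervalIntegral.norm_integral_le_of_norm_le_const fun r hr => ?_
    exact (hM r (uIcc_subset_Icc ht hs (uIoc_subset_uIcc hr))).trans (Real.le_coe_toNNReal M)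
  · filter_upwards [hf.ae_hasDerivAt_integral] with t h1 ht
    exact h1 (by rw [uIcc_of_le hδ]; exact Ioo_subset_Icc_self ht) 0 left_mem_uIcc

/-- The fundamental theorem of calculus. -/
theorem sub_eq (hx : HasAEDeriv δ x f) (hδ : 0 ≤ δ) : x δ - x 0 = ∫ t in Ioc 0 δ, f t := by
  obtain ⟨⟨L, hL⟩, hx'⟩ := hx
  -- No measurability of f is assumed, so the argument runs with the derivative itself, which is
  -- measurable, bounded by the Lipschitz constant and almost everywhere equal to f on the interval.
  let F : ℝ → ℂ := (Ioo 0 δ).indicator (deriv x)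
  have hFm : Measurable F := (measurable_deriv x).indicator measurableSet_Ioo
  have hFb : ∀ t, ‖F t‖ ≤ L := by
    intro t
    by_cases ht : t ∈ Ioo 0 δ
    · simp only [F, indicator_of_mem ht]
      exact norm_deriv_le_of_lipschitzOn (Icc_mem_nhds ht.1 ht.2) hL
    · simp [F, ht]
  have hFi : IntervalIntegrable F volume 0 δ := by
    rw [intervalIntegrable_iff]
    exact Measure.integrableOn_of_bounded (M := L) (by simp [uIoc]) hFm.aestronglyMeasurable
      (Filter.Eventually.of_forall hFb)
  obtain ⟨⟨L', hL'⟩, hF'⟩ := of_integral hFi (fun t _ => hFb t) hδ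
  -- A difference of two Lipschitz curves is absolutely continuous; its derivative vanishes almost
  -- everywhere, so it is constant.
  have hac : AbsolutelyContinuousOnInterval (fun t => x t - ∫ r in (0 : ℝ)..t, F r) 0 δ := by
    refine LipschitzOnWith.absolutelyContinuousOnInterval (K := L + L') ?_
    rw [uIcc_of_le hδ]
    refine LipschitzOnWith.of_dist_le_mul fun s hs t ht => ?_
    have h1 := hL.dist_le_mul s hs t ht
    have h2 := hL'.dist_le_mul s hs t ht
    rw [dist_eq_norm] at h1 h2 ⊢
    rw [sub_sub_sub_comm]
    refine (norm_sub_le _ _).trans ((add_le_add h1 h2).trans_eq ?_)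
    push_cast; ring
  have hne : ∀ᵐ t : ℝ, t ≠ 0 ∧ t ≠ δ := by
    have h0 : ∀ᵐ t : ℝ, t ≠ 0 := by simp [ae_iff]
    have h1 : ∀ᵐ t : ℝ, t ≠ δ := by simp [ae_iff]
    exact h0.and h1
  obtain ⟨c, hc⟩ := hac.const_of_ae_hasDerivAt_zero (by
    filter_upwards [hx', hF', hne] with t h1 h2 h3 ht
    rw [uIcc_of_le hδ] at ht
    have ht' : t ∈ Ioo 0 δ := ⟨lt_of_le_of_ne ht.1 h3.1.symm, lt_of_le_of_ne ht.2 h3.2⟩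
    have h4 := (h1 ht').sub (h2 ht')
    have h5 : F t = f t := by simp only [F, indicator_of_mem ht', (h1 ht').deriv]
    rw [h5, sub_self] at h4
    exact h4)
  have h0 := hc 0 left_mem_uIcc
  have h1 := hc δ right_mem_uIcc
  rw [← h0, intervalIntegral.integral_same, sub_zero, intervalIntegral.integral_of_le hδ] at h1
  rw [← h1, sub_sub_cancel]
  refine setIntegral_congr_ae measurableSet_Ioc ?_
  filter_upwards [hx', hne] with t h1 h3 ht
  have ht' : t ∈ Ioo 0 δ := ⟨ht.1, lt_of_le_of_ne ht.2 h3.2⟩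
  simp only [F, indicator_of_mem ht', (h1 ht').deriv]

end HasAEDeriv

/-- A solution of a Duhamel equation is differentiable almost everywhere. -/
theorem hasAEDeriv_of_duhamel {δ θ M : ℝ} {c : ℂ} {x F : ℝ → ℂ} (hδ : 0 ≤ δ) (hF : Measurable F)
    (hM : ∀ t ∈ Icc 0 δ, ‖F t‖ ≤ M)
    (h : ∀ t ∈ Icc 0 δ, x t = Complex.exp (-Complex.I * (t * θ : ℝ)) * x 0 +
      c * ∫ r in (0 : ℝ)..t, Complex.exp (-Complex.I * ((t - r) * θ : ℝ)) * F r) :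
    HasAEDeriv δ x (fun t => -Complex.I * θ * x t + c * F t) := by
  have hexp : ∀ a : ℝ, ‖Complex.exp (-Complex.I * (a : ℂ))‖ = 1 := fun a => by
    have := norm_exp_I_mul (-a)
    push_cast at this
    rwa [mul_neg, ← neg_mul] at this
  have hG : Measurable fun r : ℝ => Complex.exp (-Complex.I * ((-r) * θ : ℝ)) * F r :=
    (Continuous.measurable (by fun_prop)).mul hF
  have hGb : ∀ t ∈ Icc 0 δ, ‖Complex.exp (-Complex.I * ((-t) * θ : ℝ)) * F t‖ ≤ M := by
    intro t ht
    rw [norm_mul, hexp, one_mul]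
    exact hM t ht
  have hGi : IntervalIntegrable (fun r : ℝ => Complex.exp (-Complex.I * ((-r) * θ : ℝ)) * F r)
      volume 0 δ := by
    rw [intervalIntegrable_iff, uIoc_of_le hδ]
    refine Measure.integrableOn_of_bounded (M := M) (by simp) hG.aestronglyMeasurable ?_
    filter_upwards [ae_restrict_mem measurableSet_Ioc] with t ht
    exact hGb t (Ioc_subset_Icc_self ht)
  have h1 := HasAEDeriv.of_integral hGi hGb hδ
  have h2 : HasAEDeriv δ (fun t : ℝ => Complex.exp (-Complex.I * (t * θ : ℝ)))
      (fun t : ℝ => Complex.exp (-Complex.I * (t * θ : ℝ)) * (-Complex.I * θ)) := by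
    refine HasAEDeriv.of_hasDerivAt (L := |θ|) (fun t => ?_) (fun t => ?_)
    · have h3 : HasDerivAt (fun t : ℝ => -Complex.I * ((t * θ : ℝ) : ℂ)) (-Complex.I * θ) t := by
        have h4 := ((hasDerivAt_id t).mul_const θ).ofReal_comp
        simpa using h4.const_mul (-Complex.I)
      exact h3.cexp
    · rw [norm_mul, hexp]
      simp
  have h0 : HasAEDeriv δ (fun _ : ℝ => x 0) (fun _ => 0) :=
    HasAEDeriv.of_hasDerivAt (L := 0) (fun t => hasDerivAt_const t _) (by simp)
  have hc : HasAEDeriv δ (fun _ : ℝ => c) (fun _ => 0) :=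
    HasAEDeriv.of_hasDerivAt (L := 0) (fun t => hasDerivAt_const t _) (by simp)
  have hE : ∀ t r : ℝ, Complex.exp (-Complex.I * ((t - r) * θ : ℝ)) =
      Complex.exp (-Complex.I * (t * θ : ℝ)) * Complex.exp (-Complex.I * ((-r) * θ : ℝ)) := by
    intro t r
    rw [← Complex.exp_add]
    congr 1
    push_cast; ring
  -- Taking exp(-itθ) out of the Duhamel integral leaves an integrand independent of t, so only
  -- products of Lipschitz curves have to be differentiated.
  have hx : ∀ t ∈ Icc 0 δ, x t = Complex.exp (-Complex.I * (t * θ : ℝ)) * x 0 +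
      Complex.exp (-Complex.I * (t * θ : ℝ)) *
        (c * ∫ r in (0 : ℝ)..t, Complex.exp (-Complex.I * ((-r) * θ : ℝ)) * F r) := by
    intro t ht
    rw [h t ht]
    simp only [hE t, mul_assoc]
    rw [intervalIntegral.integral_const_mul]
    ring
  have h3 := (h2.mul h0)
  have h4 := h2.mul (hc.mul h1)
  obtain ⟨⟨L, hL⟩, h3'⟩ := h3
  obtain ⟨⟨L', hL'⟩, h4'⟩ := h4
  have h5 : HasAEDeriv δ (fun t => Complex.exp (-Complex.I * (t * θ : ℝ)) * x 0 +
      Complex.exp (-Complex.I * (t * θ : ℝ)) *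
        (c * ∫ r in (0 : ℝ)..t, Complex.exp (-Complex.I * ((-r) * θ : ℝ)) * F r))
      (fun t => -Complex.I * θ * x t + c * F t) := by
    refine ⟨⟨L + L', LipschitzOnWith.of_dist_le_mul fun s hs t ht => ?_⟩, ?_⟩
    · have h1 := hL.dist_le_mul s hs t ht
      have h2 := hL'.dist_le_mul s hs t ht
      rw [dist_eq_norm] at h1 h2 ⊢
      rw [add_sub_add_comm]
      refine (norm_add_le _ _).trans ((add_le_add h1 h2).trans_eq ?_)
      push_cast; ring
    · filter_upwards [h3', h4'] with t a1 a2 ht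
      convert! (a1 ht).add (a2 ht) using 1
      rw [hx t (Ioo_subset_Icc_self ht)]
      have e1 : Complex.exp (-Complex.I * (t * θ : ℝ)) *
          Complex.exp (-Complex.I * ((-t) * θ : ℝ)) = 1 := by
        rw [← hE, sub_self]; simp
      linear_combination (-c * F t) * e1
  exact h5.congr hx

/-- Two families of continuous curves that agree almost everywhere at each time agree at all times
almost everywhere. -/
theorem ae_forall_eq_of_forall_ae_eq {δ : ℝ} {x y : ℝ → ℝ → ℂ}
    (hx : ∀ᵐ ξ, ContinuousOn (x ξ) (Icc 0 δ)) (hy : ∀ᵐ ξ, ContinuousOn (y ξ) (Icc 0 δ))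
    (h : ∀ t ∈ Icc 0 δ, ∀ᵐ ξ, x ξ t = y ξ t) : ∀ᵐ ξ, ∀ t ∈ Icc 0 δ, x ξ t = y ξ t := by
  obtain ⟨D, hD, hD'⟩ := TopologicalSpace.exists_countable_dense (Icc 0 δ)
  have h1 : ∀ᵐ ξ, ∀ t ∈ D, x ξ t = y ξ t :=
    (ae_ball_iff hD).mpr fun t _ => h t t.2
  filter_upwards [hx, hy, h1] with ξ a1 a2 a3 t ht
  have := Continuous.ext_on hD' (continuousOn_iff_continuous_domRestrict.mp a1)
    (continuousOn_iff_continuous_domRestrict.mp a2) a3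
  exact congrFun this ⟨t, ht⟩

theorem continuousOn_duhamel {δ θ M : ℝ} {c a : ℂ} {F : ℝ → ℂ} (hδ : 0 ≤ δ) (hF : Measurable F)
    (hM : ∀ t ∈ Icc 0 δ, ‖F t‖ ≤ M) :
    ContinuousOn (fun t : ℝ => Complex.exp (-Complex.I * (t * θ : ℝ)) * a +
      c * ∫ r in (0 : ℝ)..t, Complex.exp (-Complex.I * ((t - r) * θ : ℝ)) * F r) (Icc 0 δ) := by
  have h0 : Complex.exp (-Complex.I * ((0 : ℝ) * θ : ℝ)) * a +
      c * ∫ r in (0 : ℝ)..0, Complex.exp (-Complex.I * ((0 - r) * θ : ℝ)) * F r = a := by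
    simp
  obtain ⟨⟨L, hL⟩, -⟩ := hasAEDeriv_of_duhamel (θ := θ) (c := c) (x := fun t : ℝ =>
    Complex.exp (-Complex.I * (t * θ : ℝ)) * a +
      c * ∫ r in (0 : ℝ)..t, Complex.exp (-Complex.I * ((t - r) * θ : ℝ)) * F r) hδ hF hM
      (fun t _ => by rw [h0])
  exact hL.continuousOn

end SBO
end

/-! ### The smoothed system and its trilinear form -/

noncomputable section

namespace SBO

/-- The smoothed solution `(Iu, Iv)` on the Fourier side: `Ψ` and `Φ` are the space-time transforms
of extensions, and the equations hold on `[0, δ]`. -/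
structure IsSmoothedSolution (α β ν b δ : ℝ) (m : ℝ → ℝ) (Ψ Φ : ℝ × ℝ → ℂ) : Prop where
  nonneg : 0 ≤ δ
  half_lt : 1 / 2 < b
  meas_left : Measurable Ψ
  meas_right : Measurable Φ
  norm_left : restrictionNorm (fun ξ => ξ ^ 2) 1 b Ψ ≠ ⊤
  norm_right : restrictionNorm (fun ξ => ν * ξ * |ξ|) (1 / 2) b Φ ≠ ⊤
  majorant_left : ∀ ξ, majorant Ψ ξ ≠ ⊤
  majorant_right : ∀ ξ, majorant Φ ξ ≠ ⊤
  real : ∀ ξ, ∀ t ∈ Icc 0 δ, evolution Φ (-ξ) t = (starRingEnd ℂ) (evolution Φ ξ t)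
  deriv_left : ∀ᵐ ξ, HasAEDeriv δ (evolution Ψ ξ) (fun t =>
    -Complex.I * (ξ ^ 2 : ℝ) * evolution Ψ ξ t +
      (-Complex.I * α) * (m ξ * prodTransform m Ψ Φ ξ t))
  deriv_right : ∀ᵐ ξ, HasAEDeriv δ (evolution Φ ξ) (fun t =>
    -Complex.I * (ν * ξ * |ξ| : ℝ) * evolution Φ ξ t +
      β * (m ξ * (Complex.I * ξ * absSqTransform m Ψ ξ t)))

theorem measurable_dispersion (ν : ℝ) : Measurable fun ξ : ℝ => ν * ξ * |ξ| := by fun_prop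

namespace IsSmoothedSolution

variable {α β ν b δ : ℝ} {m : ℝ → ℝ} {Ψ Φ : ℝ × ℝ → ℂ}

theorem weightedNorm_left (h : IsSmoothedSolution α β ν b δ m Ψ Φ) :
    weightedNorm 1 (majorant Ψ) ≠ ⊤ :=
  ne_top_of_le_ne_top (ENNReal.mul_ne_top (ENNReal.rpow_ne_top_of_nonneg (by norm_num)
    (tailConst_lt_top h.half_lt).ne) h.norm_left)
    (weightedNorm_majorant_le (by fun_prop) 1 b h.meas_left)

theorem weightedNorm_right (h : IsSmoothedSolution α β ν b δ m Ψ Φ) :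
    weightedNorm (1 / 2) (majorant Φ) ≠ ⊤ :=
  ne_top_of_le_ne_top (ENNReal.mul_ne_top (ENNReal.rpow_ne_top_of_nonneg (by norm_num)
    (tailConst_lt_top h.half_lt).ne) h.norm_right)
    (weightedNorm_majorant_le (measurable_dispersion ν) (1 / 2) b h.meas_right)

theorem lintegral_majorant_left (h : IsSmoothedSolution α β ν b δ m Ψ Φ) :
    ∫⁻ ξ, majorant Ψ ξ ≠ ⊤ :=
  ne_top_of_le_ne_top (ENNReal.mul_ne_top (ENNReal.rpow_ne_top_of_nonneg (by norm_num)
    (tailConst_lt_top (by norm_num)).ne) h.weightedNorm_left)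
    (lintegral_le_weightedNorm (measurable_majorant h.meas_left))

end IsSmoothedSolution

/-! ### The normalised trilinear form -/

section Tri

variable {ν N C b δ : ℝ} {m : ℝ → ℝ} {Ψ Φ : ℝ × ℝ → ℂ}

/-- The imaginary part of the trilinear integral, without the smoothing. -/
def tri (m : ℝ → ℝ) (Ψ Φ : ℝ × ℝ → ℂ) (δ x y : ℝ) : ℝ :=
  (triple Ψ Φ (Ioc 0 δ) x y).im / triSymbol m x y

theorem measurable_triple (hΨ : Measurable Ψ) (hΦ : Measurable Φ) (S : Set ℝ) :
    Measurable fun p : ℝ × ℝ => triple Ψ Φ S p.1 p.2 := by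
  have h1 : Measurable fun q : (ℝ × ℝ) × ℝ => evolution Ψ q.1.1 q.2 :=
    measurable_evolution_comp hΨ (by fun_prop) (by fun_prop)
  have h2 : Measurable fun q : (ℝ × ℝ) × ℝ => evolution Φ q.1.2 q.2 :=
    measurable_evolution_comp hΦ (by fun_prop) (by fun_prop)
  have h3 : Measurable fun q : (ℝ × ℝ) × ℝ => evolution Ψ (q.1.1 + q.1.2) q.2 :=
    measurable_evolution_comp hΨ (by fun_prop) (by fun_prop)
  have hconj : Measurable (starRingEnd ℂ : ℂ → ℂ) := Complex.continuous_conj.measurable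
  have h4 : Measurable fun q : (ℝ × ℝ) × ℝ => evolution Ψ q.1.1 q.2 * evolution Φ q.1.2 q.2 *
      (starRingEnd ℂ) (evolution Ψ (q.1.1 + q.1.2) q.2) := by fun_prop
  exact h4.stronglyMeasurable.integral_prod_right'.measurable

theorem measurable_triSymbol (hm : Measurable m) :
    Measurable fun p : ℝ × ℝ => triSymbol m p.1 p.2 := by
  unfold triSymbol; fun_prop

theorem measurable_tri (hm : Measurable m) (hΨ : Measurable Ψ) (hΦ : Measurable Φ) :
    Measurable fun p : ℝ × ℝ => tri m Ψ Φ δ p.1 p.2 :=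
  (Complex.measurable_im.comp (measurable_triple hΨ hΦ _)).div (measurable_triSymbol hm)

theorem enorm_triple_le (S : Set ℝ) (x y : ℝ) : ‖triple Ψ Φ S x y‖ₑ ≤
    volume S * (majorant Ψ x * majorant Φ y * majorant Ψ (x + y)) := by
  refine (enorm_integral_le_lintegral_enorm _).trans ?_
  calc _ ≤ ∫⁻ _ in S, majorant Ψ x * majorant Φ y * majorant Ψ (x + y) := by
        refine lintegral_mono fun t => ?_
        rw [enorm_mul, enorm_mul, RCLike.enorm_conj]
        gcongr <;> exact enorm_evolution_le _ _ _
    _ = _ := by rw [setLIntegral_const, mul_comm]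

theorem enorm_im_le (z : ℂ) : ‖z.im‖ₑ ≤ ‖z‖ₑ := by
  rw [← ofReal_norm, ← ofReal_norm]
  exact ENNReal.ofReal_le_ofReal (Complex.abs_im_le_norm z)

theorem SymbolBounds.enorm_tri_le (hm : SymbolBounds ν N C m) (x y : ℝ) :
    ‖tri m Ψ Φ δ x y‖ₑ ≤ ENNReal.ofReal (triSymbol m x y)⁻¹ * ‖triple Ψ Φ (Ioc 0 δ) x y‖ₑ := by
  have := hm.triSymbol_pos x y
  rw [tri, div_eq_mul_inv, enorm_mul, mul_comm, Real.enorm_of_nonneg (by positivity)]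
  gcongr
  exact enorm_im_le _

/-- The right-hand side of the trilinear estimate. -/
def triBound (ν b : ℝ) (Ψ Φ : ℝ × ℝ → ℂ) : ℝ≥0∞ :=
  tailConst b * ENNReal.ofReal (2 * Real.pi) ^ (1 / 2 : ℝ) *
    (restrictionNorm (fun ξ => ξ ^ 2) 1 b Ψ ^ 2 *
      restrictionNorm (fun ξ => ν * ξ * |ξ|) (1 / 2) b Φ)

variable {α β : ℝ}

theorem IsSmoothedSolution.triBound_ne_top (h : IsSmoothedSolution α β ν b δ m Ψ Φ) :
    triBound ν b Ψ Φ ≠ ⊤ :=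
  ENNReal.mul_ne_top (ENNReal.mul_ne_top (tailConst_lt_top h.half_lt).ne
    (ENNReal.rpow_ne_top_of_nonneg (by norm_num) ENNReal.ofReal_ne_top))
    (ENNReal.mul_ne_top (ENNReal.pow_ne_top h.norm_left) h.norm_right)

/-- The factor `triSymbol` in the bound for the kernel cancels the division in `tri`, which leaves
the trilinear estimate. -/
theorem IsSmoothedSolution.lintegral_mul_tri_le (h : IsSmoothedSolution α β ν b δ m Ψ Φ)
    (hm : SymbolBounds ν N C m) {κ : ℝ → ℝ → ℝ} {c : ℝ} (hc : 0 ≤ c)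
    (hκ : ∀ x y, |κ x y| ≤ c * (triWeight x y * triSymbol m x y)) :
    ∫⁻ p : ℝ × ℝ, ‖κ p.1 p.2 * tri m Ψ Φ δ p.1 p.2‖ₑ ≤ ENNReal.ofReal c * triBound ν b Ψ Φ := by
  refine le_trans ?_ (mul_le_mul_right (lintegral_triple_le h.meas_left h.meas_right
    (measurable_dispersion ν) (by linarith [h.half_lt]) (measurableSet_Ioc (a := 0) (b := δ))
    (by simp) (Filter.Eventually.of_forall h.majorant_right)) _)
  rw [← lintegral_const_mul' _ _ ENNReal.ofReal_ne_top]
  refine lintegral_mono fun p => ?_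
  have ht := hm.triSymbol_pos p.1 p.2
  have hw := triWeight_nonneg p.1 p.2
  simp only
  rw [enorm_mul]
  calc _ ≤ ENNReal.ofReal (c * (triWeight p.1 p.2 * triSymbol m p.1 p.2)) *
        (ENNReal.ofReal (triSymbol m p.1 p.2)⁻¹ * ‖triple Ψ Φ (Ioc 0 δ) p.1 p.2‖ₑ) := by
        refine mul_le_mul' ?_ (hm.enorm_tri_le _ _)
        rw [← ofReal_norm]
        exact ENNReal.ofReal_le_ofReal (hκ _ _)
    _ = _ := by
        rw [← mul_assoc (ENNReal.ofReal (c * _)), ← ENNReal.ofReal_mul (by positivity),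
          ← mul_assoc (ENNReal.ofReal c), ← ENNReal.ofReal_mul hc]
        congr 2
        field_simp

theorem IsSmoothedSolution.integrable_mul_tri (h : IsSmoothedSolution α β ν b δ m Ψ Φ)
    (hm : SymbolBounds ν N C m) {κ : ℝ → ℝ → ℝ} (hκm : Measurable fun p : ℝ × ℝ => κ p.1 p.2)
    {c : ℝ} (hc : 0 ≤ c) (hκ : ∀ x y, |κ x y| ≤ c * (triWeight x y * triSymbol m x y)) :
    Integrable fun p : ℝ × ℝ => κ p.1 p.2 * tri m Ψ Φ δ p.1 p.2 :=
  ⟨(hκm.mul (measurable_tri hm.cont.measurable h.meas_left h.meas_right)).aestronglyMeasurable,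
    lt_of_le_of_lt (h.lintegral_mul_tri_le hm hc hκ)
      (lt_top_iff_ne_top.mpr (ENNReal.mul_ne_top ENNReal.ofReal_ne_top h.triBound_ne_top))⟩

theorem IsSmoothedSolution.abs_integral_mul_tri_le (h : IsSmoothedSolution α β ν b δ m Ψ Φ)
    (hm : SymbolBounds ν N C m) {κ : ℝ → ℝ → ℝ}
    {c : ℝ} (hc : 0 ≤ c) (hκ : ∀ x y, |κ x y| ≤ c * (triWeight x y * triSymbol m x y)) :
    |∫ p : ℝ × ℝ, κ p.1 p.2 * tri m Ψ Φ δ p.1 p.2| ≤ c * (triBound ν b Ψ Φ).toReal := by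
  rw [← Real.norm_eq_abs, ← toReal_enorm, ← ENNReal.toReal_ofReal hc, ← ENNReal.toReal_mul]
  exact ENNReal.toReal_mono (ENNReal.mul_ne_top ENNReal.ofReal_ne_top h.triBound_ne_top)
    ((enorm_integral_le_lintegral_enorm _).trans (h.lintegral_mul_tri_le hm hc hκ))

/-- Exchanging the two Schrödinger frequencies conjugates the triple product, because the transform
of the real function Iv at -y is the conjugate of that at y. The imaginary part changes sign while
the symbol is unchanged. -/
theorem IsSmoothedSolution.tri_swap (h : IsSmoothedSolution α β ν b δ m Ψ Φ)
    (hm : SymbolBounds ν N C m) (x y : ℝ) :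
    tri m Ψ Φ δ (x + y) (-y) = -tri m Ψ Φ δ x y := by
  have h1 : triple Ψ Φ (Ioc 0 δ) (x + y) (-y) =
      (starRingEnd ℂ) (triple Ψ Φ (Ioc 0 δ) x y) := by
    rw [triple, triple, ← integral_conj]
    refine setIntegral_congr_fun measurableSet_Ioc fun t ht => ?_
    simp only [map_mul, Complex.conj_conj, add_neg_cancel_right]
    rw [h.real y t (Ioc_subset_Icc_self ht)]
    ring
  have h2 : triSymbol m (x + y) (-y) = triSymbol m x y := by
    simp only [triSymbol, add_neg_cancel_right, hm.even]; ring
  rw [tri, tri, h1, h2, Complex.conj_im, neg_div]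

theorem integral_comp_of_measurePreserving {X E : Type*} [MeasurableSpace X] {μ : Measure X}
    [NormedAddCommGroup E] [NormedSpace ℝ E] {T : X → X} (hT : MeasurePreserving T μ μ) {f : X → E}
    (hf : AEStronglyMeasurable f μ) : ∫ x, f (T x) ∂μ = ∫ x, f x ∂μ := by
  rw [← integral_map hT.measurable.aemeasurable (by rwa [hT.map_eq]), hT.map_eq]

/-- Symmetrisation of the trilinear form. -/
theorem IsSmoothedSolution.integral_symmetrize (h : IsSmoothedSolution α β ν b δ m Ψ Φ)
    (hm : SymbolBounds ν N C m) {g : ℝ → ℝ}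
    (hi : Integrable fun p : ℝ × ℝ => g (p.1 + p.2) * tri m Ψ Φ δ p.1 p.2) :
    2 * ∫ p : ℝ × ℝ, g (p.1 + p.2) * tri m Ψ Φ δ p.1 p.2 =
      ∫ p : ℝ × ℝ, (g (p.1 + p.2) - g p.1) * tri m Ψ Φ δ p.1 p.2 := by
  -- This involution preserves area and exchanges the frequencies x and x + y.
  have hT : MeasurePreserving (fun p : ℝ × ℝ => (p.1 + p.2, -p.2)) volume volume := by
    convert! (measurePreserving_add_prod_neg_right (volume : Measure ℝ) (volume : Measure ℝ)).comp
      Measure.measurePreserving_swap using 1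
    ext1 p
    simp [add_comm]
  have e : ∀ p : ℝ × ℝ, g ((p.1 + p.2) + -p.2) * tri m Ψ Φ δ (p.1 + p.2) (-p.2) =
      -(g p.1 * tri m Ψ Φ δ p.1 p.2) := fun p => by
    rw [h.tri_swap hm, add_neg_cancel_right]; ring
  have hi2 : Integrable fun p : ℝ × ℝ => g p.1 * tri m Ψ Φ δ p.1 p.2 := by
    have := (hT.integrable_comp_of_integrable hi).neg
    refine this.congr (Filter.Eventually.of_forall fun p => ?_)
    simp only [Function.comp_apply, Pi.neg_apply]
    rw [e, neg_neg]
  have h1 := integral_comp_of_measurePreserving hT hi.aestronglyMeasurable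
  simp only [e] at h1
  rw [integral_neg] at h1
  simp only [sub_mul]
  rw [integral_sub hi hi2]
  linarith

end Tri

/-! ### Increments of the quadratic quantities -/

section Quadratic

variable {α β ν N C b δ : ℝ} {m : ℝ → ℝ} {Ψ Φ : ℝ × ℝ → ℂ}

theorem integrable_prod_of_majorant {X : Type*} [MeasurableSpace X] {μ : Measure X} [SFinite μ]
    {S : Set ℝ} (hS : volume S ≠ ⊤) {f : X × ℝ → ℂ} (hf : Measurable f) {M : X → ℝ≥0∞}
    (hM : ∫⁻ x, M x ∂μ ≠ ⊤) (h : ∀ x t, ‖f (x, t)‖ₑ ≤ M x) :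
    Integrable f (μ.prod (volume.restrict S)) := by
  refine ⟨hf.aestronglyMeasurable, ?_⟩
  rw [HasFiniteIntegral, lintegral_prod _ hf.enorm.aemeasurable]
  calc _ ≤ ∫⁻ x, M x * volume S ∂μ := lintegral_mono fun x =>
        (lintegral_mono fun t => h x t).trans_eq (setLIntegral_const _ _)
    _ = (∫⁻ x, M x ∂μ) * volume S := lintegral_mul_const' _ _ hS
    _ < ⊤ := lt_top_iff_ne_top.mpr (ENNReal.mul_ne_top hM hS)

/-- The linear part only rotates the phase and drops out of the real part; the forcing alone changes
the modulus. -/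
theorem HasAEDeriv.norm_sq_sub {x f : ℝ → ℂ} {θ : ℝ} {F : ℝ → ℂ} (hδ : 0 ≤ δ)
    (hx : HasAEDeriv δ x f) (hf : ∀ t, f t = -Complex.I * θ * x t + F t)
    (hi : IntegrableOn (fun t => F t * (starRingEnd ℂ) (x t)) (Ioc 0 δ)) :
    ‖x δ‖ ^ 2 - ‖x 0‖ ^ 2 = 2 * (∫ t in Ioc 0 δ, F t * (starRingEnd ℂ) (x t)).re := by
  have h1 := (hx.mul hx.conj).sub_eq hδ
  have h2 : ∀ t, f t * (starRingEnd ℂ) (x t) + x t * (starRingEnd ℂ) (f t) =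
      ((2 * (F t * (starRingEnd ℂ) (x t)).re : ℝ) : ℂ) := by
    intro t
    rw [hf]
    apply Complex.ext <;> simp <;> ring
  simp only [h2, Complex.mul_conj, Complex.normSq_eq_norm_sq] at h1
  rw [integral_complex_ofReal] at h1
  have h3 : ‖x δ‖ ^ 2 - ‖x 0‖ ^ 2 = ∫ t in Ioc 0 δ, 2 * (F t * (starRingEnd ℂ) (x t)).re := by
    exact_mod_cast h1
  rw [h3, integral_const_mul]
  congr 1
  exact integral_re hi

/-- Fubini in (η, t), justified by the majorants uniform in time, turns the forcing into `triple`,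
and the factor -i turns the real part into an imaginary part. The quotient m(ξ)/(m(ξ - η) m(η)) is
m(ξ)² divided by the symbol in `tri`. -/
theorem IsSmoothedSolution.normSq_left_sub (h : IsSmoothedSolution α β ν b δ m Ψ Φ)
    (hm : SymbolBounds ν N C m) : ∀ᵐ ξ, ‖evolution Ψ ξ δ‖ ^ 2 - ‖evolution Ψ ξ 0‖ ^ 2 =
      2 * α * (√(2 * Real.pi))⁻¹ * ∫ η, m ξ ^ 2 * tri m Ψ Φ δ (ξ - η) η := by
  have hmm := hm.cont.measurable
  have hΨ := h.meas_left
  have hΦ := h.meas_right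
  have hconj : Measurable (starRingEnd ℂ : ℂ → ℂ) := Complex.continuous_conj.measurable
  filter_upwards [h.deriv_left] with ξ hξ
  have h1 : Measurable fun q : ℝ × ℝ => evolution Ψ (ξ - q.1) q.2 :=
    measurable_evolution_comp hΨ (by fun_prop) (by fun_prop)
  have h2 : Measurable fun q : ℝ × ℝ => evolution Φ q.1 q.2 :=
    measurable_evolution_comp hΦ (by fun_prop) (by fun_prop)
  have h3 : Measurable fun q : ℝ × ℝ => evolution Ψ ξ q.2 :=
    measurable_evolution_comp hΨ (by fun_prop) (by fun_prop)
  set G : ℝ × ℝ → ℂ := fun q => ((m (ξ - q.1) : ℂ)⁻¹ * evolution Ψ (ξ - q.1) q.2) *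
    ((m q.1 : ℂ)⁻¹ * evolution Φ q.1 q.2) * (starRingEnd ℂ) (evolution Ψ ξ q.2) with hG
  have hGm : Measurable G := by fun_prop
  have hGi : Integrable G (volume.prod (volume.restrict (Ioc 0 δ))) := by
    refine integrable_prod_of_majorant (by simp) hGm
      (M := fun η => ENNReal.ofReal ((m (ξ - η))⁻¹ * (m η)⁻¹) *
        (majorant Ψ (ξ - η) * majorant Φ η) * majorant Ψ ξ) ?_ fun η t => ?_
    · rw [lintegral_mul_const' _ _ (h.majorant_left ξ)]
      refine ENNReal.mul_ne_top (ne_top_of_mul_le ?_ (hm.mul_lintegral_prod_le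
        (measurable_majorant hΨ) (measurable_majorant hΦ) ξ) (ENNReal.mul_ne_top
          ENNReal.ofReal_ne_top (ENNReal.mul_ne_top h.weightedNorm_left h.weightedNorm_right)))
        (h.majorant_left ξ)
      have := hm.pos ξ
      have := bracket_pos ξ
      rw [Ne, ENNReal.ofReal_eq_zero, not_le]; positivity
    · have h1 := hm.pos (ξ - η)
      have h2 := hm.pos η
      simp only [hG]
      rw [enorm_mul, enorm_mul, enorm_mul, enorm_mul, RCLike.enorm_conj, ← Complex.ofReal_inv,
        ← Complex.ofReal_inv,
        enorm_ofReal_complex, enorm_ofReal_complex, abs_of_pos (by positivity),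
        abs_of_pos (by positivity), ENNReal.ofReal_mul (by positivity), mul_mul_mul_comm]
      gcongr <;> exact enorm_evolution_le _ _ _
  have hswap := integral_integral_swap (f := fun t η => G (η, t)) (μ := volume.restrict (Ioc 0 δ))
    (ν := volume) hGi.swap
  have hP : ∀ t, ((-Complex.I * α) * (m ξ * prodTransform m Ψ Φ ξ t)) *
      (starRingEnd ℂ) (evolution Ψ ξ t) =
      (-Complex.I * α * m ξ * (√(2 * Real.pi) : ℂ)⁻¹) * ∫ η, G (η, t) := by
    intro t
    simp only [hG, prodTransform]
    rw [integral_mul_const]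
    ring
  have hi : IntegrableOn (fun t => ((-Complex.I * α) * (m ξ * prodTransform m Ψ Φ ξ t)) *
      (starRingEnd ℂ) (evolution Ψ ξ t)) (Ioc 0 δ) := by
    simp only [hP]
    exact hGi.swap.integral_prod_left.const_mul _
  rw [hξ.norm_sq_sub h.nonneg (fun t => rfl) hi]
  simp only [hP]
  rw [integral_const_mul, hswap]
  have hT : ∀ η, ∫ t in Ioc 0 δ, G (η, t) =
      ((m (ξ - η))⁻¹ * (m η)⁻¹ : ℝ) * triple Ψ Φ (Ioc 0 δ) (ξ - η) η := by
    intro η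
    rw [triple, ← integral_const_mul]
    congr 1
    ext t
    simp only [hG, sub_add_cancel]
    push_cast
    ring
  have hTi : Integrable fun η => ∫ t in Ioc 0 δ, G (η, t) := hGi.integral_prod_left
  have him : ∀ z : ℂ, ((-Complex.I * α * m ξ * (√(2 * Real.pi) : ℂ)⁻¹) * z).re =
      α * (√(2 * Real.pi))⁻¹ * (m ξ * z.im) := by
    intro z
    generalize √(2 * Real.pi) = r
    rw [← Complex.ofReal_inv]
    simp
    ring
  rw [him, ← RCLike.im_to_complex, ← integral_im hTi]
  rw [mul_assoc 2 α, mul_assoc 2 (α * _)]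
  congr 2
  rw [← integral_const_mul]
  congr 1
  ext η
  have h4 := (hm.pos ξ).ne'
  have h5 := (hm.pos η).ne'
  have h6 := (hm.pos (ξ - η)).ne'
  rw [hT, RCLike.im_to_complex, Complex.im_ofReal_mul, tri, triSymbol, sub_add_cancel]
  field_simp

/-- The same computation for the second equation. With x = -η, the product of Iu at ξ - η, its
conjugate at -η and the conjugate of Iv at ξ is the conjugate of the triple product at (x, ξ), so
both equations feed the same form `tri`. -/
theorem IsSmoothedSolution.normSq_right_sub (h : IsSmoothedSolution α β ν b δ m Ψ Φ)
    (hm : SymbolBounds ν N C m) : ∀ᵐ y, ‖evolution Φ y δ‖ ^ 2 - ‖evolution Φ y 0‖ ^ 2 =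
      2 * β * (√(2 * Real.pi))⁻¹ * ∫ x, y * m y ^ 2 * tri m Ψ Φ δ x y := by
  have hmm := hm.cont.measurable
  have hΨ := h.meas_left
  have hΦ := h.meas_right
  have hconj : Measurable (starRingEnd ℂ : ℂ → ℂ) := Complex.continuous_conj.measurable
  filter_upwards [h.deriv_right] with ξ hξ
  have h1 : Measurable fun q : ℝ × ℝ => evolution Ψ (ξ - q.1) q.2 :=
    measurable_evolution_comp hΨ (by fun_prop) (by fun_prop)
  have h2 : Measurable fun q : ℝ × ℝ => evolution Ψ (-q.1) q.2 :=
    measurable_evolution_comp hΨ (by fun_prop) (by fun_prop)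
  have h3 : Measurable fun q : ℝ × ℝ => evolution Φ ξ q.2 :=
    measurable_evolution_comp hΦ (by fun_prop) (by fun_prop)
  set G : ℝ × ℝ → ℂ := fun q => ((m (ξ - q.1) : ℂ)⁻¹ * evolution Ψ (ξ - q.1) q.2) *
    (starRingEnd ℂ) ((m (-q.1) : ℂ)⁻¹ * evolution Ψ (-q.1) q.2) *
    (starRingEnd ℂ) (evolution Φ ξ q.2) with hG
  have hGm : Measurable G := by fun_prop
  have hMm := measurable_majorant hΨ
  have hGi : Integrable G (volume.prod (volume.restrict (Ioc 0 δ))) := by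
    refine integrable_prod_of_majorant (by simp) hGm
      (M := fun η => ENNReal.ofReal ((m (ξ - η))⁻¹ * (m η)⁻¹) *
        (majorant Ψ (ξ - η) * majorant Ψ (-η)) * majorant Φ ξ) ?_ fun η t => ?_
    · rw [lintegral_mul_const' _ _ (h.majorant_right ξ)]
      refine ENNReal.mul_ne_top (ne_top_of_le_ne_top ?_ (hm.lintegral_absSq_le hMm
        (g := fun η => majorant Ψ (-η)) (by fun_prop) ξ)) (h.majorant_right ξ)
      rw [weightedNorm_comp_neg]
      exact ENNReal.mul_ne_top
          ENNReal.ofReal_ne_top (ENNReal.mul_ne_top h.weightedNorm_left h.weightedNorm_left)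
    · have h1 := hm.pos (ξ - η)
      have h2 := hm.pos η
      simp only [hG]
      rw [enorm_mul, enorm_mul, enorm_mul, RCLike.enorm_conj, RCLike.enorm_conj, enorm_mul, hm.even,
        ← Complex.ofReal_inv, ← Complex.ofReal_inv,
        enorm_ofReal_complex, enorm_ofReal_complex, abs_of_pos (by positivity),
        abs_of_pos (by positivity), ENNReal.ofReal_mul (by positivity), mul_mul_mul_comm]
      gcongr <;> exact enorm_evolution_le _ _ _
  have hswap := integral_integral_swap (f := fun t η => G (η, t)) (μ := volume.restrict (Ioc 0 δ))
    (ν := volume) hGi.swap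
  have hP : ∀ t, (β * (m ξ * (Complex.I * ξ * absSqTransform m Ψ ξ t))) *
      (starRingEnd ℂ) (evolution Φ ξ t) =
      (β * m ξ * Complex.I * ξ * (√(2 * Real.pi) : ℂ)⁻¹) * ∫ η, G (η, t) := by
    intro t
    simp only [hG, absSqTransform]
    rw [integral_mul_const]
    ring
  have hi : IntegrableOn (fun t => (β * (m ξ * (Complex.I * ξ * absSqTransform m Ψ ξ t))) *
      (starRingEnd ℂ) (evolution Φ ξ t)) (Ioc 0 δ) := by
    simp only [hP]
    exact hGi.swap.integral_prod_left.const_mul _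
  rw [hξ.norm_sq_sub h.nonneg (fun t => rfl) hi]
  simp only [hP]
  rw [integral_const_mul, hswap]
  have hT : ∀ η, ∫ t in Ioc 0 δ, G (η, t) =
      ((m (ξ - η))⁻¹ * (m η)⁻¹ : ℝ) * (starRingEnd ℂ) (triple Ψ Φ (Ioc 0 δ) (-η) ξ) := by
    intro η
    rw [triple, ← integral_conj, ← integral_const_mul]
    congr 1
    ext t
    have e : -η + ξ = ξ - η := by ring
    simp only [hG, map_mul, Complex.conj_conj, e, hm.even, map_inv₀, Complex.conj_ofReal]
    push_cast
    ring
  have hTi : Integrable fun η => ∫ t in Ioc 0 δ, G (η, t) := hGi.integral_prod_left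
  have him : ∀ z : ℂ, ((β * m ξ * Complex.I * ξ * (√(2 * Real.pi) : ℂ)⁻¹) * z).re =
      β * (√(2 * Real.pi))⁻¹ * (-(ξ * m ξ) * z.im) := by
    intro z
    generalize √(2 * Real.pi) = r
    rw [← Complex.ofReal_inv]
    simp
    ring
  rw [him, ← RCLike.im_to_complex, ← integral_im hTi]
  rw [mul_assoc 2 β, mul_assoc 2 (β * _)]
  congr 2
  rw [← integral_const_mul, ← integral_neg_eq_self]
  congr 1
  ext η
  have h4 := (hm.pos ξ).ne'
  have h5 := (hm.pos η).ne'
  have h6 := (hm.pos (η + ξ)).ne'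
  have e : ξ - -η = η + ξ := by ring
  rw [hT, RCLike.im_to_complex, Complex.im_ofReal_mul, tri, triSymbol, neg_neg, e, hm.even,
    Complex.conj_im]
  field_simp

end Quadratic

end SBO
end

/-! ### Increments of weighted quadratic integrals -/

noncomputable section

namespace SBO

section Integrated

variable {α β ν N C b δ : ℝ} {m : ℝ → ℝ} {Ψ Φ : ℝ × ℝ → ℂ}

theorem integrable_bracket_rpow_mul_normSq {σ : ℝ} {Ψ : ℝ × ℝ → ℂ} (hΨ : Measurable Ψ)
    (h : weightedNorm σ (majorant Ψ) ≠ ⊤) (t : ℝ) :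
    Integrable fun ξ => (bracket ξ ^ σ) ^ 2 * ‖evolution Ψ ξ t‖ ^ 2 := by
  have h1 : Measurable fun ξ => evolution Ψ ξ t :=
    measurable_evolution_comp hΨ (by fun_prop) (by fun_prop)
  have h2 := measurable_bracket
  refine ⟨Measurable.aestronglyMeasurable (by fun_prop), ?_⟩
  have h3 : ∫⁻ ξ, (weight σ ξ * majorant Ψ ξ) ^ 2 ≠ ⊤ := by
    intro h4
    rw [weightedNorm, h4, ENNReal.top_rpow_of_pos (by norm_num)] at h
    exact h rfl
  refine lt_of_le_of_lt (lintegral_mono fun ξ => ?_) (lt_top_iff_ne_top.mpr h3)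
  have := bracket_pos ξ
  simp only
  rw [← mul_pow, Real.enorm_of_nonneg (by positivity), ENNReal.ofReal_pow (by positivity),
    ENNReal.ofReal_mul (by positivity), ofReal_norm]
  change (weight σ ξ * _) ^ 2 ≤ _
  gcongr
  exact enorm_evolution_le _ _ _

theorem IsSmoothedSolution.integrable_left (h : IsSmoothedSolution α β ν b δ m Ψ Φ) (t : ℝ) :
    Integrable fun ξ => bracket ξ ^ 2 * ‖evolution Ψ ξ t‖ ^ 2 := by
  simpa only [Real.rpow_one] using
    integrable_bracket_rpow_mul_normSq h.meas_left h.weightedNorm_left t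

theorem IsSmoothedSolution.integrable_right (h : IsSmoothedSolution α β ν b δ m Ψ Φ) (t : ℝ) :
    Integrable fun ξ => bracket ξ * ‖evolution Φ ξ t‖ ^ 2 := by
  simpa only [← sqrt_bracket, Real.sq_sqrt (bracket_pos _).le] using
    integrable_bracket_rpow_mul_normSq h.meas_right h.weightedNorm_right t

theorem integrable_mul_of_abs_le {k w : ℝ → ℝ} {f : ℝ → ℝ}
    (hi : Integrable fun ξ => w ξ * f ξ) (hk : Measurable k) (hf : AEStronglyMeasurable f)
    (h0 : ∀ ξ, 0 ≤ f ξ) (h : ∀ ξ, |k ξ| ≤ w ξ) : Integrable fun ξ => k ξ * f ξ := by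
  refine hi.mono' (hk.aestronglyMeasurable.mul hf) (Filter.Eventually.of_forall fun ξ => ?_)
  rw [norm_mul, Real.norm_eq_abs, Real.norm_of_nonneg (h0 ξ)]
  exact mul_le_mul_of_nonneg_right (h ξ) (h0 ξ)

theorem IsSmoothedSolution.aestronglyMeasurable_normSq_left
    (h : IsSmoothedSolution α β ν b δ m Ψ Φ) (t : ℝ) :
    AEStronglyMeasurable fun ξ => ‖evolution Ψ ξ t‖ ^ 2 := by
  have h1 : Measurable fun ξ => evolution Ψ ξ t :=
    measurable_evolution_comp h.meas_left (by fun_prop) (by fun_prop)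
  exact Measurable.aestronglyMeasurable (by fun_prop)

theorem IsSmoothedSolution.aestronglyMeasurable_normSq_right
    (h : IsSmoothedSolution α β ν b δ m Ψ Φ) (t : ℝ) :
    AEStronglyMeasurable fun ξ => ‖evolution Φ ξ t‖ ^ 2 := by
  have h1 : Measurable fun ξ => evolution Φ ξ t :=
    measurable_evolution_comp h.meas_right (by fun_prop) (by fun_prop)
  exact Measurable.aestronglyMeasurable (by fun_prop)

theorem IsSmoothedSolution.integrable_mul_left (h : IsSmoothedSolution α β ν b δ m Ψ Φ)
    {G : ℝ → ℝ} (hG : Measurable G) (hGb : ∀ ξ, |G ξ| ≤ bracket ξ ^ 2) (t : ℝ) :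
    Integrable fun ξ => G ξ * ‖evolution Ψ ξ t‖ ^ 2 :=
  integrable_mul_of_abs_le (h.integrable_left t) hG (h.aestronglyMeasurable_normSq_left t)
    (fun _ => by positivity) hGb

theorem IsSmoothedSolution.integrable_mul_right (h : IsSmoothedSolution α β ν b δ m Ψ Φ)
    {G : ℝ → ℝ} (hG : Measurable G) (hGb : ∀ ξ, |G ξ| ≤ bracket ξ) (t : ℝ) :
    Integrable fun ξ => G ξ * ‖evolution Φ ξ t‖ ^ 2 :=
  integrable_mul_of_abs_le (h.integrable_right t) hG (h.aestronglyMeasurable_normSq_right t)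
    (fun _ => by positivity) hGb

/-- The derivative in the second equation supplies the factor y required by `triWeight`, so the
double integral converges absolutely without symmetrisation or truncation. -/
theorem IsSmoothedSolution.integral_normSq_right_sub (h : IsSmoothedSolution α β ν b δ m Ψ Φ)
    (hm : SymbolBounds ν N C m) {G : ℝ → ℝ} (hG : Measurable G)
    (hGb : ∀ ξ, |G ξ| ≤ bracket ξ) :
    (∫ ξ, G ξ * ‖evolution Φ ξ δ‖ ^ 2) - ∫ ξ, G ξ * ‖evolution Φ ξ 0‖ ^ 2 =
      2 * β * (√(2 * Real.pi))⁻¹ *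
        ∫ p : ℝ × ℝ, (G p.2 * p.2 * m p.2 ^ 2) * tri m Ψ Φ δ p.1 p.2 := by
  have hmm := hm.cont.measurable
  rw [← integral_sub (h.integrable_mul_right hG hGb δ) (h.integrable_mul_right hG hGb 0)]
  have hi := h.integrable_mul_tri hm (κ := fun _ y => G y * y * m y ^ 2) (by fun_prop)
    hm.const_pos.le (fun x y => by
      have h1 := hm.bracket_mul_sq_le x y
      have h2 := hm.pos y
      rw [abs_mul, abs_mul, abs_of_nonneg (a := m y ^ 2) (by positivity)]
      calc _ ≤ bracket y * |y| * m y ^ 2 := by gcongr; exact hGb y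
        _ = |y| * (bracket y * m y ^ 2) := by ring
        _ ≤ |y| * (C * (bracket x * bracket (x + y) * triSymbol m x y)) := by gcongr
        _ = _ := by rw [triWeight]; ring)
  rw [Measure.volume_eq_prod] at hi ⊢
  rw [integral_prod_symm _ hi, ← integral_const_mul]
  refine integral_congr_ae ?_
  filter_upwards [h.normSq_right_sub hm] with y hy
  rw [← mul_sub, hy]
  have e : G y * ∫ x, y * m y ^ 2 * tri m Ψ Φ δ x y =
      ∫ x, G y * y * m y ^ 2 * tri m Ψ Φ δ x y := by
    rw [← integral_const_mul]
    congr 1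
    ext x
    ring
  rw [← e]
  generalize ∫ x, y * m y ^ 2 * tri m Ψ Φ δ x y = z
  ring

/-- There is no factor y here, so the trilinear estimate does not apply. The crude majorant bound,
which costs the length of the time interval, is enough because only finiteness matters. -/
theorem IsSmoothedSolution.integrable_bounded_mul_tri (h : IsSmoothedSolution α β ν b δ m Ψ Φ)
    (hm : SymbolBounds ν N C m) {G : ℝ → ℝ} (hG : Measurable G) {B : ℝ} (hB : ∀ ξ, |G ξ| ≤ B) :
    Integrable fun p : ℝ × ℝ => (G (p.1 + p.2) * m (p.1 + p.2) ^ 2) * tri m Ψ Φ δ p.1 p.2 := by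
  have hmm := hm.cont.measurable
  have hB0 : 0 ≤ B := (abs_nonneg _).trans (hB 0)
  have hMΨ := measurable_majorant h.meas_left
  have hMΦ := measurable_majorant h.meas_right
  have hw := measurable_bracket
  have ht := measurable_tri (δ := δ) hmm h.meas_left h.meas_right
  refine ⟨Measurable.aestronglyMeasurable (by fun_prop), ?_⟩
  let X : ℝ → ℝ → ℝ≥0∞ := fun x y =>
    ENNReal.ofReal B * volume (Ioc 0 δ) * majorant Ψ (x + y) *
      (ENNReal.ofReal (m (x + y) * √(bracket (x + y))) *
        (ENNReal.ofReal ((m x)⁻¹ * (m y)⁻¹) * (majorant Ψ x * majorant Φ y)))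
  have hXm : Measurable fun p : ℝ × ℝ => X p.1 p.2 := by fun_prop
  have hX : ∀ p : ℝ × ℝ,
      ‖(G (p.1 + p.2) * m (p.1 + p.2) ^ 2) * tri m Ψ Φ δ p.1 p.2‖ₑ ≤ X p.1 p.2 := by
    rintro ⟨x, y⟩
    have h1 := hm.pos (x + y)
    have h2 := hm.pos x
    have h3 := hm.pos y
    have h4 : 1 ≤ √(bracket (x + y)) := Real.one_le_sqrt.mpr (one_le_bracket _)
    have h5 : |G (x + y) * m (x + y) ^ 2| * (triSymbol m x y)⁻¹ ≤
        B * ((m (x + y) * √(bracket (x + y))) * ((m x)⁻¹ * (m y)⁻¹)) := by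
      have e : |G (x + y) * m (x + y) ^ 2| * (triSymbol m x y)⁻¹ =
          |G (x + y)| * ((m (x + y) * 1) * ((m x)⁻¹ * (m y)⁻¹)) := by
        rw [abs_mul, abs_of_nonneg (a := m (x + y) ^ 2) (by positivity), triSymbol]
        field_simp
      rw [e]
      gcongr
      exact hB _
    simp only
    rw [enorm_mul]
    calc _ ≤ ENNReal.ofReal |G (x + y) * m (x + y) ^ 2| *
          (ENNReal.ofReal (triSymbol m x y)⁻¹ *
            (volume (Ioc 0 δ) * (majorant Ψ x * majorant Φ y * majorant Ψ (x + y)))) := by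
          rw [← ofReal_norm, Real.norm_eq_abs]
          exact mul_le_mul_right ((hm.enorm_tri_le _ _).trans
            (mul_le_mul_right (enorm_triple_le _ _ _) _)) _
      _ = ENNReal.ofReal (|G (x + y) * m (x + y) ^ 2| * (triSymbol m x y)⁻¹) *
            (volume (Ioc 0 δ) * (majorant Ψ x * majorant Φ y * majorant Ψ (x + y))) := by
          rw [ENNReal.ofReal_mul (abs_nonneg _), ← mul_assoc (ENNReal.ofReal _)]
      _ ≤ ENNReal.ofReal (B * ((m (x + y) * √(bracket (x + y))) * ((m x)⁻¹ * (m y)⁻¹))) *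
            (volume (Ioc 0 δ) * (majorant Ψ x * majorant Φ y * majorant Ψ (x + y))) := by
          gcongr
      _ = X x y := by
          simp only [X]
          rw [ENNReal.ofReal_mul hB0, ENNReal.ofReal_mul (p := m (x + y) * √(bracket (x + y)))
            (by positivity)]
          ring
  refine lt_of_le_of_lt (lintegral_mono hX) ?_
  rw [Measure.volume_eq_prod, lintegral_prod _ hXm.aemeasurable, ← lintegral_conv_eq hXm]
  have hXi : ∀ ξ, ∫⁻ η, X (ξ - η) η ≤ ENNReal.ofReal B * volume (Ioc 0 δ) * majorant Ψ ξ *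
      (ENNReal.ofReal C * (weightedNorm 1 (majorant Ψ) * weightedNorm (1 / 2) (majorant Φ))) := by
    intro ξ
    simp only [X, sub_add_cancel]
    rw [lintegral_const_mul _ (by fun_prop), lintegral_const_mul _ (by fun_prop)]
    exact mul_le_mul_right (hm.mul_lintegral_prod_le hMΨ hMΦ ξ) _
  refine lt_of_le_of_lt (lintegral_mono hXi) ?_
  rw [lintegral_mul_const _ (by fun_prop), lintegral_const_mul _ hMΨ]
  exact lt_top_iff_ne_top.mpr (ENNReal.mul_ne_top (ENNReal.mul_ne_top
    (ENNReal.mul_ne_top ENNReal.ofReal_ne_top (by simp)) h.lintegral_majorant_left)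
    (ENNReal.mul_ne_top ENNReal.ofReal_ne_top
      (ENNReal.mul_ne_top h.weightedNorm_left h.weightedNorm_right)))

theorem IsSmoothedSolution.integral_normSq_left_sub_of_bounded
    (h : IsSmoothedSolution α β ν b δ m Ψ Φ)
    (hm : SymbolBounds ν N C m) {G : ℝ → ℝ} (hG : Measurable G) {B : ℝ} (hB : ∀ ξ, |G ξ| ≤ B) :
    ∫ ξ, G ξ * (‖evolution Ψ ξ δ‖ ^ 2 - ‖evolution Ψ ξ 0‖ ^ 2) =
      α * (√(2 * Real.pi))⁻¹ * ∫ p : ℝ × ℝ,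
        (G (p.1 + p.2) * m (p.1 + p.2) ^ 2 - G p.1 * m p.1 ^ 2) * tri m Ψ Φ δ p.1 p.2 := by
  have hi := h.integrable_bounded_mul_tri hm hG hB
  rw [← h.integral_symmetrize hm (g := fun ξ => G ξ * m ξ ^ 2) hi]
  have hT : MeasurePreserving (fun p : ℝ × ℝ => (p.1 - p.2, p.2)) volume volume :=
    measurePreserving_sub_prod volume volume
  have hi2 := hT.integrable_comp_of_integrable hi
  rw [← integral_comp_of_measurePreserving hT hi.aestronglyMeasurable, Measure.volume_eq_prod,
    integral_prod (fun p : ℝ × ℝ => G (p.1 - p.2 + p.2) * m (p.1 - p.2 + p.2) ^ 2 *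
      tri m Ψ Φ δ (p.1 - p.2) p.2) hi2, ← integral_const_mul, ← integral_const_mul]
  refine integral_congr_ae ?_
  filter_upwards [h.normSq_left_sub hm] with ξ hξ
  simp only [sub_add_cancel]
  rw [hξ]
  have e : G ξ * ∫ η, m ξ ^ 2 * tri m Ψ Φ δ (ξ - η) η =
      ∫ η, G ξ * m ξ ^ 2 * tri m Ψ Φ δ (ξ - η) η := by
    rw [← integral_const_mul]
    congr 1
    ext η
    ring
  rw [← e]
  generalize ∫ η, m ξ ^ 2 * tri m Ψ Φ δ (ξ - η) η = z
  ring

/-- A piecewise linear cutoff. -/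
def cutoff (x : ℝ) : ℝ := max 0 (min 1 (2 - x))

theorem cutoff_nonneg (x : ℝ) : 0 ≤ cutoff x := le_max_left _ _

theorem cutoff_le_one (x : ℝ) : cutoff x ≤ 1 := max_le zero_le_one (min_le_left _ _)

theorem cutoff_eq_one {x : ℝ} (h : x ≤ 1) : cutoff x = 1 := by
  rw [cutoff, min_eq_left (by linarith), max_eq_right zero_le_one]

theorem cutoff_eq_zero {x : ℝ} (h : 2 ≤ x) : cutoff x = 0 := by
  rw [cutoff, max_eq_left (min_le_of_right_le (by linarith))]

theorem abs_cutoff_sub_le (x y : ℝ) : |cutoff x - cutoff y| ≤ |x - y| := by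
  unfold cutoff
  have h1 := abs_max_sub_max_le_max 0 (min 1 (2 - x)) 0 (min 1 (2 - y))
  have h2 := abs_min_sub_min_le_max 1 (2 - x) 1 (2 - y)
  simp only [sub_self, abs_zero, sub_sub_sub_cancel_left] at h1 h2
  rw [max_eq_right (a := (0 : ℝ)) (b := |_|) (abs_nonneg _)] at h1 h2
  rw [abs_sub_comm x y]
  exact h1.trans h2

/-- Truncation preserves difference bounds uniformly in R: the cutoff has Lipschitz constant 1/R in
ω, and |g| ≤ 1 + 2R ≤ 3R wherever it has not vanished. -/
theorem abs_mul_cutoff_sub_le {R g₁ g₂ ω₁ ω₂ : ℝ} (hR : 1 ≤ R) (h₁ : |g₁| ≤ 1 + ω₁)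
    (h₂ : |g₂| ≤ 1 + ω₂) :
    |g₁ * cutoff (ω₁ / R) - g₂ * cutoff (ω₂ / R)| ≤ |g₁ - g₂| + 3 * |ω₁ - ω₂| := by
  have hR0 : 0 < R := by linarith
  have hc := abs_cutoff_sub_le (ω₁ / R) (ω₂ / R)
  rw [← sub_div, abs_div, abs_of_pos hR0] at hc
  have key : ∀ g ω, |g| ≤ 1 + ω → ω ≤ 2 * R →
      |g| * |cutoff (ω₁ / R) - cutoff (ω₂ / R)| ≤ 3 * |ω₁ - ω₂| := by
    intro g ω hg hω
    calc |g| * |cutoff (ω₁ / R) - cutoff (ω₂ / R)| ≤ (3 * R) * (|ω₁ - ω₂| / R) := by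
          gcongr; linarith
      _ = _ := by field_simp
  rcases le_total ω₂ (2 * R) with h | h
  · have e : g₁ * cutoff (ω₁ / R) - g₂ * cutoff (ω₂ / R) =
        (g₁ - g₂) * cutoff (ω₁ / R) + g₂ * (cutoff (ω₁ / R) - cutoff (ω₂ / R)) := by ring
    rw [e]
    refine (abs_add_le _ _).trans (add_le_add ?_ ?_)
    · rw [abs_mul, abs_of_nonneg (cutoff_nonneg _)]
      exact mul_le_of_le_one_right (abs_nonneg _) (cutoff_le_one _)
    · rw [abs_mul]
      exact key _ _ h₂ h
  · have h0 : cutoff (ω₂ / R) = 0 := cutoff_eq_zero (by rwa [le_div_iff₀ hR0])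
    rcases le_total ω₁ (2 * R) with h' | h'
    · have e : g₁ * cutoff (ω₁ / R) - g₂ * cutoff (ω₂ / R) =
        g₁ * (cutoff (ω₁ / R) - cutoff (ω₂ / R)) := by rw [h0]; ring
      rw [e, abs_mul]
      exact (key _ _ h₁ h').trans (by linarith [abs_nonneg (g₁ - g₂)])
    · have h0' : cutoff (ω₁ / R) = 0 := cutoff_eq_zero (by rwa [le_div_iff₀ hR0])
      rw [h0, h0']
      simp only [mul_zero, sub_zero, abs_zero]
      positivity

/-- For unbounded G the integrals of the weight at x + y and at x need not converge separately; only
their difference is controlled. Truncation reduces to bounded weights, and dominated convergence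
applies on both sides. -/
theorem IsSmoothedSolution.integral_normSq_left_sub (h : IsSmoothedSolution α β ν b δ m Ψ Φ)
    (hm : SymbolBounds ν N C m) {G : ℝ → ℝ} (hG : Measurable G)
    (hGb : ∀ ξ, |G ξ| ≤ bracket ξ ^ 2) {c : ℝ} (hc : 0 ≤ c)
    (hg : ∀ x y, |G (x + y) * m (x + y) ^ 2 - G x * m x ^ 2| ≤
      c * (triWeight x y * triSymbol m x y)) :
    (∫ ξ, G ξ * ‖evolution Ψ ξ δ‖ ^ 2) - ∫ ξ, G ξ * ‖evolution Ψ ξ 0‖ ^ 2 =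
      α * (√(2 * Real.pi))⁻¹ * ∫ p : ℝ × ℝ,
        (G (p.1 + p.2) * m (p.1 + p.2) ^ 2 - G p.1 * m p.1 ^ 2) * tri m Ψ Φ δ p.1 p.2 := by
  have hmm := hm.cont.measurable
  have hcut : Measurable cutoff := by unfold cutoff; fun_prop
  have ht := measurable_tri (δ := δ) hmm h.meas_left h.meas_right
  -- The truncation is by the size of ξ² m(ξ)², not of ξ, because the differences of this function
  -- are bounded by `triWeight` times `triSymbol`, as those of G m² are; the truncated differences
  -- thus have a bound independent of n.
  let Gn : ℕ → ℝ → ℝ := fun n ξ => G ξ * cutoff (ξ ^ 2 * m ξ ^ 2 / (n + 1))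
  have hGnm : ∀ n, Measurable (Gn n) := fun n => by fun_prop
  have hGnle : ∀ n ξ, |Gn n ξ| ≤ |G ξ| := fun n ξ => by
    simp only [Gn]
    rw [abs_mul, abs_of_nonneg (cutoff_nonneg _)]
    exact mul_le_of_le_one_right (abs_nonneg _) (cutoff_le_one _)
  have hGnlim : ∀ ξ, ∀ᶠ n in Filter.atTop, Gn n ξ = G ξ := fun ξ => by
    filter_upwards [Filter.eventually_ge_atTop ⌈ξ ^ 2 * m ξ ^ 2⌉₊] with n hn
    have h1 : ξ ^ 2 * m ξ ^ 2 ≤ n := (Nat.le_ceil _).trans (by exact_mod_cast hn)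
    simp only [Gn]
    rw [cutoff_eq_one, mul_one]
    rw [div_le_one (by positivity)]; linarith
  have hGnb : ∀ n, ∃ B, ∀ ξ, |Gn n ξ| ≤ B := fun n => by
    obtain ⟨M, hM⟩ := hm.bounded (2 * (n + 1))
    refine ⟨1 + M ^ 2, fun ξ => ?_⟩
    rcases le_total (ξ ^ 2 * m ξ ^ 2) (2 * (n + 1)) with h1 | h1
    · refine (hGnle n ξ).trans ((hGb ξ).trans ?_)
      rw [bracket_sq]
      have := hM ξ h1
      have : ξ ^ 2 ≤ M ^ 2 := sq_le_sq.mpr (this.trans (le_abs_self M))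
      linarith
    · simp only [Gn]
      rw [cutoff_eq_zero (by rwa [le_div_iff₀ (by positivity)]), mul_zero, abs_zero]
      positivity
  have hdom : ∀ n (x y : ℝ), |Gn n (x + y) * m (x + y) ^ 2 - Gn n x * m x ^ 2| ≤
      (c + 3 * C) * (triWeight x y * triSymbol m x y) := by
    intro n x y
    have hg1 : ∀ ξ, |G ξ * m ξ ^ 2| ≤ 1 + ξ ^ 2 * m ξ ^ 2 := fun ξ => by
      have h0 := hm.pos ξ
      have h1 : m ξ ^ 2 ≤ 1 := pow_le_one₀ h0.le (hm.le_one ξ)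
      rw [abs_mul, abs_of_nonneg (a := m ξ ^ 2) (by positivity)]
      calc _ ≤ bracket ξ ^ 2 * m ξ ^ 2 := by gcongr; exact hGb ξ
        _ = m ξ ^ 2 + ξ ^ 2 * m ξ ^ 2 := by rw [bracket_sq]; ring
        _ ≤ _ := by linarith
    have h1 := abs_mul_cutoff_sub_le (R := (n : ℝ) + 1) (by linarith [n.cast_nonneg (α := ℝ)])
      (hg1 (x + y)) (hg1 x)
    have h2 := hg x y
    have h3 := hm.sq_sub_sq_le x y
    have e : Gn n (x + y) * m (x + y) ^ 2 - Gn n x * m x ^ 2 =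
      G (x + y) * m (x + y) ^ 2 * cutoff ((x + y) ^ 2 * m (x + y) ^ 2 / (n + 1)) -
        G x * m x ^ 2 * cutoff (x ^ 2 * m x ^ 2 / (n + 1)) := by simp only [Gn]; ring
    rw [e]
    linarith
  rw [← integral_sub (h.integrable_mul_left hG hGb δ) (h.integrable_mul_left hG hGb 0)]
  have hlim1 : Filter.Tendsto
      (fun n => ∫ ξ, Gn n ξ * (‖evolution Ψ ξ δ‖ ^ 2 - ‖evolution Ψ ξ 0‖ ^ 2)) Filter.atTop
      (nhds (∫ ξ, (G ξ * ‖evolution Ψ ξ δ‖ ^ 2 - G ξ * ‖evolution Ψ ξ 0‖ ^ 2))) := by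
    refine tendsto_integral_of_dominated_convergence
      (fun ξ => |G ξ * ‖evolution Ψ ξ δ‖ ^ 2 - G ξ * ‖evolution Ψ ξ 0‖ ^ 2|) (fun n => ?_) ?_
      (fun n => Filter.Eventually.of_forall fun ξ => ?_) (Filter.Eventually.of_forall fun ξ => ?_)
    · exact (hGnm n).aestronglyMeasurable.mul ((h.aestronglyMeasurable_normSq_left δ).sub
        (h.aestronglyMeasurable_normSq_left 0))
    · exact ((h.integrable_mul_left hG hGb δ).sub (h.integrable_mul_left hG hGb 0)).abs
    · rw [← mul_sub, abs_mul, norm_mul, Real.norm_eq_abs, Real.norm_eq_abs]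
      exact mul_le_mul_of_nonneg_right (hGnle n ξ) (abs_nonneg _)
    · refine tendsto_const_nhds.congr' ?_
      filter_upwards [hGnlim ξ] with n hn
      rw [hn, mul_sub]
  have hlim2 : Filter.Tendsto (fun n => ∫ p : ℝ × ℝ,
        (Gn n (p.1 + p.2) * m (p.1 + p.2) ^ 2 - Gn n p.1 * m p.1 ^ 2) * tri m Ψ Φ δ p.1 p.2)
      Filter.atTop (nhds (∫ p : ℝ × ℝ,
        (G (p.1 + p.2) * m (p.1 + p.2) ^ 2 - G p.1 * m p.1 ^ 2) * tri m Ψ Φ δ p.1 p.2)) := by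
    have htw : Measurable fun p : ℝ × ℝ => triWeight p.1 p.2 := continuous_triWeight.measurable
    have hts := measurable_triSymbol hmm
    have hc' : 0 ≤ c + 3 * C := by linarith [hm.const_pos]
    have hi := h.integrable_mul_tri hm
      (κ := fun x y => (c + 3 * C) * (triWeight x y * triSymbol m x y)) (by fun_prop) hc'
      (fun x y => by
        have := hm.triSymbol_pos x y
        have := triWeight_nonneg x y
        rw [abs_of_nonneg (by positivity)])
    refine tendsto_integral_of_dominated_convergence _ (fun n => ?_) hi.norm
      (fun n => Filter.Eventually.of_forall fun p => ?_) (Filter.Eventually.of_forall fun p => ?_)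
    · have := hGnm n
      exact Measurable.aestronglyMeasurable (by fun_prop)
    · have h1 := hm.triSymbol_pos p.1 p.2
      have h2 := triWeight_nonneg p.1 p.2
      rw [norm_mul, norm_mul, Real.norm_eq_abs,
        Real.norm_of_nonneg (r := (c + 3 * C) * _) (by positivity)]
      gcongr
      exact hdom n _ _
    · refine tendsto_const_nhds.congr' ?_
      filter_upwards [hGnlim (p.1 + p.2), hGnlim p.1] with n h1 h2
      rw [h1, h2]
  refine tendsto_nhds_unique hlim1 ((hlim2.const_mul (α * (√(2 * Real.pi))⁻¹)).congr fun n => ?_)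
  obtain ⟨B, hB⟩ := hGnb n
  exact (h.integral_normSq_left_sub_of_bounded hm (hGnm n) hB).symm

end Integrated

end SBO
end

/-! ### The cubic part of the energy and the quartic commutator terms -/

noncomputable section

namespace SBO

section Cubic

variable {α β ν N C b δ : ℝ} {m : ℝ → ℝ} {Ψ Φ : ℝ × ℝ → ℂ}

/-- The integrand of the cubic part of the energy. -/
def cubicIntegrand (Ψ Φ : ℝ × ℝ → ℂ) (t : ℝ) (p : ℝ × ℝ) : ℂ :=
  evolution Ψ p.1 t * evolution Φ p.2 t * (starRingEnd ℂ) (evolution Ψ (p.1 + p.2) t)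

/-- The integral of `v |u|²` at time `t`, on the Fourier side. -/
def cubicForm (Ψ Φ : ℝ × ℝ → ℂ) (t : ℝ) : ℂ :=
  (√(2 * Real.pi) : ℂ)⁻¹ * ∫ p : ℝ × ℝ, cubicIntegrand Ψ Φ t p

/-- The resonance function. -/
def resonance (ν x y : ℝ) : ℝ := (x + y) ^ 2 - x ^ 2 - ν * y * |y|

theorem abs_resonance_le (hν : 0 ≤ ν) (x y : ℝ) :
    |resonance ν x y| ≤ (4 + 2 * ν) * triWeight x y := by
  have hx := abs_le_bracket x
  have hz := abs_le_bracket (x + y)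
  have hx1 := one_le_bracket x
  have hz1 := one_le_bracket (x + y)
  have hy0 := abs_nonneg y
  have hy : |y| ≤ 2 * (bracket x * bracket (x + y)) := by
    have : |y| ≤ |x + y| + |x| := by
      have := abs_sub (x + y) x
      rwa [add_sub_cancel_left] at this
    nlinarith
  have hx2 : |x| ≤ bracket x * bracket (x + y) := by nlinarith
  have e : resonance ν x y = 2 * (x * y) + y * y - ν * (y * |y|) := by unfold resonance; ring
  have h1 : |resonance ν x y| ≤ 2 * (|x| * |y|) + |y| * |y| + ν * (|y| * |y|) := by
    rw [e]
    refine (abs_sub _ _).trans (add_le_add ((abs_add_le _ _).trans (le_of_eq ?_)) (le_of_eq ?_))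
    · simp [abs_mul]
    · simp [abs_mul, abs_of_nonneg hν]
  refine h1.trans ?_
  unfold triWeight
  have h2 : |y| * |x| ≤ |y| * (bracket x * bracket (x + y)) := by gcongr
  have h3 : |y| * |y| ≤ |y| * (2 * (bracket x * bracket (x + y))) := by gcongr
  have h4 := mul_le_mul_of_nonneg_left h3 hν
  linarith

theorem IsSmoothedSolution.integrable_mul_triple (h : IsSmoothedSolution α β ν b δ m Ψ Φ)
    {κ : ℝ → ℝ → ℝ} (hκm : Measurable fun p : ℝ × ℝ => κ p.1 p.2)
    {c : ℝ} (hc : 0 ≤ c) (hκ : ∀ x y, |κ x y| ≤ c * triWeight x y) :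
    Integrable fun p : ℝ × ℝ => (κ p.1 p.2 : ℂ) * triple Ψ Φ (Ioc 0 δ) p.1 p.2 := by
  have h1 := measurable_triple h.meas_left h.meas_right (Ioc 0 δ)
  refine ⟨Measurable.aestronglyMeasurable (by fun_prop), ?_⟩
  have hT : ∫⁻ p : ℝ × ℝ, ENNReal.ofReal c *
      (ENNReal.ofReal (triWeight p.1 p.2) * ‖triple Ψ Φ (Ioc 0 δ) p.1 p.2‖ₑ) < ⊤ := by
    rw [lintegral_const_mul' _ _ ENNReal.ofReal_ne_top]
    exact lt_top_iff_ne_top.mpr (ENNReal.mul_ne_top ENNReal.ofReal_ne_top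
      (ne_top_of_le_ne_top h.triBound_ne_top (lintegral_triple_le h.meas_left h.meas_right
      (measurable_dispersion ν) (by linarith [h.half_lt]) measurableSet_Ioc
      (by simp) (Filter.Eventually.of_forall h.majorant_right))))
  refine lt_of_le_of_lt (lintegral_mono fun p => ?_) hT
  simp only
  rw [enorm_mul, enorm_ofReal_complex, ← mul_assoc, ← ENNReal.ofReal_mul hc]
  gcongr
  exact hκ _ _

theorem lintegral_shift_eq {f g : ℝ → ℝ≥0∞} (x : ℝ) :
    ∫⁻ y, g y * f (x + y) = ∫⁻ η, f (x - η) * g (-η) := by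
  rw [← lintegral_neg_eq_self]
  simp only [sub_eq_add_neg, mul_comm]

theorem integral_shift_eq {f g : ℝ → ℂ} (x : ℝ) :
    ∫ y, g y * f (x + y) = ∫ η, f (x - η) * g (-η) := by
  rw [← integral_neg_eq_self]
  simp only [sub_eq_add_neg, mul_comm]

theorem measurable_cubicIntegrand (hΨ : Measurable Ψ) (hΦ : Measurable Φ) :
    Measurable fun q : (ℝ × ℝ) × ℝ => cubicIntegrand Ψ Φ q.2 q.1 := by
  have h1 : Measurable fun q : (ℝ × ℝ) × ℝ => evolution Ψ q.1.1 q.2 :=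
    measurable_evolution_comp hΨ (by fun_prop) (by fun_prop)
  have h2 : Measurable fun q : (ℝ × ℝ) × ℝ => evolution Φ q.1.2 q.2 :=
    measurable_evolution_comp hΦ (by fun_prop) (by fun_prop)
  have h3 : Measurable fun q : (ℝ × ℝ) × ℝ => evolution Ψ (q.1.1 + q.1.2) q.2 :=
    measurable_evolution_comp hΨ (by fun_prop) (by fun_prop)
  have hconj : Measurable (starRingEnd ℂ : ℂ → ℂ) := Complex.continuous_conj.measurable
  unfold cubicIntegrand
  fun_prop

theorem enorm_cubicIntegrand_le (t : ℝ) (p : ℝ × ℝ) : ‖cubicIntegrand Ψ Φ t p‖ₑ ≤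
    majorant Ψ p.1 * majorant Φ p.2 * majorant Ψ (p.1 + p.2) := by
  rw [cubicIntegrand, enorm_mul, enorm_mul, RCLike.enorm_conj]
  gcongr <;> exact enorm_evolution_le _ _ _

namespace IsSmoothedSolution

theorem lintegral_cubic_majorant (h : IsSmoothedSolution α β ν b δ m Ψ Φ) :
    ∫⁻ p : ℝ × ℝ, majorant Ψ p.1 * majorant Φ p.2 * majorant Ψ (p.1 + p.2) ≠ ⊤ := by
  have h1 := measurable_majorant h.meas_left
  have h2 := measurable_majorant h.meas_right
  rw [Measure.volume_eq_prod, lintegral_prod _ (by fun_prop)]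
  simp only [mul_assoc]
  have e : ∀ x, ∫⁻ y, majorant Ψ x * (majorant Φ y * majorant Ψ (x + y)) ≤
      majorant Ψ x * (weightedNorm 1 (majorant Ψ) * weightedNorm (1 / 2) (majorant Φ)) := by
    intro x
    rw [lintegral_const_mul _ (by fun_prop), lintegral_shift_eq]
    refine mul_le_mul_right ((lintegral_conv_le_weightedNorm h1 (g := fun η => majorant Φ (-η))
      (by fun_prop) x).trans_eq ?_) _
    rw [weightedNorm_comp_neg]
  refine ne_top_of_le_ne_top ?_ (lintegral_mono e)
  rw [lintegral_mul_const _ h1]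
  exact ENNReal.mul_ne_top h.lintegral_majorant_left
    (ENNReal.mul_ne_top h.weightedNorm_left h.weightedNorm_right)

theorem integrable_of_majorant {X : Type*} [MeasurableSpace X] {μ : Measure X} {f : X → ℂ}
    (hf : Measurable f) {M : X → ℝ≥0∞} (hM : ∫⁻ x, M x ∂μ ≠ ⊤) (h : ∀ x, ‖f x‖ₑ ≤ M x) :
    Integrable f μ :=
  ⟨hf.aestronglyMeasurable, lt_of_le_of_lt (lintegral_mono h) (lt_top_iff_ne_top.mpr hM)⟩

theorem integrable_cubicIntegrand (h : IsSmoothedSolution α β ν b δ m Ψ Φ) (t : ℝ) :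
    Integrable (cubicIntegrand Ψ Φ t) :=
  integrable_of_majorant ((measurable_cubicIntegrand h.meas_left h.meas_right).comp
    (g := fun q : (ℝ × ℝ) × ℝ => cubicIntegrand Ψ Φ q.2 q.1) (f := fun p => (p, t))
    (by fun_prop)) h.lintegral_cubic_majorant (enorm_cubicIntegrand_le t)

end IsSmoothedSolution

/-- The bound for the forcing term of the first equation. -/
theorem SymbolBounds.enorm_mul_prodTransform_le
    (hm : SymbolBounds ν N C m) (hΨ : Measurable Ψ) (hΦ : Measurable Φ) (ξ t : ℝ) :
    ‖(m ξ : ℂ) * prodTransform m Ψ Φ ξ t‖ₑ ≤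
      ENNReal.ofReal C * (weightedNorm 1 (majorant Ψ) * weightedNorm (1 / 2) (majorant Φ)) *
        weight (-(1 / 2)) ξ := by
  have h1 := hm.mul_lintegral_prod_le (measurable_majorant hΨ) (measurable_majorant hΦ) ξ
  have h2 := (mul_le_mul_right (hm.enorm_prodTransform_le (Ψ := Ψ) (Φ := Φ) ξ t) _).trans h1
  rw [ENNReal.ofReal_mul (hm.pos ξ).le, ← weight_half] at h2
  calc _ = (weight (-(1 / 2)) ξ * weight (1 / 2) ξ) *
        ‖(m ξ : ℂ) * prodTransform m Ψ Φ ξ t‖ₑ := by rw [weight_mul_neg, one_mul]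
    _ = (ENNReal.ofReal (m ξ) * weight (1 / 2) ξ * ‖prodTransform m Ψ Φ ξ t‖ₑ) *
        weight (-(1 / 2)) ξ := by
        rw [enorm_mul, enorm_ofReal_complex, abs_of_pos (hm.pos ξ)]; ring
    _ ≤ _ := mul_le_mul_left h2 _

/-- The bound for the forcing term of the second equation. -/
theorem SymbolBounds.enorm_mul_absSqTransform_le
    (hm : SymbolBounds ν N C m) (hΨ : Measurable Ψ) (ξ t : ℝ) :
    ‖(m ξ : ℂ) * (Complex.I * ξ * absSqTransform m Ψ ξ t)‖ₑ ≤
      ENNReal.ofReal (C + 2) * (weightedNorm 1 (majorant Ψ) * weightedNorm 1 (majorant Ψ)) := by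
  have hM := measurable_majorant hΨ
  have h1 := hm.abs_mul_lintegral_absSq_le hM (g := fun η => majorant Ψ (-η)) (by fun_prop) ξ
  rw [weightedNorm_comp_neg] at h1
  refine le_trans (le_of_eq ?_)
    ((mul_le_mul_right (hm.enorm_absSqTransform_le (Ψ := Ψ) ξ t) _).trans h1)
  rw [enorm_mul, enorm_mul, enorm_mul, enorm_ofReal_complex, enorm_ofReal_complex,
    abs_of_pos (hm.pos ξ), ENNReal.ofReal_mul (abs_nonneg _)]
  have : ‖Complex.I‖ₑ = 1 := by rw [← ofReal_norm, Complex.norm_I, ENNReal.ofReal_one]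
  rw [this]
  ring

/-- The part of the time derivative of the cubic integrand due to the nonlinearity acting on the
first factor. -/
def quarticFirst (α : ℝ) (m : ℝ → ℝ) (Ψ Φ : ℝ × ℝ → ℂ) (q : (ℝ × ℝ) × ℝ) : ℂ :=
  ((-Complex.I * α) * (m q.1.1 * prodTransform m Ψ Φ q.1.1 q.2)) *
    (evolution Φ q.1.2 q.2 * (starRingEnd ℂ) (evolution Ψ (q.1.1 + q.1.2) q.2))

/-- The part due to the second factor. -/
def quarticSecond (β : ℝ) (m : ℝ → ℝ) (Ψ : ℝ × ℝ → ℂ) (q : (ℝ × ℝ) × ℝ) : ℂ :=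
  (β * (m q.1.2 * (Complex.I * q.1.2 * absSqTransform m Ψ q.1.2 q.2))) *
    (evolution Ψ q.1.1 q.2 * (starRingEnd ℂ) (evolution Ψ (q.1.1 + q.1.2) q.2))

/-- The part due to the third factor. -/
def quarticThird (α : ℝ) (m : ℝ → ℝ) (Ψ Φ : ℝ × ℝ → ℂ) (q : (ℝ × ℝ) × ℝ) : ℂ :=
  (starRingEnd ℂ) ((-Complex.I * α) *
    (m (q.1.1 + q.1.2) * prodTransform m Ψ Φ (q.1.1 + q.1.2) q.2)) *
    (evolution Ψ q.1.1 q.2 * evolution Φ q.1.2 q.2)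

theorem measurable_quarticFirst (hm : Measurable m) (hΨ : Measurable Ψ) (hΦ : Measurable Φ) :
    Measurable (quarticFirst α m Ψ Φ) := by
  have h2 : Measurable fun q : (ℝ × ℝ) × ℝ => evolution Φ q.1.2 q.2 :=
    measurable_evolution_comp hΦ (by fun_prop) (by fun_prop)
  have h3 : Measurable fun q : (ℝ × ℝ) × ℝ => evolution Ψ (q.1.1 + q.1.2) q.2 :=
    measurable_evolution_comp hΨ (by fun_prop) (by fun_prop)
  have h4 : Measurable fun q : (ℝ × ℝ) × ℝ => prodTransform m Ψ Φ q.1.1 q.2 :=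
    (measurable_prodTransform hm hΨ hΦ).comp
      (f := fun q : (ℝ × ℝ) × ℝ => (q.1.1, q.2)) (by fun_prop)
  have hconj : Measurable (starRingEnd ℂ : ℂ → ℂ) := Complex.continuous_conj.measurable
  unfold quarticFirst
  fun_prop

theorem measurable_quarticSecond (hm : Measurable m) (hΨ : Measurable Ψ) :
    Measurable (quarticSecond β m Ψ) := by
  have h2 : Measurable fun q : (ℝ × ℝ) × ℝ => evolution Ψ q.1.1 q.2 :=
    measurable_evolution_comp hΨ (by fun_prop) (by fun_prop)
  have h3 : Measurable fun q : (ℝ × ℝ) × ℝ => evolution Ψ (q.1.1 + q.1.2) q.2 :=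
    measurable_evolution_comp hΨ (by fun_prop) (by fun_prop)
  have h4 : Measurable fun q : (ℝ × ℝ) × ℝ => absSqTransform m Ψ q.1.2 q.2 :=
    (measurable_absSqTransform hm hΨ).comp
      (f := fun q : (ℝ × ℝ) × ℝ => (q.1.2, q.2)) (by fun_prop)
  have hconj : Measurable (starRingEnd ℂ : ℂ → ℂ) := Complex.continuous_conj.measurable
  unfold quarticSecond
  fun_prop

theorem measurable_quarticThird (hm : Measurable m) (hΨ : Measurable Ψ) (hΦ : Measurable Φ) :
    Measurable (quarticThird α m Ψ Φ) := by
  have h2 : Measurable fun q : (ℝ × ℝ) × ℝ => evolution Φ q.1.2 q.2 :=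
    measurable_evolution_comp hΦ (by fun_prop) (by fun_prop)
  have h3 : Measurable fun q : (ℝ × ℝ) × ℝ => evolution Ψ q.1.1 q.2 :=
    measurable_evolution_comp hΨ (by fun_prop) (by fun_prop)
  have h4 : Measurable fun q : (ℝ × ℝ) × ℝ => prodTransform m Ψ Φ (q.1.1 + q.1.2) q.2 :=
    (measurable_prodTransform hm hΨ hΦ).comp
      (f := fun q : (ℝ × ℝ) × ℝ => (q.1.1 + q.1.2, q.2)) (by fun_prop)
  have hconj : Measurable (starRingEnd ℂ : ℂ → ℂ) := Complex.continuous_conj.measurable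
  unfold quarticThird
  fun_prop

namespace IsSmoothedSolution

/-- The forcing of the first factor is at most a constant times ⟨x⟩^(-1/2), uniformly in time, and
against this weight the convolution of the other two majorants is integrable. -/
theorem exists_quarticFirst_majorant (h : IsSmoothedSolution α β ν b δ m Ψ Φ)
    (hm : SymbolBounds ν N C m) : ∃ M : ℝ × ℝ → ℝ≥0∞, ∫⁻ p, M p ≠ ⊤ ∧
      ∀ p t, ‖quarticFirst α m Ψ Φ (p, t)‖ₑ ≤ M p := by
  have hMΨ := measurable_majorant h.meas_left
  have hMΦ := measurable_majorant h.meas_right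
  have hw := measurable_weight (-(1 / 2))
  set c := ‖-Complex.I * (α : ℂ)‖ₑ *
    (ENNReal.ofReal C * (weightedNorm 1 (majorant Ψ) * weightedNorm (1 / 2) (majorant Φ))) with hc
  have hc' : c ≠ ⊤ := ENNReal.mul_ne_top enorm_ne_top (ENNReal.mul_ne_top ENNReal.ofReal_ne_top
    (ENNReal.mul_ne_top h.weightedNorm_left h.weightedNorm_right))
  refine ⟨fun p => c * (weight (-(1 / 2)) p.1 * (majorant Φ p.2 * majorant Ψ (p.1 + p.2))), ?_,
    fun p t => ?_⟩
  · rw [lintegral_const_mul' _ _ hc']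
    refine ENNReal.mul_ne_top hc' ?_
    rw [Measure.volume_eq_prod, lintegral_prod _ (by fun_prop)]
    simp only
    have e : ∀ x, ∫⁻ y, weight (-(1 / 2)) x * (majorant Φ y * majorant Ψ (x + y)) =
        weight (-(1 / 2)) x * ∫⁻ η, majorant Ψ (x - η) * majorant Φ (-η) := fun x => by
      rw [lintegral_const_mul' _ _ (weight_ne_top _ _), lintegral_shift_eq]
    simp only [e]
    refine ne_top_of_le_ne_top ?_ (lintegral_weight_conv_le hMΨ (g := fun η => majorant Φ (-η))
      (by fun_prop))
    rw [weightedNorm_comp_neg]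
    exact ENNReal.mul_ne_top (tailConst_lt_top (by norm_num)).ne
      (ENNReal.mul_ne_top h.weightedNorm_left h.weightedNorm_right)
  · simp only [quarticFirst]
    rw [enorm_mul, enorm_mul, enorm_mul (evolution Φ _ _), RCLike.enorm_conj]
    calc _ ≤ ‖-Complex.I * (α : ℂ)‖ₑ * (ENNReal.ofReal C * (weightedNorm 1 (majorant Ψ) *
          weightedNorm (1 / 2) (majorant Φ)) * weight (-(1 / 2)) p.1) *
          (majorant Φ p.2 * majorant Ψ (p.1 + p.2)) := by
          gcongr
          · exact hm.enorm_mul_prodTransform_le h.meas_left h.meas_right _ _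
          · exact enorm_evolution_le _ _ _
          · exact enorm_evolution_le _ _ _
      _ = _ := by rw [hc]; ring

/-- The forcing of the second equation is bounded in frequency and time, and the majorant of Iu is
integrable because Iu has H¹ regularity. -/
theorem exists_quarticSecond_majorant (h : IsSmoothedSolution α β ν b δ m Ψ Φ)
    (hm : SymbolBounds ν N C m) : ∃ M : ℝ × ℝ → ℝ≥0∞, ∫⁻ p, M p ≠ ⊤ ∧
      ∀ p t, ‖quarticSecond β m Ψ (p, t)‖ₑ ≤ M p := by
  have hMΨ := measurable_majorant h.meas_left
  set c := ‖(β : ℂ)‖ₑ *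
    (ENNReal.ofReal (C + 2) * (weightedNorm 1 (majorant Ψ) * weightedNorm 1 (majorant Ψ))) with hc
  have hc' : c ≠ ⊤ := ENNReal.mul_ne_top enorm_ne_top (ENNReal.mul_ne_top ENNReal.ofReal_ne_top
    (ENNReal.mul_ne_top h.weightedNorm_left h.weightedNorm_left))
  refine ⟨fun p => c * (majorant Ψ p.1 * majorant Ψ (p.1 + p.2)), ?_, fun p t => ?_⟩
  · rw [lintegral_const_mul' _ _ hc']
    refine ENNReal.mul_ne_top hc' ?_
    rw [Measure.volume_eq_prod, lintegral_prod _ (by fun_prop)]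
    simp only
    have e : ∀ x, ∫⁻ y, majorant Ψ x * majorant Ψ (x + y) = majorant Ψ x * ∫⁻ y, majorant Ψ y :=
      fun x => by
        rw [lintegral_const_mul _ (by fun_prop), lintegral_add_left_eq_self]
    simp only [e]
    rw [lintegral_mul_const _ hMΨ]
    exact ENNReal.mul_ne_top h.lintegral_majorant_left h.lintegral_majorant_left
  · simp only [quarticSecond]
    rw [enorm_mul, enorm_mul, enorm_mul (evolution Ψ _ _), RCLike.enorm_conj]
    refine mul_le_mul' (mul_le_mul_right (hm.enorm_mul_absSqTransform_le h.meas_left _ _) _)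
      (mul_le_mul' (enorm_evolution_le _ _ _) (enorm_evolution_le _ _ _))

theorem exists_quarticThird_majorant (h : IsSmoothedSolution α β ν b δ m Ψ Φ)
    (hm : SymbolBounds ν N C m) : ∃ M : ℝ × ℝ → ℝ≥0∞, ∫⁻ p, M p ≠ ⊤ ∧
      ∀ p t, ‖quarticThird α m Ψ Φ (p, t)‖ₑ ≤ M p := by
  have hMΨ := measurable_majorant h.meas_left
  have hMΦ := measurable_majorant h.meas_right
  have hw := measurable_weight (-(1 / 2))
  set c := ‖-Complex.I * (α : ℂ)‖ₑ *
    (ENNReal.ofReal C * (weightedNorm 1 (majorant Ψ) * weightedNorm (1 / 2) (majorant Φ))) with hc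
  have hc' : c ≠ ⊤ := ENNReal.mul_ne_top enorm_ne_top (ENNReal.mul_ne_top ENNReal.ofReal_ne_top
    (ENNReal.mul_ne_top h.weightedNorm_left h.weightedNorm_right))
  refine ⟨fun p => c * (weight (-(1 / 2)) (p.1 + p.2) * (majorant Ψ p.1 * majorant Φ p.2)), ?_,
    fun p t => ?_⟩
  · rw [lintegral_const_mul' _ _ hc']
    refine ENNReal.mul_ne_top hc' ?_
    rw [Measure.volume_eq_prod, lintegral_prod _ (by fun_prop)]
    simp only
    rw [← lintegral_conv_eq
      (X := fun x y => weight (-(1 / 2)) (x + y) * (majorant Ψ x * majorant Φ y)) (by fun_prop)]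
    simp only [sub_add_cancel]
    have e : ∀ ξ, ∫⁻ η, weight (-(1 / 2)) ξ * (majorant Ψ (ξ - η) * majorant Φ η) =
        weight (-(1 / 2)) ξ * ∫⁻ η, majorant Ψ (ξ - η) * majorant Φ η :=
      fun ξ => lintegral_const_mul' _ _ (weight_ne_top _ _)
    simp only [e]
    exact ne_top_of_le_ne_top (ENNReal.mul_ne_top (tailConst_lt_top (by norm_num)).ne
      (ENNReal.mul_ne_top h.weightedNorm_left h.weightedNorm_right))
      (lintegral_weight_conv_le hMΨ hMΦ)
  · simp only [quarticThird]
    rw [enorm_mul, RCLike.enorm_conj, enorm_mul, enorm_mul (evolution Ψ _ _)]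
    calc _ ≤ ‖-Complex.I * (α : ℂ)‖ₑ * (ENNReal.ofReal C * (weightedNorm 1 (majorant Ψ) *
          weightedNorm (1 / 2) (majorant Φ)) * weight (-(1 / 2)) (p.1 + p.2)) *
          (majorant Ψ p.1 * majorant Φ p.2) := by
          gcongr
          · exact hm.enorm_mul_prodTransform_le h.meas_left h.meas_right _ _
          · exact enorm_evolution_le _ _ _
          · exact enorm_evolution_le _ _ _
      _ = _ := by rw [hc]; ring

/-- The increment of the cubic integrand at a pair of frequencies. -/
theorem cubicIntegrand_sub (h : IsSmoothedSolution α β ν b δ m Ψ Φ)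
    (hm : SymbolBounds ν N C m) : ∀ᵐ p : ℝ × ℝ,
      cubicIntegrand Ψ Φ δ p - cubicIntegrand Ψ Φ 0 p =
        Complex.I * ((resonance ν p.1 p.2 : ℂ) * triple Ψ Φ (Ioc 0 δ) p.1 p.2) +
        ∫ t in Ioc 0 δ, (quarticFirst α m Ψ Φ (p, t) + quarticSecond β m Ψ (p, t) +
          quarticThird α m Ψ Φ (p, t)) := by
  have hmm := hm.cont.measurable
  have hx : ∀ᵐ p : ℝ × ℝ, HasAEDeriv δ (evolution Ψ p.1) (fun t =>
      -Complex.I * (p.1 ^ 2 : ℝ) * evolution Ψ p.1 t +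
      (-Complex.I * α) * (m p.1 * prodTransform m Ψ Φ p.1 t)) :=
    Measure.quasiMeasurePreserving_fst.ae h.deriv_left
  have hy : ∀ᵐ p : ℝ × ℝ, HasAEDeriv δ (evolution Φ p.2) (fun t =>
      -Complex.I * (ν * p.2 * |p.2| : ℝ) * evolution Φ p.2 t +
      β * (m p.2 * (Complex.I * p.2 * absSqTransform m Ψ p.2 t))) :=
    Measure.quasiMeasurePreserving_snd.ae h.deriv_right
  have hT : Measure.QuasiMeasurePreserving (fun p : ℝ × ℝ => p.1 + p.2) volume volume :=
    Measure.quasiMeasurePreserving_fst.comp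
      (measurePreserving_add_prod (volume : Measure ℝ) volume).quasiMeasurePreserving
  have hz := hT.ae h.deriv_left
  obtain ⟨M1, hM1, hM1'⟩ := h.exists_quarticFirst_majorant hm
  obtain ⟨M2, hM2, hM2'⟩ := h.exists_quarticSecond_majorant hm
  obtain ⟨M3, hM3, hM3'⟩ := h.exists_quarticThird_majorant hm
  have hS : volume (Ioc 0 δ) ≠ ⊤ := by simp
  have i0 := (integrable_prod_of_majorant hS (measurable_cubicIntegrand h.meas_left h.meas_right)
    h.lintegral_cubic_majorant (fun p t => enorm_cubicIntegrand_le t p)).prod_right_ae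
  have i1 := (integrable_prod_of_majorant hS (measurable_quarticFirst (α := α) hmm h.meas_left
    h.meas_right) hM1 hM1').prod_right_ae
  have i2 := (integrable_prod_of_majorant hS (measurable_quarticSecond (β := β) hmm h.meas_left)
    hM2 hM2').prod_right_ae
  have i3 := (integrable_prod_of_majorant hS (measurable_quarticThird (α := α) hmm h.meas_left
    h.meas_right) hM3 hM3').prod_right_ae
  filter_upwards [hx, hy, hz, i0, i1, i2, i3] with p hx hy hz i0 i1 i2 i3
  -- The linear parts of the three factors add up to -ix² - iνy|y| + i(x + y)², that is i times the
  -- resonance function; the forcings give the three quartic terms.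
  have h1 := ((hx.mul hy).mul hz.conj).sub_eq h.nonneg
  have e : triple Ψ Φ (Ioc 0 δ) p.1 p.2 = ∫ t in Ioc 0 δ, cubicIntegrand Ψ Φ t p := rfl
  have e' : ∫ t in Ioc 0 δ, (Complex.I * (resonance ν p.1 p.2 : ℂ) * cubicIntegrand Ψ Φ t p +
      (quarticFirst α m Ψ Φ (p, t) + quarticSecond β m Ψ (p, t) + quarticThird α m Ψ Φ (p, t))) = _
    := integral_add (i0.const_mul _) ((i1.add i2).add i3)
  rw [e, ← mul_assoc, ← integral_const_mul]
  refine h1.trans (Eq.trans ?_ e')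
  congr 1
  ext t
  simp only [cubicIntegrand, quarticFirst, quarticSecond, quarticThird, resonance, map_add,
    map_mul, map_neg, Complex.conj_I, Complex.conj_ofReal]
  push_cast
  ring

/-- Integrating out y turns the remaining pair of factors into the conjugate transform of the
product Iu Iv; the reflection y ↦ -y uses that Iv is real, hence the restriction to t in [0, δ]. -/
theorem integral_quarticFirst (h : IsSmoothedSolution α β ν b δ m Ψ Φ)
    (hm : SymbolBounds ν N C m) {t : ℝ} (ht : t ∈ Icc 0 δ) :
    Integrable (fun ξ => ((-Complex.I * α) * (m ξ * prodTransform m Ψ Φ ξ t)) *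
        (starRingEnd ℂ) (prodTransform (fun _ => 1) Ψ Φ ξ t)) ∧
    (√(2 * Real.pi) : ℂ)⁻¹ * ∫ p, quarticFirst α m Ψ Φ (p, t) =
      ∫ ξ, ((-Complex.I * α) * (m ξ * prodTransform m Ψ Φ ξ t)) *
        (starRingEnd ℂ) (prodTransform (fun _ => 1) Ψ Φ ξ t) := by
  have hmm := hm.cont.measurable
  obtain ⟨M, hM, hM'⟩ := h.exists_quarticFirst_majorant hm
  have hi : Integrable (fun p => quarticFirst α m Ψ Φ (p, t)) (volume.prod volume) :=
    integrable_of_majorant ((measurable_quarticFirst hmm h.meas_left h.meas_right).comp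
      (f := fun p => (p, t)) (by fun_prop)) hM (fun p => hM' p t)
  have e : ∀ ξ, (√(2 * Real.pi) : ℂ)⁻¹ * ∫ y, quarticFirst α m Ψ Φ ((ξ, y), t) =
      ((-Complex.I * α) * (m ξ * prodTransform m Ψ Φ ξ t)) *
        (starRingEnd ℂ) (prodTransform (fun _ => 1) Ψ Φ ξ t) := by
    intro ξ
    simp only [quarticFirst]
    rw [integral_const_mul, integral_shift_eq (g := fun y => evolution Φ y t)
      (f := fun z => (starRingEnd ℂ) (evolution Ψ z t))]
    have : prodTransform (fun _ => 1) Ψ Φ ξ t =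
        (√(2 * Real.pi) : ℂ)⁻¹ * ∫ η, evolution Ψ (ξ - η) t * evolution Φ η t := by
      simp [prodTransform]
    rw [this, map_mul, ← integral_conj, map_inv₀, Complex.conj_ofReal]
    simp only [h.real _ t ht, map_mul]
    ring
  refine ⟨(hi.integral_prod_left.const_mul (√(2 * Real.pi) : ℂ)⁻¹).congr
    (Filter.Eventually.of_forall e), ?_⟩
  rw [Measure.volume_eq_prod, integral_prod _ hi, ← integral_const_mul]
  simp only [e]

theorem integral_quarticSecond (h : IsSmoothedSolution α β ν b δ m Ψ Φ)
    (hm : SymbolBounds ν N C m) (t : ℝ) :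
    Integrable (fun ξ => (β * (m ξ * (Complex.I * ξ * absSqTransform m Ψ ξ t))) *
        (starRingEnd ℂ) (absSqTransform (fun _ => 1) Ψ ξ t)) ∧
    (√(2 * Real.pi) : ℂ)⁻¹ * ∫ p, quarticSecond β m Ψ (p, t) =
      ∫ ξ, (β * (m ξ * (Complex.I * ξ * absSqTransform m Ψ ξ t))) *
        (starRingEnd ℂ) (absSqTransform (fun _ => 1) Ψ ξ t) := by
  have hmm := hm.cont.measurable
  obtain ⟨M, hM, hM'⟩ := h.exists_quarticSecond_majorant hm
  have hi : Integrable (fun p => quarticSecond β m Ψ (p, t)) (volume.prod volume) :=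
    integrable_of_majorant ((measurable_quarticSecond hmm h.meas_left).comp
      (f := fun p => (p, t)) (by fun_prop)) hM (fun p => hM' p t)
  have e : ∀ ξ, (√(2 * Real.pi) : ℂ)⁻¹ * ∫ x, quarticSecond β m Ψ ((x, ξ), t) =
      (β * (m ξ * (Complex.I * ξ * absSqTransform m Ψ ξ t))) *
        (starRingEnd ℂ) (absSqTransform (fun _ => 1) Ψ ξ t) := by
    intro ξ
    simp only [quarticSecond, add_comm _ ξ]
    rw [integral_const_mul, integral_shift_eq (g := fun y => evolution Ψ y t)
      (f := fun z => (starRingEnd ℂ) (evolution Ψ z t))]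
    have : absSqTransform (fun _ => 1) Ψ ξ t =
        (√(2 * Real.pi) : ℂ)⁻¹ * ∫ η, evolution Ψ (ξ - η) t *
          (starRingEnd ℂ) (evolution Ψ (-η) t) := by
      simp [absSqTransform]
    rw [this, map_mul, ← integral_conj, map_inv₀, Complex.conj_ofReal]
    simp only [map_mul, Complex.conj_conj]
    ring
  refine ⟨(hi.integral_prod_right.const_mul (√(2 * Real.pi) : ℂ)⁻¹).congr
    (Filter.Eventually.of_forall e), ?_⟩
  rw [Measure.volume_eq_prod, integral_prod_symm _ hi, ← integral_const_mul]
  simp only [e]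

theorem integral_quarticThird (h : IsSmoothedSolution α β ν b δ m Ψ Φ)
    (hm : SymbolBounds ν N C m) (t : ℝ) :
    Integrable (fun ξ => (starRingEnd ℂ) ((-Complex.I * α) * (m ξ * prodTransform m Ψ Φ ξ t)) *
        prodTransform (fun _ => 1) Ψ Φ ξ t) ∧
    (√(2 * Real.pi) : ℂ)⁻¹ * ∫ p, quarticThird α m Ψ Φ (p, t) =
      ∫ ξ, (starRingEnd ℂ) ((-Complex.I * α) * (m ξ * prodTransform m Ψ Φ ξ t)) *
        prodTransform (fun _ => 1) Ψ Φ ξ t := by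
  have hmm := hm.cont.measurable
  obtain ⟨M, hM, hM'⟩ := h.exists_quarticThird_majorant hm
  have hi : Integrable (fun p => quarticThird α m Ψ Φ (p, t)) (volume.prod volume) :=
    integrable_of_majorant ((measurable_quarticThird hmm h.meas_left h.meas_right).comp
      (f := fun p => (p, t)) (by fun_prop)) hM (fun p => hM' p t)
  have hT : MeasurePreserving (fun p : ℝ × ℝ => (p.1 - p.2, p.2)) (volume.prod volume)
    (volume.prod volume) := measurePreserving_sub_prod volume volume
  have hi2 := hT.integrable_comp_of_integrable hi
  have e : ∀ ξ, (√(2 * Real.pi) : ℂ)⁻¹ * ∫ y, quarticThird α m Ψ Φ ((ξ - y, y), t) =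
      (starRingEnd ℂ) ((-Complex.I * α) * (m ξ * prodTransform m Ψ Φ ξ t)) *
        prodTransform (fun _ => 1) Ψ Φ ξ t := by
    intro ξ
    simp only [quarticThird, sub_add_cancel]
    rw [integral_const_mul]
    have : prodTransform (fun _ => 1) Ψ Φ ξ t =
        (√(2 * Real.pi) : ℂ)⁻¹ * ∫ η, evolution Ψ (ξ - η) t * evolution Φ η t := by
      simp [prodTransform]
    rw [this]
    ring
  refine ⟨(hi2.integral_prod_left.const_mul (√(2 * Real.pi) : ℂ)⁻¹).congr
    (Filter.Eventually.of_forall e), ?_⟩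
  rw [Measure.volume_eq_prod, ← integral_comp_of_measurePreserving hT hi.aestronglyMeasurable,
    integral_prod (fun p : ℝ × ℝ => quarticThird α m Ψ Φ ((p.1 - p.2, p.2), t)) hi2,
    ← integral_const_mul]
  simp only [e]

theorem enorm_re_integral_le {X : Type*} [MeasurableSpace X] {μ : Measure X} {f : X → ℂ}
    (hf : Integrable f μ) : ‖(∫ x, f x ∂μ).re‖ₑ ≤ ∫⁻ x, ‖(f x).re‖ₑ ∂μ := by
  rw [← RCLike.re_to_complex, ← integral_re hf]
  exact enorm_integral_le_lintegral_enorm _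

/-- Only the commutators contribute to the real part of the quartic term. -/
theorem enorm_re_quartic_le (h : IsSmoothedSolution α β ν b δ m Ψ Φ)
    (hm : SymbolBounds ν N C m) {t : ℝ} (ht : t ∈ Icc 0 δ) :
    ‖((√(2 * Real.pi) : ℂ)⁻¹ * ∫ p, (quarticFirst α m Ψ Φ (p, t) + quarticSecond β m Ψ (p, t) +
          quarticThird α m Ψ Φ (p, t))).re‖ₑ ≤
      ENNReal.ofReal (2 * |α|) * (∫⁻ ξ, ‖prodTransform (fun _ => 1) Ψ Φ ξ t‖ₑ *
        ‖m ξ * prodTransform m Ψ Φ ξ t - prodTransform (fun _ => 1) Ψ Φ ξ t‖ₑ) +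
      ENNReal.ofReal |β| * ∫⁻ ξ, ‖absSqTransform (fun _ => 1) Ψ ξ t‖ₑ * (ENNReal.ofReal |ξ| *
        ‖m ξ * absSqTransform m Ψ ξ t - absSqTransform (fun _ => 1) Ψ ξ t‖ₑ) := by
  have hmm := hm.cont.measurable
  obtain ⟨M1, hM1, hM1'⟩ := h.exists_quarticFirst_majorant hm
  obtain ⟨M2, hM2, hM2'⟩ := h.exists_quarticSecond_majorant hm
  obtain ⟨M3, hM3, hM3'⟩ := h.exists_quarticThird_majorant hm
  have i1 : Integrable (fun p => quarticFirst α m Ψ Φ (p, t)) :=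
    integrable_of_majorant ((measurable_quarticFirst hmm h.meas_left h.meas_right).comp
      (f := fun p => (p, t)) (by fun_prop)) hM1 (fun p => hM1' p t)
  have i2 : Integrable (fun p => quarticSecond β m Ψ (p, t)) :=
    integrable_of_majorant ((measurable_quarticSecond hmm h.meas_left).comp
      (f := fun p => (p, t)) (by fun_prop)) hM2 (fun p => hM2' p t)
  have i3 : Integrable (fun p => quarticThird α m Ψ Φ (p, t)) :=
    integrable_of_majorant ((measurable_quarticThird hmm h.meas_left h.meas_right).comp
      (f := fun p => (p, t)) (by fun_prop)) hM3 (fun p => hM3' p t)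
  obtain ⟨j1, e1⟩ := h.integral_quarticFirst hm ht
  obtain ⟨j2, e2⟩ := h.integral_quarticSecond hm t
  obtain ⟨j3, e3⟩ := h.integral_quarticThird hm t
  have e0 : ∫ p, (quarticFirst α m Ψ Φ (p, t) + quarticSecond β m Ψ (p, t) +
      quarticThird α m Ψ Φ (p, t)) = _ := integral_add (i1.add i2) i3
  have e0' : ∫ p, (quarticFirst α m Ψ Φ (p, t) + quarticSecond β m Ψ (p, t)) = _ :=
    integral_add i1 i2
  rw [e0, e0', mul_add, mul_add, e1, e2, e3,
    add_right_comm, ← integral_add j1 j3, Complex.add_re]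
  refine (enorm_add_le _ _).trans (add_le_add ?_ ?_)
  · rw [← lintegral_const_mul' _ _ ENNReal.ofReal_ne_top]
    refine (enorm_re_integral_le (j1.add j3)).trans (lintegral_mono fun ξ => ?_)
    simp only [Pi.add_apply]
    set w := (m ξ : ℂ) * prodTransform m Ψ Φ ξ t
    set D := prodTransform (fun _ => 1) Ψ Φ ξ t
    -- With w for I(uv) and D for Iu Iv, the sum is 2α Im(w D̄). Since D D̄ is real, w may be
    -- replaced by the commutator w - D.
    have e : (-Complex.I * (α : ℂ) * w * (starRingEnd ℂ) D +
        (starRingEnd ℂ) (-Complex.I * (α : ℂ) * w) * D).re =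
        2 * α * (D * (starRingEnd ℂ) (w - D)).im * (-1) := by
      simp
      ring
    rw [e, ← ofReal_norm, ← ofReal_norm, ← ofReal_norm, ← ENNReal.ofReal_mul (norm_nonneg _),
      ← ENNReal.ofReal_mul (by positivity)]
    refine ENNReal.ofReal_le_ofReal ?_
    simp only [norm_mul, norm_neg, norm_one, mul_one, Real.norm_eq_abs, Nat.abs_ofNat]
    gcongr
    refine (Complex.abs_im_le_norm _).trans_eq ?_
    rw [norm_mul, RCLike.norm_conj]
  · rw [← lintegral_const_mul' _ _ ENNReal.ofReal_ne_top]
    refine (enorm_re_integral_le j2).trans (lintegral_mono fun ξ => ?_)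
    simp only
    set q := absSqTransform m Ψ ξ t
    set D := absSqTransform (fun _ => 1) Ψ ξ t
    -- Again D D̄ is real, and iξ times a real number has no real part, so I(|u|²) may be replaced
    -- by its difference from |Iu|².
    have e : ((β : ℂ) * (m ξ * (Complex.I * ξ * q)) * (starRingEnd ℂ) D).re =
        β * (ξ * (D * (starRingEnd ℂ) (m ξ * q - D)).im) := by
      simp
      ring
    rw [e, ← ofReal_norm, ← ofReal_norm, ← ofReal_norm, ← ENNReal.ofReal_mul (abs_nonneg _),
      ← ENNReal.ofReal_mul (norm_nonneg _), ← ENNReal.ofReal_mul (by positivity)]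
    refine ENNReal.ofReal_le_ofReal ?_
    rw [norm_mul, norm_mul, Real.norm_eq_abs, Real.norm_eq_abs, Real.norm_eq_abs,
      mul_left_comm ‖D‖]
    gcongr
    refine (Complex.abs_im_le_norm _).trans_eq ?_
    rw [norm_mul, RCLike.norm_conj]

/-- The increment of the cubic part of the energy. -/
theorem abs_re_cubicForm_sub_le (h : IsSmoothedSolution α β ν b δ m Ψ Φ)
    (hm : SymbolBounds ν N C m) (hν : 0 ≤ ν) :
    ENNReal.ofReal |(cubicForm Ψ Φ δ).re - (cubicForm Ψ Φ 0).re + (√(2 * Real.pi))⁻¹ *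
        ∫ p : ℝ × ℝ, (triSymbol m p.1 p.2 * resonance ν p.1 p.2) * tri m Ψ Φ δ p.1 p.2| ≤
      ENNReal.ofReal (2 * |α|) * (ENNReal.ofReal (C / N) * (tailConst 1 * tailConst b) *
        (restrictionNorm (fun ξ => ξ ^ 2) 1 b Ψ ^ 2 *
          restrictionNorm (fun ξ => ν * ξ * |ξ|) (1 / 2) b Φ ^ 2)) +
      ENNReal.ofReal |β| * (ENNReal.ofReal (C / N) * (tailConst 1 * tailConst b) *
        restrictionNorm (fun ξ => ξ ^ 2) 1 b Ψ ^ 4) := by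
  have hmm := hm.cont.measurable
  obtain ⟨M1, hM1, hM1'⟩ := h.exists_quarticFirst_majorant hm
  obtain ⟨M2, hM2, hM2'⟩ := h.exists_quarticSecond_majorant hm
  obtain ⟨M3, hM3, hM3'⟩ := h.exists_quarticThird_majorant hm
  have hS : volume (Ioc 0 δ) ≠ ⊤ := by simp
  have iq := ((integrable_prod_of_majorant hS (measurable_quarticFirst (α := α) hmm h.meas_left
    h.meas_right) hM1 hM1').add (integrable_prod_of_majorant hS
    (measurable_quarticSecond (β := β) hmm h.meas_left) hM2 hM2')).add
    (integrable_prod_of_majorant hS (measurable_quarticThird (α := α) hmm h.meas_left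
    h.meas_right) hM3 hM3')
  have hres : Measurable fun p : ℝ × ℝ => resonance ν p.1 p.2 := by unfold resonance; fun_prop
  have ir := h.integrable_mul_triple hres (by linarith) (abs_resonance_le hν)
  set Q : ℝ × ℝ → ℝ → ℂ := fun p t => quarticFirst α m Ψ Φ (p, t) + quarticSecond β m Ψ (p, t) +
    quarticThird α m Ψ Φ (p, t) with hQ
  have iq' : Integrable (Function.uncurry Q) (volume.prod (volume.restrict (Ioc 0 δ))) := iq
  have e1 : (∫ p, cubicIntegrand Ψ Φ δ p) - ∫ p, cubicIntegrand Ψ Φ 0 p =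
      Complex.I * (∫ p : ℝ × ℝ, (resonance ν p.1 p.2 : ℂ) * triple Ψ Φ (Ioc 0 δ) p.1 p.2) +
        ∫ t in Ioc 0 δ, ∫ p, Q p t := by
    have e0 : ∫ p : ℝ × ℝ, (Complex.I * ((resonance ν p.1 p.2 : ℂ) * triple Ψ Φ (Ioc 0 δ) p.1 p.2) +
        ∫ t in Ioc 0 δ, Q p t) = _ := integral_add (ir.const_mul _) iq'.integral_prod_left
    rw [← integral_sub (h.integrable_cubicIntegrand δ) (h.integrable_cubicIntegrand 0),
      integral_congr_ae (h.cubicIntegrand_sub hm), ← integral_integral_swap iq',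
      ← integral_const_mul]
    exact e0
  have e2 : (cubicForm Ψ Φ δ).re - (cubicForm Ψ Φ 0).re =
      -((√(2 * Real.pi))⁻¹ *
        ∫ p : ℝ × ℝ, (triSymbol m p.1 p.2 * resonance ν p.1 p.2) * tri m Ψ Φ δ p.1 p.2) +
      ∫ t in Ioc 0 δ, ((√(2 * Real.pi) : ℂ)⁻¹ * ∫ p, Q p t).re := by
    have e3 : ∀ p : ℝ × ℝ, (triSymbol m p.1 p.2 * resonance ν p.1 p.2) * tri m Ψ Φ δ p.1 p.2 =
        RCLike.im ((resonance ν p.1 p.2 : ℂ) * triple Ψ Φ (Ioc 0 δ) p.1 p.2) := by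
      intro p
      have := (hm.triSymbol_pos p.1 p.2).ne'
      rw [tri, RCLike.im_to_complex, Complex.im_ofReal_mul]
      field_simp
    simp only [e3]
    have e4 := integral_re (iq'.integral_prod_right.const_mul (√(2 * Real.pi) : ℂ)⁻¹)
    rw [integral_im ir]
    simp only [RCLike.re_to_complex, RCLike.im_to_complex, Function.uncurry] at e4 ⊢
    rw [e4, integral_const_mul, cubicForm, cubicForm, ← Complex.sub_re, ← mul_sub, e1, mul_add,
      Complex.add_re]
    congr 1
    rw [← Complex.ofReal_inv, Complex.re_ofReal_mul, Complex.I_mul_re]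
    ring
  rw [e2, neg_add_eq_sub, sub_add_cancel]
  calc _ = ‖∫ t in Ioc 0 δ, ((√(2 * Real.pi) : ℂ)⁻¹ * ∫ p, Q p t).re‖ₑ := by
        rw [← Real.norm_eq_abs, ofReal_norm]
    _ ≤ ∫⁻ t in Ioc 0 δ, ‖((√(2 * Real.pi) : ℂ)⁻¹ * ∫ p, Q p t).re‖ₑ :=
        enorm_integral_le_lintegral_enorm _
    _ ≤ ∫⁻ t in Ioc 0 δ, (ENNReal.ofReal (2 * |α|) *
        (∫⁻ ξ, ‖prodTransform (fun _ => 1) Ψ Φ ξ t‖ₑ *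
        ‖m ξ * prodTransform m Ψ Φ ξ t - prodTransform (fun _ => 1) Ψ Φ ξ t‖ₑ) +
      ENNReal.ofReal |β| * ∫⁻ ξ, ‖absSqTransform (fun _ => 1) Ψ ξ t‖ₑ * (ENNReal.ofReal |ξ| *
        ‖m ξ * absSqTransform m Ψ ξ t - absSqTransform (fun _ => 1) Ψ ξ t‖ₑ)) :=
        setLIntegral_mono' measurableSet_Ioc fun t ht =>
          h.enorm_re_quartic_le hm (Ioc_subset_Icc_self ht)
    _ ≤ _ := by
        have hP := measurable_prodTransform hmm h.meas_left h.meas_right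
        have hD := measurable_prodTransform (m := fun _ => 1) measurable_const h.meas_left
          h.meas_right
        have hmeas : Measurable fun t => ∫⁻ ξ, ‖prodTransform (fun _ => 1) Ψ Φ ξ t‖ₑ *
            ‖m ξ * prodTransform m Ψ Φ ξ t - prodTransform (fun _ => 1) Ψ Φ ξ t‖ₑ :=
          Measurable.lintegral_prod_left' (f := fun p : ℝ × ℝ =>
            ‖prodTransform (fun _ => 1) Ψ Φ p.1 p.2‖ₑ * ‖m p.1 * prodTransform m Ψ Φ p.1 p.2 -
              prodTransform (fun _ => 1) Ψ Φ p.1 p.2‖ₑ) (by fun_prop)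
        rw [lintegral_add_left (hmeas.const_mul _), lintegral_const_mul' _ _ ENNReal.ofReal_ne_top,
          lintegral_const_mul' _ _ ENNReal.ofReal_ne_top]
        gcongr
        · exact hm.lintegral_prod_commutator_le (measurable_dispersion ν) h.half_lt h.meas_left
            h.meas_right h.norm_left h.norm_right _
        · exact hm.lintegral_absSq_commutator_le h.half_lt h.meas_left h.norm_left _

end IsSmoothedSolution

end Cubic

end SBO
end

/-! ### Increments of E and L on the Fourier side -/

noncomputable section

namespace SBO

section Increments

variable {α β ν N C b δ : ℝ} {m : ℝ → ℝ} {Ψ Φ : ℝ × ℝ → ℂ}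

/-- The energy at time `t`, on the Fourier side. -/
def energyForm (α β ν : ℝ) (Ψ Φ : ℝ × ℝ → ℂ) (t : ℝ) : ℝ :=
  (∫ ξ, ξ ^ 2 * ‖evolution Ψ ξ t‖ ^ 2)
    - α * ν / (2 * β) * (∫ ξ, |ξ| * ‖evolution Φ ξ t‖ ^ 2) + α * (cubicForm Ψ Φ t).re

/-- The functional `L` at time `t`, on the Fourier side. -/
def momentumForm (α β : ℝ) (Ψ Φ : ℝ × ℝ → ℂ) (t : ℝ) : ℝ :=
  -(α / (2 * β)) * (∫ ξ, ‖evolution Φ ξ t‖ ^ 2) + ∫ ξ, ξ * ‖evolution Ψ ξ t‖ ^ 2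

/-- The constant in the trilinear estimate. -/
def triConst (b : ℝ) : ℝ := (tailConst b * ENNReal.ofReal (2 * Real.pi) ^ (1 / 2 : ℝ)).toReal

/-- The constant in the quadrilinear estimates. -/
def quarticConst (b : ℝ) : ℝ := (tailConst 1 * tailConst b).toReal

theorem triConst_nonneg (b : ℝ) : 0 ≤ triConst b := ENNReal.toReal_nonneg

theorem quarticConst_nonneg (b : ℝ) : 0 ≤ quarticConst b := ENNReal.toReal_nonneg

theorem triBound_toReal (ν b : ℝ) (Ψ Φ : ℝ × ℝ → ℂ) : (triBound ν b Ψ Φ).toReal =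
    triConst b * ((restrictionNorm (fun ξ => ξ ^ 2) 1 b Ψ).toReal ^ 2 *
      (restrictionNorm (fun ξ => ν * ξ * |ξ|) (1 / 2) b Φ).toReal) := by
  rw [triBound, ENNReal.toReal_mul, ENNReal.toReal_mul (a := _ ^ 2), ENNReal.toReal_pow, triConst]

theorem inv_sqrt_two_pi_le_one : (√(2 * Real.pi))⁻¹ ≤ 1 := by
  refine inv_le_one_of_one_le₀ ?_
  rw [Real.one_le_sqrt]
  linarith [Real.pi_gt_three]

theorem abs_const_mul_integral_tri_le (h : IsSmoothedSolution α β ν b δ m Ψ Φ)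
    (hm : SymbolBounds ν N C m) {κ : ℝ → ℝ → ℝ}
    (hκ : ∀ x y, |κ x y| ≤ C / N * (triWeight x y * triSymbol m x y)) :
    |α * (√(2 * Real.pi))⁻¹ * ∫ p : ℝ × ℝ, κ p.1 p.2 * tri m Ψ Φ δ p.1 p.2| ≤
      |α| * (C / N * (triConst b * ((restrictionNorm (fun ξ => ξ ^ 2) 1 b Ψ).toReal ^ 2 *
        (restrictionNorm (fun ξ => ν * ξ * |ξ|) (1 / 2) b Φ).toReal))) := by
  rw [← triBound_toReal, abs_mul, abs_mul, abs_of_nonneg (a := (√(2 * Real.pi))⁻¹) (by positivity)]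
  have h1 := h.abs_integral_mul_tri_le hm hm.const_div_nonneg hκ
  have h2 : |α| * (√(2 * Real.pi))⁻¹ ≤ |α| :=
    mul_le_of_le_one_right (abs_nonneg _) inv_sqrt_two_pi_le_one
  exact mul_le_mul h2 h1 (abs_nonneg _) (abs_nonneg _)

namespace IsSmoothedSolution

theorem abs_re_cubicForm_sub_toReal_le (h : IsSmoothedSolution α β ν b δ m Ψ Φ)
    (hm : SymbolBounds ν N C m) (hν : 0 ≤ ν) :
    |(cubicForm Ψ Φ δ).re - (cubicForm Ψ Φ 0).re + (√(2 * Real.pi))⁻¹ *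
        ∫ p : ℝ × ℝ, (triSymbol m p.1 p.2 * resonance ν p.1 p.2) * tri m Ψ Φ δ p.1 p.2| ≤
      2 * |α| * (C / N * quarticConst b * ((restrictionNorm (fun ξ => ξ ^ 2) 1 b Ψ).toReal ^ 2 *
          (restrictionNorm (fun ξ => ν * ξ * |ξ|) (1 / 2) b Φ).toReal ^ 2)) +
        |β| * (C / N * quarticConst b *
          (restrictionNorm (fun ξ => ξ ^ 2) 1 b Ψ).toReal ^ 4) := by
  have h1 := h.abs_re_cubicForm_sub_le hm hν
  have hT : tailConst 1 * tailConst b ≠ ⊤ :=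
    ENNReal.mul_ne_top (tailConst_lt_top (by norm_num)).ne (tailConst_lt_top h.half_lt).ne
  have hA := h.norm_left
  have hB := h.norm_right
  have hCN := hm.const_div_nonneg
  have h2 := (ENNReal.ofReal_le_iff_le_toReal (by finiteness)).mp h1
  rw [ENNReal.toReal_add (by finiteness) (by finiteness)] at h2
  simp only [ENNReal.toReal_mul, ENNReal.toReal_pow, ENNReal.toReal_ofReal hCN,
    ENNReal.toReal_ofReal (abs_nonneg _),
    ENNReal.toReal_ofReal (mul_nonneg zero_le_two (abs_nonneg _))] at h2
  simpa only [quarticConst, ENNReal.toReal_mul] using h2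

theorem integrable_right_symbol_mul_tri (h : IsSmoothedSolution α β ν b δ m Ψ Φ)
    (hm : SymbolBounds ν N C m) {G : ℝ → ℝ} (hG : Measurable G) (hGb : ∀ ξ, |G ξ| ≤ bracket ξ) :
    Integrable fun p : ℝ × ℝ => (G p.2 * p.2 * m p.2 ^ 2) * tri m Ψ Φ δ p.1 p.2 := by
  have hmm := hm.cont.measurable
  refine h.integrable_mul_tri hm (κ := fun _ y => G y * y * m y ^ 2) (by fun_prop)
    hm.const_pos.le fun x y => ?_
  rw [abs_mul, abs_mul, abs_of_nonneg (a := m y ^ 2) (by positivity)]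
  calc _ ≤ bracket y * |y| * m y ^ 2 := by gcongr; exact hGb y
    _ = |y| * (bracket y * m y ^ 2) := by ring
    _ ≤ |y| * (C * (bracket x * bracket (x + y) * triSymbol m x y)) := by
        exact mul_le_mul_of_nonneg_left (hm.bracket_mul_sq_le x y) (abs_nonneg _)
    _ = _ := by unfold triWeight; ring

/-- The increment of the energy. -/
theorem abs_energyForm_sub_le (h : IsSmoothedSolution α β ν b δ m Ψ Φ)
    (hm : SymbolBounds ν N C m) (hν : 0 ≤ ν) (hβ : β ≠ 0) :
    |energyForm α β ν Ψ Φ δ - energyForm α β ν Ψ Φ 0| ≤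
      |α| * (C / N * (triConst b * ((restrictionNorm (fun ξ => ξ ^ 2) 1 b Ψ).toReal ^ 2 *
        (restrictionNorm (fun ξ => ν * ξ * |ξ|) (1 / 2) b Φ).toReal))) +
      |α| * (2 * |α| * (C / N * quarticConst b *
          ((restrictionNorm (fun ξ => ξ ^ 2) 1 b Ψ).toReal ^ 2 *
          (restrictionNorm (fun ξ => ν * ξ * |ξ|) (1 / 2) b Φ).toReal ^ 2)) +
        |β| * (C / N * quarticConst b *
          (restrictionNorm (fun ξ => ξ ^ 2) 1 b Ψ).toReal ^ 4)) := by
  have hmm := hm.cont.measurable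
  have hsq : ∀ ξ : ℝ, |ξ ^ 2| ≤ bracket ξ ^ 2 := fun ξ => by
    rw [abs_of_nonneg (by positivity), bracket_sq]; linarith
  have habs : ∀ ξ : ℝ, |(|ξ|)| ≤ bracket ξ := fun ξ => by rw [abs_abs]; exact abs_le_bracket ξ
  have e1 := h.integral_normSq_left_sub hm (G := fun ξ => ξ ^ 2) (by fun_prop) hsq
    hm.const_pos.le hm.sq_sub_sq_le
  have e2 := h.integral_normSq_right_sub hm (G := fun ξ => |ξ|) (by fun_prop) habs
  have i1 : Integrable fun p : ℝ × ℝ =>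
      ((p.1 + p.2) ^ 2 * m (p.1 + p.2) ^ 2 - p.1 ^ 2 * m p.1 ^ 2) * tri m Ψ Φ δ p.1 p.2 :=
    h.integrable_mul_tri hm (κ := fun x y => (x + y) ^ 2 * m (x + y) ^ 2 - x ^ 2 * m x ^ 2)
      (by fun_prop) hm.const_pos.le hm.sq_sub_sq_le
  have i2 := h.integrable_right_symbol_mul_tri hm (G := fun ξ => |ξ|) (by fun_prop) habs
  have hts := measurable_triSymbol hmm
  have hres : Measurable fun p : ℝ × ℝ => resonance ν p.1 p.2 := by unfold resonance; fun_prop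
  have i3 : Integrable fun p : ℝ × ℝ =>
      (triSymbol m p.1 p.2 * resonance ν p.1 p.2) * tri m Ψ Φ δ p.1 p.2 :=
    h.integrable_mul_tri hm (κ := fun x y => triSymbol m x y * resonance ν x y)
      (c := 4 + 2 * ν) (by fun_prop) (by linarith) fun x y => by
      have h1 := hm.triSymbol_pos x y
      rw [abs_mul, abs_of_pos h1, mul_comm, ← mul_assoc]
      exact mul_le_mul_of_nonneg_right (abs_resonance_le hν x y) h1.le
  have h1 := abs_const_mul_integral_tri_le h hm hm.energySymbol_le
  have h2 := h.abs_re_cubicForm_sub_toReal_le hm hν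
  have e3 : ∫ p : ℝ × ℝ, energySymbol ν m p.1 p.2 * tri m Ψ Φ δ p.1 p.2 =
      (∫ p : ℝ × ℝ,
        ((p.1 + p.2) ^ 2 * m (p.1 + p.2) ^ 2 - p.1 ^ 2 * m p.1 ^ 2) * tri m Ψ Φ δ p.1 p.2) -
      ν * (∫ p : ℝ × ℝ, (|p.2| * p.2 * m p.2 ^ 2) * tri m Ψ Φ δ p.1 p.2) -
      ∫ p : ℝ × ℝ, (triSymbol m p.1 p.2 * resonance ν p.1 p.2) * tri m Ψ Φ δ p.1 p.2 := by
    rw [← integral_const_mul, ← integral_sub i1 (i2.const_mul ν), ← integral_sub _ i3]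
    · congr 1
      ext p
      simp only [energySymbol, resonance]
      ring
    · exact i1.sub (i2.const_mul ν)
  rw [e3] at h1
  -- The resonance integral is added and subtracted: subtracted from the quadratic increments it
  -- completes `energySymbol`, and added to the cubic increment it leaves only quartic commutators.
  -- The coefficient αν/(2β) times the 2β of the second equation gives the common factor α.
  have e4 : energyForm α β ν Ψ Φ δ - energyForm α β ν Ψ Φ 0 =
      α * (√(2 * Real.pi))⁻¹ * ((∫ p : ℝ × ℝ,
        ((p.1 + p.2) ^ 2 * m (p.1 + p.2) ^ 2 - p.1 ^ 2 * m p.1 ^ 2) * tri m Ψ Φ δ p.1 p.2) -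
      ν * (∫ p : ℝ × ℝ, (|p.2| * p.2 * m p.2 ^ 2) * tri m Ψ Φ δ p.1 p.2) -
      ∫ p : ℝ × ℝ, (triSymbol m p.1 p.2 * resonance ν p.1 p.2) * tri m Ψ Φ δ p.1 p.2) +
      α * ((cubicForm Ψ Φ δ).re - (cubicForm Ψ Φ 0).re + (√(2 * Real.pi))⁻¹ *
        ∫ p : ℝ × ℝ, (triSymbol m p.1 p.2 * resonance ν p.1 p.2) * tri m Ψ Φ δ p.1 p.2) := by
    have e5 : energyForm α β ν Ψ Φ δ - energyForm α β ν Ψ Φ 0 =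
        ((∫ ξ, ξ ^ 2 * ‖evolution Ψ ξ δ‖ ^ 2) - ∫ ξ, ξ ^ 2 * ‖evolution Ψ ξ 0‖ ^ 2) -
        α * ν / (2 * β) * ((∫ ξ, |ξ| * ‖evolution Φ ξ δ‖ ^ 2) -
          ∫ ξ, |ξ| * ‖evolution Φ ξ 0‖ ^ 2) +
        α * ((cubicForm Ψ Φ δ).re - (cubicForm Ψ Φ 0).re) := by
      unfold energyForm; ring
    rw [e5, e1, e2]
    field_simp
    ring
  rw [e4]
  refine (abs_add_le _ _).trans (add_le_add h1 ?_)
  rw [abs_mul]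
  exact mul_le_mul_of_nonneg_left h2 (abs_nonneg _)

/-- The increment of `L`. -/
theorem abs_momentumForm_sub_le (h : IsSmoothedSolution α β ν b δ m Ψ Φ)
    (hm : SymbolBounds ν N C m) (hβ : β ≠ 0) :
    |momentumForm α β Ψ Φ δ - momentumForm α β Ψ Φ 0| ≤
      |α| * (C / N * (triConst b * ((restrictionNorm (fun ξ => ξ ^ 2) 1 b Ψ).toReal ^ 2 *
        (restrictionNorm (fun ξ => ν * ξ * |ξ|) (1 / 2) b Φ).toReal))) := by
  have hmm := hm.cont.measurable
  have hid : ∀ ξ : ℝ, |ξ| ≤ bracket ξ ^ 2 := fun ξ => by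
    have h1 := abs_le_bracket ξ
    have h2 := one_le_bracket ξ
    nlinarith
  have hone : ∀ ξ : ℝ, |(1 : ℝ)| ≤ bracket ξ := fun ξ => by rw [abs_one]; exact one_le_bracket ξ
  -- The difference is the momentum symbol plus y m(y)². The latter does not gain 1/N, but this
  -- bound is needed only for convergence; it cancels against the contribution of g before the size
  -- is measured.
  have hdiff : ∀ x y, |(x + y) * m (x + y) ^ 2 - x * m x ^ 2| ≤
      (2 * C) * (triWeight x y * triSymbol m x y) := by
    intro x y
    have h1 := hm.momentumSymbol_le x y
    have h2 : C / N ≤ C := div_le_self hm.const_pos.le hm.one_le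
    have h3 := mul_nonneg (triWeight_nonneg x y) (hm.triSymbol_pos x y).le
    have h4 : |y * m y ^ 2| ≤ C * (triWeight x y * triSymbol m x y) := by
      rw [abs_mul, abs_of_nonneg (a := m y ^ 2) (by positivity)]
      calc _ ≤ |y| * (bracket y * m y ^ 2) := by
            gcongr; exact le_mul_of_one_le_left (by positivity) (one_le_bracket y)
        _ ≤ |y| * (C * (bracket x * bracket (x + y) * triSymbol m x y)) := by
            exact mul_le_mul_of_nonneg_left (hm.bracket_mul_sq_le x y) (abs_nonneg _)
        _ = _ := by unfold triWeight; ring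
    have e : (x + y) * m (x + y) ^ 2 - x * m x ^ 2 = momentumSymbol m x y + y * m y ^ 2 := by
      unfold momentumSymbol; ring
    rw [e]
    refine (abs_add_le _ _).trans ?_
    have h5 := mul_le_mul_of_nonneg_right h2 h3
    linarith
  have hC : 0 ≤ 2 * C := by linarith [hm.const_pos]
  have e1 := h.integral_normSq_left_sub hm (G := fun ξ => ξ) (by fun_prop) hid hC hdiff
  have e2 := h.integral_normSq_right_sub hm (G := fun _ => 1) (by fun_prop) hone
  have i1 : Integrable fun p : ℝ × ℝ =>
      ((p.1 + p.2) * m (p.1 + p.2) ^ 2 - p.1 * m p.1 ^ 2) * tri m Ψ Φ δ p.1 p.2 :=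
    h.integrable_mul_tri hm (κ := fun x y => (x + y) * m (x + y) ^ 2 - x * m x ^ 2)
      (by fun_prop) hC hdiff
  have i2 := h.integrable_right_symbol_mul_tri hm (G := fun _ => 1) (by fun_prop) hone
  simp only [one_mul] at e2 i2
  have h1 := abs_const_mul_integral_tri_le h hm hm.momentumSymbol_le
  have e3 : ∫ p : ℝ × ℝ, momentumSymbol m p.1 p.2 * tri m Ψ Φ δ p.1 p.2 =
      (∫ p : ℝ × ℝ,
        ((p.1 + p.2) * m (p.1 + p.2) ^ 2 - p.1 * m p.1 ^ 2) * tri m Ψ Φ δ p.1 p.2) -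
      ∫ p : ℝ × ℝ, (p.2 * m p.2 ^ 2) * tri m Ψ Φ δ p.1 p.2 := by
    rw [← integral_sub i1 i2]
    congr 1
    ext p
    simp only [momentumSymbol]
    ring
  rw [e3] at h1
  refine le_trans (le_of_eq ?_) h1
  have e5 : momentumForm α β Ψ Φ δ - momentumForm α β Ψ Φ 0 =
      ((∫ ξ, ξ * ‖evolution Ψ ξ δ‖ ^ 2) - ∫ ξ, ξ * ‖evolution Ψ ξ 0‖ ^ 2) -
      α / (2 * β) * ((∫ ξ, ‖evolution Φ ξ δ‖ ^ 2) - ∫ ξ, ‖evolution Φ ξ 0‖ ^ 2) := by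
    unfold momentumForm; ring
  rw [e5, e1, e2]
  congr 1
  field_simp

end IsSmoothedSolution

/-- The constant in the estimate of the increments. -/
def incrementConst (α β ν b K : ℝ) : ℝ :=
  symbolConst ν K * (2 * (|α| * triConst b) + |α| * ((2 * |α| + |β|) * quarticConst b))

theorem IsSmoothedSolution.increments_le {K : ℝ}
    (h : IsSmoothedSolution α β ν b δ m Ψ Φ) (hm : SymbolBounds ν N (symbolConst ν K) m)
    (hν : 0 ≤ ν) (hβ : β ≠ 0) {A B : ℝ}
    (hA : (restrictionNorm (fun ξ => ξ ^ 2) 1 b Ψ).toReal = A)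
    (hB : (restrictionNorm (fun ξ => ν * ξ * |ξ|) (1 / 2) b Φ).toReal = B) :
    |energyForm α β ν Ψ Φ δ - energyForm α β ν Ψ Φ 0| +
        |momentumForm α β Ψ Φ δ - momentumForm α β Ψ Φ 0| ≤
      incrementConst α β ν b K * N⁻¹ * (A ^ 2 * B + A ^ 4 + A ^ 2 * B ^ 2) := by
  have h1 := h.abs_energyForm_sub_le hm hν hβ
  have h2 := h.abs_momentumForm_sub_le hm hβ
  rw [hA, hB] at h1 h2
  have hA0 : 0 ≤ A := hA ▸ ENNReal.toReal_nonneg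
  have hB0 : 0 ≤ B := hB ▸ ENNReal.toReal_nonneg
  have hC := hm.const_div_nonneg
  have hT := triConst_nonneg b
  have hQ := quarticConst_nonneg b
  have hα := abs_nonneg α
  have hβ' := abs_nonneg β
  refine (add_le_add h1 h2).trans ?_
  have e : incrementConst α β ν b K * N⁻¹ * (A ^ 2 * B + A ^ 4 + A ^ 2 * B ^ 2) =
      (symbolConst ν K / N) * ((2 * (|α| * triConst b)) * (A ^ 2 * B + A ^ 4 + A ^ 2 * B ^ 2) +
        |α| * ((2 * |α| + |β|) * quarticConst b) * (A ^ 2 * B + A ^ 4 + A ^ 2 * B ^ 2)) := by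
    unfold incrementConst; ring
  rw [e, ← sub_nonneg]
  -- The right-hand side minus the sum of the two bounds is written with nonnegative terms only.
  have e' : symbolConst ν K / N * ((2 * (|α| * triConst b)) * (A ^ 2 * B + A ^ 4 + A ^ 2 * B ^ 2) +
        |α| * ((2 * |α| + |β|) * quarticConst b) * (A ^ 2 * B + A ^ 4 + A ^ 2 * B ^ 2)) -
      (|α| * (symbolConst ν K / N * (triConst b * (A ^ 2 * B))) +
        |α| * (2 * |α| * (symbolConst ν K / N * quarticConst b * (A ^ 2 * B ^ 2)) +
          |β| * (symbolConst ν K / N * quarticConst b * A ^ 4)) +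
        |α| * (symbolConst ν K / N * (triConst b * (A ^ 2 * B)))) =
      symbolConst ν K / N * ((2 * (|α| * triConst b)) * (A ^ 4 + A ^ 2 * B ^ 2) +
        |α| * quarticConst b * (2 * |α| * (A ^ 2 * B + A ^ 4) +
          |β| * (A ^ 2 * B + A ^ 2 * B ^ 2))) := by ring
  rw [e']
  positivity

end Increments

end SBO
end

noncomputable section

namespace SBO

/-! ### Extensions -/

section Extension

variable {h : ℝ → ℝ} {σ b δ : ℝ} {w : ℝ → 𝓢'(ℝ, ℂ)} {Ψ Ψ' : ℝ × ℝ → ℂ}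

/-- `Ψ` is a measurable space-time transform of finite norm of an extension of `w` from `[0, δ]`,
with a time inversion integral that converges at every spatial frequency. -/
structure IsExtension (h : ℝ → ℝ) (σ b δ : ℝ) (w : ℝ → 𝓢'(ℝ, ℂ)) (Ψ : ℝ × ℝ → ℂ) : Prop where
  meas : Measurable Ψ
  norm_ne_top : restrictionNorm h σ b Ψ ≠ ⊤
  majorant_ne_top : ∀ ξ, majorant Ψ ξ ≠ ⊤
  hasFourier : ∀ t ∈ Icc 0 δ, HasFourier (w t) (fun ξ => evolution Ψ ξ t)

theorem restrictionNorm_congr_ae (h : ℝ → ℝ) (σ b : ℝ) (hΨ : Ψ =ᵐ[volume] Ψ') :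
    restrictionNorm h σ b Ψ = restrictionNorm h σ b Ψ' := by
  refine eLpNorm_congr_ae ?_
  filter_upwards [hΨ] with p hp
  rw [hp]

theorem evolution_congr_ae (hΨ : Ψ =ᵐ[volume] Ψ') :
    ∀ᵐ ξ, ∀ t, evolution Ψ ξ t = evolution Ψ' ξ t := by
  rw [Measure.volume_eq_prod] at hΨ
  filter_upwards [Measure.ae_ae_of_ae_prod hΨ] with ξ hξ t
  simp only [evolution, fourierInversion]
  congr 1
  refine integral_congr_ae ?_
  filter_upwards [hξ] with τ hτ
  rw [hτ]

theorem ae_majorant_ne_top (hh : Measurable h) (hσ : 0 ≤ σ) (hb : 1 / 2 < b) (hΨ : Measurable Ψ)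
    (hn : restrictionNorm h σ b Ψ ≠ ⊤) : ∀ᵐ ξ, majorant Ψ ξ ≠ ⊤ := by
  have h1 := measurable_majorant hΨ
  have h2 := measurable_weight σ
  have h3 := ne_top_of_le_ne_top (ENNReal.mul_ne_top (tailConst_lt_top hb).ne
    (ENNReal.pow_ne_top hn)) (lintegral_majorant_sq_le hh σ b hΨ)
  filter_upwards [ae_lt_top (by fun_prop) h3] with ξ hξ
  refine ne_top_of_le_ne_top (b := weight σ ξ * majorant Ψ ξ) ?_
    (le_mul_of_one_le_left' (one_le_weight hσ ξ))
  rintro h0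
  rw [h0] at hξ
  simp at hξ

/-- The transform `Ψ` with the spatial frequencies in `S` removed. -/
def removeFrequencies (S : Set ℝ) (Ψ : ℝ × ℝ → ℂ) : ℝ × ℝ → ℂ :=
  (Prod.fst ⁻¹' Sᶜ).indicator Ψ

theorem measurable_removeFrequencies {S : Set ℝ} (hS : MeasurableSet S) (hΨ : Measurable Ψ) :
    Measurable (removeFrequencies S Ψ) :=
  hΨ.indicator (measurable_fst hS.compl)

theorem removeFrequencies_of_mem {S : Set ℝ} {ξ : ℝ} (hξ : ξ ∈ S) (τ : ℝ) :
    removeFrequencies S Ψ (ξ, τ) = 0 :=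
  indicator_of_notMem (by simpa using hξ) _

theorem removeFrequencies_of_notMem {S : Set ℝ} {ξ : ℝ} (hξ : ξ ∉ S) (τ : ℝ) :
    removeFrequencies S Ψ (ξ, τ) = Ψ (ξ, τ) :=
  indicator_of_mem (by simpa using hξ) _

theorem evolution_removeFrequencies_of_mem {S : Set ℝ} {ξ : ℝ} (hξ : ξ ∈ S) (t : ℝ) :
    evolution (removeFrequencies S Ψ) ξ t = 0 := by
  simp [evolution, fourierInversion, removeFrequencies_of_mem hξ]

theorem evolution_removeFrequencies_of_notMem {S : Set ℝ} {ξ : ℝ} (hξ : ξ ∉ S) (t : ℝ) :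
    evolution (removeFrequencies S Ψ) ξ t = evolution Ψ ξ t := by
  simp [evolution, removeFrequencies_of_notMem hξ]

theorem majorant_removeFrequencies_ne_top {S : Set ℝ} {ξ : ℝ} (hξ : ξ ∉ S → majorant Ψ ξ ≠ ⊤) :
    majorant (removeFrequencies S Ψ) ξ ≠ ⊤ := by
  by_cases h0 : ξ ∈ S
  · simp [majorant, removeFrequencies_of_mem h0]
  · simpa [majorant, removeFrequencies_of_notMem h0] using hξ h0

theorem removeFrequencies_ae_eq {S : Set ℝ} (hS : volume S = 0) :
    removeFrequencies S Ψ =ᵐ[volume] Ψ := by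
  have h1 : ∀ᵐ p : ℝ × ℝ, p.1 ∉ S :=
    Measure.quasiMeasurePreserving_fst.ae (measure_eq_zero_iff_ae_notMem.mp hS)
  filter_upwards [h1] with p hp
  exact removeFrequencies_of_notMem hp p.2

theorem HasFourier.removeFrequencies {S : Set ℝ} (hS : volume S = 0) {T : 𝓢'(ℝ, ℂ)} {t : ℝ}
    (hT : HasFourier T (fun ξ => evolution Ψ ξ t)) :
    HasFourier T (fun ξ => evolution (removeFrequencies S Ψ) ξ t) := by
  refine hT.congr ?_
  filter_upwards [evolution_congr_ae (removeFrequencies_ae_eq (Ψ := Ψ) hS)] with ξ hξ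
  exact (hξ t).symm

/-- A symmetric measurable null set outside of which a property holds. -/
theorem exists_symmetric_null_set {p : ℝ → Prop} (hp : ∀ᵐ ξ, p ξ) :
    ∃ S : Set ℝ, MeasurableSet S ∧ volume S = 0 ∧ (∀ ξ, -ξ ∈ S ↔ ξ ∈ S) ∧ ∀ ξ ∉ S, p ξ := by
  let T := toMeasurable volume {ξ | ¬ p ξ}
  have hT : MeasurableSet T := measurableSet_toMeasurable _ _
  have hT0 : volume T = 0 := by rw [measure_toMeasurable]; exact hp
  refine ⟨T ∪ -T, hT.union hT.neg, ?_, fun ξ => ?_, fun ξ hξ => ?_⟩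
  · rw [measure_union_null_iff, Measure.measure_neg]
    exact ⟨hT0, hT0⟩
  · simp [or_comm]
  · by_contra h0
    exact hξ (Or.inl (subset_toMeasurable _ _ h0))

theorem IsSpaceTimeFourier.exists_isExtension {ψ : ℝ → 𝓢'(ℝ, ℂ)} (hψ : IsSpaceTimeFourier ψ Ψ)
    (hw : ∀ t ∈ Icc 0 δ, ψ t = w t) (hh : Measurable h) (hσ : 0 ≤ σ) (hb : 1 / 2 < b)
    (hn : restrictionNorm h σ b Ψ ≠ ⊤) :
    ∃ Ψ', IsExtension h σ b δ w Ψ' ∧ restrictionNorm h σ b Ψ' = restrictionNorm h σ b Ψ := by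
  obtain ⟨hm, hF⟩ := hψ
  set Ψ₁ := hm.mk Ψ
  have hΨ₁ : Measurable Ψ₁ := hm.stronglyMeasurable_mk.measurable
  have hae : Ψ =ᵐ[volume] Ψ₁ := hm.ae_eq_mk
  have hn₁ := restrictionNorm_congr_ae h σ b hae
  obtain ⟨S, hS, hS0, -, hSp⟩ := exists_symmetric_null_set
    (ae_majorant_ne_top hh hσ hb hΨ₁ (hn₁ ▸ hn))
  have hn₂ := restrictionNorm_congr_ae h σ b (removeFrequencies_ae_eq (Ψ := Ψ₁) hS0)
  refine ⟨removeFrequencies S Ψ₁, ⟨measurable_removeFrequencies hS hΨ₁, ?_, fun ξ =>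
    majorant_removeFrequencies_ne_top (hSp ξ), fun t ht => HasFourier.removeFrequencies hS0 ?_⟩, ?_⟩
  · rwa [hn₂, ← hn₁]
  · rw [← hw t ht]
    refine (hF t).congr ?_
    filter_upwards [evolution_congr_ae hae] with ξ hξ
    exact hξ t
  · rw [hn₂, hn₁]

theorem IsExtension.continuous_evolution (hΨ : IsExtension h σ b δ w Ψ) (ξ : ℝ) :
    Continuous (evolution Ψ ξ) :=
  SBO.continuous_evolution hΨ.meas (hΨ.majorant_ne_top ξ)

theorem IsExtension.removeFrequencies (hΨ : IsExtension h σ b δ w Ψ) {S : Set ℝ}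
    (hS : MeasurableSet S) (hS0 : volume S = 0) :
    IsExtension h σ b δ w (removeFrequencies S Ψ) where
  meas := measurable_removeFrequencies hS hΨ.meas
  norm_ne_top := by
    rw [restrictionNorm_congr_ae h σ b (removeFrequencies_ae_eq hS0)]
    exact hΨ.norm_ne_top
  majorant_ne_top ξ := majorant_removeFrequencies_ne_top fun _ => hΨ.majorant_ne_top ξ
  hasFourier t ht := HasFourier.removeFrequencies hS0 (hΨ.hasFourier t ht)

/-- Continuity in time makes the exceptional set of frequencies independent of t. It is removed
together with its reflection, so that the symmetry holds at every frequency while the norm is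
unchanged. -/
theorem IsExtension.exists_conj_symmetric (hΨ : IsExtension h σ b δ w Ψ)
    (hr : ∀ t ∈ Icc 0 δ, ∀ᵐ ξ, evolution Ψ (-ξ) t = (starRingEnd ℂ) (evolution Ψ ξ t)) :
    ∃ Ψ', IsExtension h σ b δ w Ψ' ∧ restrictionNorm h σ b Ψ' = restrictionNorm h σ b Ψ ∧
      ∀ ξ, ∀ t ∈ Icc 0 δ, evolution Ψ' (-ξ) t = (starRingEnd ℂ) (evolution Ψ' ξ t) := by
  have h1 := ae_forall_eq_of_forall_ae_eq (δ := δ) (x := fun ξ t => evolution Ψ (-ξ) t)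
    (y := fun ξ t => (starRingEnd ℂ) (evolution Ψ ξ t))
    (Filter.Eventually.of_forall fun ξ => (hΨ.continuous_evolution (-ξ)).continuousOn)
    (Filter.Eventually.of_forall fun ξ =>
      (Complex.continuous_conj.comp (hΨ.continuous_evolution ξ)).continuousOn) hr
  obtain ⟨S, hS, hS0, hSn, hSp⟩ := exists_symmetric_null_set h1
  refine ⟨SBO.removeFrequencies S Ψ, hΨ.removeFrequencies hS hS0,
    restrictionNorm_congr_ae h σ b (removeFrequencies_ae_eq hS0), fun ξ t ht => ?_⟩
  by_cases hξ : ξ ∈ S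
  · rw [evolution_removeFrequencies_of_mem hξ, evolution_removeFrequencies_of_mem ((hSn ξ).mpr hξ),
      map_zero]
  · rw [evolution_removeFrequencies_of_notMem hξ,
      evolution_removeFrequencies_of_notMem (mt (hSn ξ).mp hξ)]
    exact hSp ξ hξ t ht

/-- Extensions with norms close to the local norm. -/
theorem exists_isExtension_of_localNorm_lt_top (hw : localNorm h σ b δ w < ⊤) (hh : Measurable h)
    (hσ : 0 ≤ σ) (hb : 1 / 2 < b) {ε : ℝ} (hε : 0 < ε) :
    ∃ Ψ, IsExtension h σ b δ w Ψ ∧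
      (restrictionNorm h σ b Ψ).toReal ≤ (localNorm h σ b δ w).toReal + ε := by
  have h1 : localNorm h σ b δ w < localNorm h σ b δ w + ENNReal.ofReal ε :=
    ENNReal.lt_add_right hw.ne (by simpa using hε)
  conv_lhs at h1 => unfold localNorm
  simp only [iInf_lt_iff] at h1
  obtain ⟨ψ, Ψ, hψ, hψw, hlt⟩ := h1
  obtain ⟨Ψ', hΨ', hn⟩ := hψ.exists_isExtension hψw hh hσ hb hlt.ne_top
  refine ⟨Ψ', hΨ', ?_⟩
  rw [hn, ← ENNReal.toReal_ofReal hε.le, ← ENNReal.toReal_add hw.ne ENNReal.ofReal_ne_top]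
  exact ENNReal.toReal_mono (ENNReal.add_ne_top.mpr ⟨hw.ne, ENNReal.ofReal_ne_top⟩) hlt.le

end Extension

/-! ### The equations on the Fourier side -/

section Equations

variable {α β ν s b N K C δ : ℝ} {m : ℝ → ℝ} {u₀ v₀ : 𝓢'(ℝ, ℂ)} {u v : ℝ → 𝓢'(ℝ, ℂ)}
  {Ψ Φ : ℝ × ℝ → ℂ} {h h' : ℝ → ℝ} {σ σ' : ℝ}

theorem IsExtension.hat_ae (hΨ : IsExtension h σ b δ (fun t => smoothing m (u t)) Ψ)
    (hm : IsSymbol s N K m) (hs : 1 / 4 ≤ s) (hN : 1 ≤ N) {t : ℝ} (ht : t ∈ Icc 0 δ) :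
    hat (u t) =ᵐ[volume] fun ξ => (m ξ : ℂ)⁻¹ * evolution Ψ ξ t :=
  (hm.hasFourier_of_smoothing hs hN (hΨ.hasFourier t ht)).hat_ae

theorem prodHat_eq (hΨ : IsExtension h σ b δ (fun t => smoothing m (u t)) Ψ)
    (hΦ : IsExtension h' σ' b δ (fun t => smoothing m (v t)) Φ)
    (hm : IsSymbol s N K m) (hs : 1 / 4 ≤ s) (hN : 1 ≤ N) {t : ℝ} (ht : t ∈ Icc 0 δ) (ξ : ℝ) :
    prodHat (u t) (v t) ξ = prodTransform m Ψ Φ ξ t := by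
  rw [prodHat, prodTransform]
  congr 1
  refine integral_congr_ae ?_
  filter_upwards [(quasiMeasurePreserving_sub_left (volume : Measure ℝ) ξ).ae
    (hΨ.hat_ae hm hs hN ht), hΦ.hat_ae hm hs hN ht] with η h1 h2
  rw [h1, h2]

theorem absSqHat_eq (hΨ : IsExtension h σ b δ (fun t => smoothing m (u t)) Ψ)
    (hm : IsSymbol s N K m) (hs : 1 / 4 ≤ s) (hN : 1 ≤ N) {t : ℝ} (ht : t ∈ Icc 0 δ) (ξ : ℝ) :
    absSqHat (u t) ξ = absSqTransform m Ψ ξ t := by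
  rw [absSqHat, absSqTransform]
  congr 1
  refine integral_congr_ae ?_
  filter_upwards [(quasiMeasurePreserving_sub_left (volume : Measure ℝ) ξ).ae
    (hΨ.hat_ae hm hs hN ht), (Measure.measurePreserving_neg (volume : Measure
      ℝ)).quasiMeasurePreserving.ae (hΨ.hat_ae hm hs hN ht)] with η h1 h2
  rw [h1, h2]

/-- The passage from the integral equation to the differential equation. -/
theorem ae_hasAEDeriv_of_duhamel {θ : ℝ → ℝ} {c : ℂ} {a : ℝ → ℂ} {F : ℝ → ℝ → ℂ}
    {w : ℝ → 𝓢'(ℝ, ℂ)} (hΨ : IsExtension h σ b δ w Ψ) (hδ : 0 ≤ δ)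
    (hF : ∀ ξ, Measurable (F ξ)) (hM : ∀ ξ, ∃ M : ℝ≥0∞, M ≠ ⊤ ∧ ∀ t, ‖F ξ t‖ₑ ≤ M)
    (hd : ∀ t ∈ Icc 0 δ, ∀ᵐ ξ, evolution Ψ ξ t = Complex.exp (-Complex.I * (t * θ ξ : ℝ)) * a ξ +
      c * ∫ r in (0 : ℝ)..t, Complex.exp (-Complex.I * ((t - r) * θ ξ : ℝ)) * F ξ r) :
    ∀ᵐ ξ, HasAEDeriv δ (evolution Ψ ξ) (fun t =>
      -Complex.I * θ ξ * evolution Ψ ξ t + c * F ξ t) := by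
  have hM' : ∀ ξ, ∃ M : ℝ, ∀ t ∈ Icc 0 δ, ‖F ξ t‖ ≤ M := fun ξ => by
    obtain ⟨M, hM, hle⟩ := hM ξ
    refine ⟨M.toReal, fun t _ => ?_⟩
    rw [← toReal_enorm]
    exact ENNReal.toReal_mono hM (hle t)
  have h1 := ae_forall_eq_of_forall_ae_eq (δ := δ) (x := evolution Ψ) (y := fun ξ t =>
    Complex.exp (-Complex.I * (t * θ ξ : ℝ)) * a ξ +
      c * ∫ r in (0 : ℝ)..t, Complex.exp (-Complex.I * ((t - r) * θ ξ : ℝ)) * F ξ r)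
    (Filter.Eventually.of_forall fun ξ => (hΨ.continuous_evolution ξ).continuousOn)
    (Filter.Eventually.of_forall fun ξ => continuousOn_duhamel hδ (hF ξ) (hM' ξ).choose_spec) hd
  filter_upwards [h1] with ξ hξ
  refine hasAEDeriv_of_duhamel hδ (hF ξ) (hM' ξ).choose_spec fun t ht => ?_
  have h0 := hξ 0 ⟨le_rfl, hδ⟩
  simp only [zero_mul, Complex.ofReal_zero, mul_zero, Complex.exp_zero, one_mul,
    intervalIntegral.integral_same, add_zero] at h0
  rw [h0]
  exact hξ t ht

/-- The transforms of u and v are those of Iu and Iv divided by m, so multiplying the Duhamel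
formulas by m(ξ) gives integral equations for the evolutions; the uniform bounds on the forcing then
allow differentiation in time. -/
theorem IsLocalSolution.isSmoothedSolution (hsol : IsLocalSolution α β ν s b m δ u₀ v₀ u v)
    (hm : IsSymbol s N K m) (hs : 1 / 4 ≤ s) (hs1 : s ≤ 1) (hN : 1 ≤ N) (hν : 0 ≤ ν)
    (hb : 1 / 2 < b) (hδ : 0 ≤ δ)
    (hΨ : IsExtension (fun ξ => ξ ^ 2) 1 b δ (fun t => smoothing m (u t)) Ψ)
    (hΦ : IsExtension (fun ξ => ν * ξ * |ξ|) (1 / 2) b δ (fun t => smoothing m (v t)) Φ)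
    (hr : ∀ ξ, ∀ t ∈ Icc 0 δ, evolution Φ (-ξ) t = (starRingEnd ℂ) (evolution Φ ξ t)) :
    IsSmoothedSolution α β ν b δ m Ψ Φ := by
  have hB := hm.symbolBounds hs hs1 hN hν
  have hmm := hB.cont.measurable
  have h0 : (0 : ℝ) ∈ Icc 0 δ := ⟨le_rfl, hδ⟩
  have hsub : ∀ {t r : ℝ}, t ∈ Icc 0 δ → r ∈ uIcc 0 t → r ∈ Icc 0 δ := fun {t r} ht hr' => by
    rw [uIcc_of_le ht.1] at hr'
    exact ⟨hr'.1, hr'.2.trans ht.2⟩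
  have hwΨ : weightedNorm 1 (majorant Ψ) ≠ ⊤ :=
    ne_top_of_le_ne_top (ENNReal.mul_ne_top (ENNReal.rpow_ne_top_of_nonneg (by norm_num)
      (tailConst_lt_top hb).ne) hΨ.norm_ne_top) (weightedNorm_majorant_le (by fun_prop) 1 b hΨ.meas)
  have hwΦ : weightedNorm (1 / 2) (majorant Φ) ≠ ⊤ :=
    ne_top_of_le_ne_top (ENNReal.mul_ne_top (ENNReal.rpow_ne_top_of_nonneg (by norm_num)
      (tailConst_lt_top hb).ne) hΦ.norm_ne_top)
      (weightedNorm_majorant_le (measurable_dispersion ν) (1 / 2) b hΦ.meas)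
  have hP : ∀ ξ, Measurable fun t => (m ξ : ℂ) * prodTransform m Ψ Φ ξ t := fun ξ =>
    ((measurable_prodTransform hmm hΨ.meas hΦ.meas).comp measurable_prodMk_left).const_mul _
  have hQ : ∀ ξ, Measurable fun t => (m ξ : ℂ) * (Complex.I * ξ * absSqTransform m Ψ ξ t) :=
    fun ξ => (((measurable_absSqTransform hmm hΨ.meas).comp
      measurable_prodMk_left).const_mul _).const_mul _
  refine ⟨hδ, hb, hΨ.meas, hΦ.meas, hΨ.norm_ne_top, hΦ.norm_ne_top, hΨ.majorant_ne_top,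
    hΦ.majorant_ne_top, hr, ?_, ?_⟩
  · refine ae_hasAEDeriv_of_duhamel (θ := fun ξ => ξ ^ 2) (a := fun ξ => evolution Ψ ξ 0)
      hΨ hδ hP (fun ξ => ⟨_, ?_, fun t => hB.enorm_mul_prodTransform_le hΨ.meas hΦ.meas ξ t⟩)
      fun t ht => ?_
    · exact ENNReal.mul_ne_top (ENNReal.mul_ne_top ENNReal.ofReal_ne_top
        (ENNReal.mul_ne_top hwΨ hwΦ)) (weight_ne_top _ _)
    · filter_upwards [hsol.duhamel_u t ht, hΨ.hat_ae hm hs hN ht, hΨ.hat_ae hm hs hN h0]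
        with ξ h1 h2 h3
      rw [← hsol.initial_u, h2, h3] at h1
      have h4 : (m ξ : ℂ) ≠ 0 := by exact_mod_cast (hB.pos ξ).ne'
      have h5 : ∫ r in (0 : ℝ)..t,
          Complex.exp (-Complex.I * ((t - r) * ξ ^ 2 : ℝ)) * prodHat (u r) (v r) ξ =
          ∫ r in (0 : ℝ)..t, Complex.exp (-Complex.I * ((t - r) * ξ ^ 2 : ℝ)) *
            prodTransform m Ψ Φ ξ r :=
        intervalIntegral.integral_congr fun r hr' => by
          rw [prodHat_eq hΨ hΦ hm hs hN (hsub ht hr')]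
      have h6 : ∫ r in (0 : ℝ)..t, Complex.exp (-Complex.I * ((t - r) * ξ ^ 2 : ℝ)) *
            ((m ξ : ℂ) * prodTransform m Ψ Φ ξ r) =
          m ξ * ∫ r in (0 : ℝ)..t, Complex.exp (-Complex.I * ((t - r) * ξ ^ 2 : ℝ)) *
            prodTransform m Ψ Φ ξ r := by
        rw [← intervalIntegral.integral_const_mul]
        congr 1
        ext r
        ring
      rw [h5] at h1
      rw [h6]
      have h7 := congrArg (fun z => (m ξ : ℂ) * z) h1
      rw [mul_inv_cancel_left₀ h4] at h7
      rw [h7]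
      generalize ∫ r in (0 : ℝ)..t, Complex.exp (-Complex.I * ((t - r) * ξ ^ 2 : ℝ)) *
            prodTransform m Ψ Φ ξ r = J
      field_simp
      ring
  · refine ae_hasAEDeriv_of_duhamel (θ := fun ξ => ν * ξ * |ξ|) (a := fun ξ => evolution Φ ξ 0)
      hΦ hδ hQ (fun ξ => ⟨_, ?_, fun t => hB.enorm_mul_absSqTransform_le hΨ.meas ξ t⟩)
      fun t ht => ?_
    · exact ENNReal.mul_ne_top ENNReal.ofReal_ne_top (ENNReal.mul_ne_top hwΨ hwΨ)
    · filter_upwards [hsol.duhamel_v t ht, hΦ.hat_ae hm hs hN ht, hΦ.hat_ae hm hs hN h0]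
        with ξ h1 h2 h3
      rw [← hsol.initial_v, h2, h3] at h1
      have h4 : (m ξ : ℂ) ≠ 0 := by exact_mod_cast (hB.pos ξ).ne'
      have h5 : ∫ r in (0 : ℝ)..t, Complex.exp (-Complex.I * ((t - r) * (ν * ξ * |ξ|) : ℝ)) *
            (Complex.I * ξ * absSqHat (u r) ξ) =
          ∫ r in (0 : ℝ)..t, Complex.exp (-Complex.I * ((t - r) * (ν * ξ * |ξ|) : ℝ)) *
            (Complex.I * ξ * absSqTransform m Ψ ξ r) :=
        intervalIntegral.integral_congr fun r hr' => by
          rw [absSqHat_eq hΨ hm hs hN (hsub ht hr')]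
      have h6 : ∫ r in (0 : ℝ)..t, Complex.exp (-Complex.I * ((t - r) * (ν * ξ * |ξ|) : ℝ)) *
            ((m ξ : ℂ) * (Complex.I * ξ * absSqTransform m Ψ ξ r)) =
          m ξ * ∫ r in (0 : ℝ)..t, Complex.exp (-Complex.I * ((t - r) * (ν * ξ * |ξ|) : ℝ)) *
            (Complex.I * ξ * absSqTransform m Ψ ξ r) := by
        rw [← intervalIntegral.integral_const_mul]
        congr 1
        ext r
        ring
      rw [h5] at h1
      rw [h6]
      have h7 := congrArg (fun z => (m ξ : ℂ) * z) h1
      rw [mul_inv_cancel_left₀ h4] at h7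
      rw [h7]
      generalize ∫ r in (0 : ℝ)..t, Complex.exp (-Complex.I * ((t - r) * (ν * ξ * |ξ|) : ℝ)) *
            (Complex.I * ξ * absSqTransform m Ψ ξ r) = J
      field_simp

end Equations

/-! ### The functionals on the Fourier side -/

section Functionals

variable {α β ν b δ : ℝ} {m : ℝ → ℝ} {f g : 𝓢'(ℝ, ℂ)} {Ψ Φ : ℝ × ℝ → ℂ} {t : ℝ}

theorem memLp_two_of_integrable_sq {F : ℝ → ℂ} (hF : Measurable F)
    (h : Integrable fun ξ => ‖F ξ‖ ^ 2) : MemLp F 2 :=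
  (memLp_two_iff_integrable_sq_norm hF.aestronglyMeasurable).mpr h

namespace IsSmoothedSolution

theorem memLp_left (h : IsSmoothedSolution α β ν b δ m Ψ Φ) (t : ℝ) :
    MemLp (fun ξ => evolution Ψ ξ t) 2 := by
  refine memLp_two_of_integrable_sq (measurable_evolution_comp h.meas_left (by fun_prop)
    (by fun_prop)) ?_
  simpa using h.integrable_mul_left (G := fun _ => 1) (by fun_prop) (fun ξ => by
    rw [abs_one]; exact one_le_pow₀ (one_le_bracket ξ)) t

theorem memLp_mul_left (h : IsSmoothedSolution α β ν b δ m Ψ Φ) (t : ℝ) :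
    MemLp (fun ξ : ℝ => Complex.I * ξ * evolution Ψ ξ t) 2 := by
  have h1 : Measurable fun ξ => evolution Ψ ξ t :=
    measurable_evolution_comp h.meas_left (by fun_prop) (by fun_prop)
  refine memLp_two_of_integrable_sq (by fun_prop) ?_
  have := h.integrable_mul_left (G := fun ξ => ξ ^ 2) (by fun_prop) (fun ξ => by
    rw [abs_of_nonneg (by positivity), bracket_sq]; linarith) t
  refine this.congr (Filter.Eventually.of_forall fun ξ => ?_)
  simp [mul_pow]

theorem memLp_right (h : IsSmoothedSolution α β ν b δ m Ψ Φ) (t : ℝ) :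
    MemLp (fun ξ => evolution Φ ξ t) 2 := by
  refine memLp_two_of_integrable_sq (measurable_evolution_comp h.meas_right (by fun_prop)
    (by fun_prop)) ?_
  simpa using h.integrable_mul_right (G := fun _ => 1) (by fun_prop) (fun ξ => by
    rw [abs_one]; exact one_le_bracket ξ) t

theorem integrable_evolution_left (h : IsSmoothedSolution α β ν b δ m Ψ Φ) (t : ℝ) :
    Integrable (fun ξ => evolution Ψ ξ t) :=
  integrable_of_majorant (measurable_evolution_comp h.meas_left (by fun_prop) (by fun_prop))
    h.lintegral_majorant_left fun ξ => enorm_evolution_le _ _ _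

/-- By Parseval, ∫ f conj(fₓ) is -i times the integral of ξ|f̂|², so minus its imaginary part is the
momentum with a plus sign. -/
theorem functionalL_eq (h : IsSmoothedSolution α β ν b δ m Ψ Φ)
    (hf : HasFourier f (fun ξ => evolution Ψ ξ t)) (hg : HasFourier g (fun ξ => evolution Φ ξ t)) :
    functionalL α β f g = momentumForm α β Ψ Φ t := by
  have h1 := hg.integral_norm_sq (h.memLp_right t)
  have h2 := hf.parseval hf.deriv (h.memLp_left t) (h.memLp_mul_left t)
  have e : ∀ ξ : ℝ, evolution Ψ ξ t * (starRingEnd ℂ) (Complex.I * ξ * evolution Ψ ξ t) =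
      -Complex.I * ((ξ * ‖evolution Ψ ξ t‖ ^ 2 : ℝ) : ℂ) := fun ξ => by
    rw [← Complex.normSq_eq_norm_sq, Complex.ofReal_mul, ← Complex.mul_conj, map_mul, map_mul,
      Complex.conj_I, Complex.conj_ofReal]
    ring
  simp only [e] at h2
  rw [integral_const_mul, integral_complex_ofReal] at h2
  rw [functionalL, momentumForm, h1, h2]
  simp

/-- The cubic term is the only one beyond Plancherel. It uses that the transform of Iu is
integrable, a consequence of H¹ regularity. -/
theorem functionalE_eq (h : IsSmoothedSolution α β ν b δ m Ψ Φ)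
    (hf : HasFourier f (fun ξ => evolution Ψ ξ t)) (hg : HasFourier g (fun ξ => evolution Φ ξ t)) :
    functionalE α β ν f g = energyForm α β ν Ψ Φ t := by
  have h1 := hf.deriv.integral_norm_sq (h.memLp_mul_left t)
  have h2 : ∫ ξ, |ξ| * ‖hat g ξ‖ ^ 2 = ∫ ξ, |ξ| * ‖evolution Φ ξ t‖ ^ 2 := by
    refine integral_congr_ae ?_
    filter_upwards [hg.hat_ae] with ξ hξ
    rw [hξ]
  have h3 := hf.integral_mul_norm_sq hg (h.memLp_left t) (h.integrable_evolution_left t)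
    (h.memLp_right t)
  have h4 : ∫ p : ℝ × ℝ, cubicIntegrand Ψ Φ t p =
      ∫ ξ, ∫ η, evolution Ψ ξ t * evolution Φ η t * (starRingEnd ℂ) (evolution Ψ (ξ + η) t) :=
    integral_prod _ (h.integrable_cubicIntegrand t)
  rw [functionalE, energyForm, cubicForm, h1, h2, h3, h4]
  congr 3
  ext ξ
  simp [mul_pow]

end IsSmoothedSolution

end Functionals

end SBO
end

/-! ### From the extensions to the local norms -/

namespace SBO

/-- The bound for the increments, with the local norms enlarged by `ε`. -/
theorem IsLocalSolution.increments_le {α β ν s b N K δ ε : ℝ} {m : ℝ → ℝ} {u₀ v₀ : 𝓢'(ℝ, ℂ)}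
    {u v : ℝ → 𝓢'(ℝ, ℂ)} (hsol : IsLocalSolution α β ν s b m δ u₀ v₀ u v)
    (hm : IsSymbol s N K m) (hs : 1 / 4 ≤ s) (hs1 : s ≤ 1) (hN : 1 ≤ N) (hν : 0 ≤ ν)
    (hb : 1 / 2 < b) (hδ : 0 ≤ δ) (hβ : β ≠ 0) (hε : 0 < ε) :
    |functionalE α β ν (smoothing m (u δ)) (smoothing m (v δ))
        - functionalE α β ν (smoothing m (u 0)) (smoothing m (v 0))|
      + |functionalL α β (smoothing m (u δ)) (smoothing m (v δ))
        - functionalL α β (smoothing m (u 0)) (smoothing m (v 0))|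
    ≤ (|incrementConst α β ν b K| + 1) * N⁻¹ *
      (((normX 1 b δ (fun t => smoothing m (u t))).toReal + ε) ^ 2
          * ((normY ν (1 / 2) b δ (fun t => smoothing m (v t))).toReal + ε)
        + ((normX 1 b δ (fun t => smoothing m (u t))).toReal + ε) ^ 4
        + ((normX 1 b δ (fun t => smoothing m (u t))).toReal + ε) ^ 2
          * ((normY ν (1 / 2) b δ (fun t => smoothing m (v t))).toReal + ε) ^ 2) := by
  obtain ⟨Ψ, hΨ, hΨn⟩ := exists_isExtension_of_localNorm_lt_top hsol.mem_X (by fun_prop)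
    zero_le_one hb hε
  obtain ⟨Φ₁, hΦ₁, hΦn₁⟩ := exists_isExtension_of_localNorm_lt_top hsol.mem_Y
    (measurable_dispersion ν) (by norm_num) hb hε
  have hp := fun ξ => (hm.pos hs hN ξ).ne'
  obtain ⟨Φ, hΦ, hΦn, hr⟩ := hΦ₁.exists_conj_symmetric fun t ht => by
    filter_upwards [(hsol.real_v t ht).hat_neg
      (hm.hasFourier_of_smoothing hs hN (hΦ₁.hasFourier t ht))] with ξ hξ
    have h1 : (m ξ : ℂ)⁻¹ ≠ 0 := inv_ne_zero (by exact_mod_cast hp ξ)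
    rw [hm.even, map_mul, map_inv₀, Complex.conj_ofReal] at hξ
    exact mul_left_cancel₀ h1 hξ
  rw [← hΦn] at hΦn₁
  have hS := hsol.isSmoothedSolution hm hs hs1 hN hν hb hδ hΨ hΦ hr
  have h0 : (0 : ℝ) ∈ Icc 0 δ := ⟨le_rfl, hδ⟩
  have hd : δ ∈ Icc 0 δ := ⟨hδ, le_rfl⟩
  rw [hS.functionalE_eq (hΨ.hasFourier δ hd) (hΦ.hasFourier δ hd),
    hS.functionalE_eq (hΨ.hasFourier 0 h0) (hΦ.hasFourier 0 h0),
    hS.functionalL_eq (hΨ.hasFourier δ hd) (hΦ.hasFourier δ hd),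
    hS.functionalL_eq (hΨ.hasFourier 0 h0) (hΦ.hasFourier 0 h0)]
  refine (hS.increments_le (hm.symbolBounds hs hs1 hN hν) hν hβ rfl rfl).trans ?_
  have hc : incrementConst α β ν b K ≤ |incrementConst α β ν b K| + 1 := by
    linarith [le_abs_self (incrementConst α β ν b K)]
  rw [normX, normY]
  gcongr

end SBO

theorem proposition4 (α β ν s b K : ℝ) (hν : 0 < ν) (hαβ : α / β < 0)
    (hs : 1 / 4 ≤ s) (hs1 : s ≤ 1) (hb : 1 / 2 < b) :
    ∃ c : ℝ, 0 < c ∧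
      ∀ (N : ℝ), 1 ≤ N →
      ∀ (m : ℝ → ℝ), SBO.IsSymbol s N K m →
      ∀ (δ : ℝ), 0 < δ →
      ∀ (u₀ v₀ : 𝓢'(ℝ, ℂ)) (u v : ℝ → 𝓢'(ℝ, ℂ)),
        SBO.IsLocalSolution α β ν s b m δ u₀ v₀ u v →
        |SBO.functionalE α β ν (SBO.smoothing m (u δ)) (SBO.smoothing m (v δ))
            - SBO.functionalE α β ν (SBO.smoothing m (u 0)) (SBO.smoothing m (v 0))|
          + |SBO.functionalL α β (SBO.smoothing m (u δ)) (SBO.smoothing m (v δ))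
            - SBO.functionalL α β (SBO.smoothing m (u 0)) (SBO.smoothing m (v 0))|
        ≤ c * N⁻¹ *
          ((SBO.normX 1 b δ (fun t => SBO.smoothing m (u t))).toReal ^ 2
              * (SBO.normY ν (1 / 2) b δ (fun t => SBO.smoothing m (v t))).toReal
            + (SBO.normX 1 b δ (fun t => SBO.smoothing m (u t))).toReal ^ 4
            + (SBO.normX 1 b δ (fun t => SBO.smoothing m (u t))).toReal ^ 2
              * (SBO.normY ν (1 / 2) b δ (fun t => SBO.smoothing m (v t))).toReal ^ 2) := by
  have hβ : β ≠ 0 := by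
    rintro rfl
    simp at hαβ
  -- The absolute value and the 1 make the constant positive before any symbol is given, when the
  -- sign of K is not yet known.
  refine ⟨|SBO.incrementConst α β ν b K| + 1, by positivity, ?_⟩
  intro N hN m hm δ hδ u₀ v₀ u v hsol
  set A := (SBO.normX 1 b δ (fun t => SBO.smoothing m (u t))).toReal
  set B := (SBO.normY ν (1 / 2) b δ (fun t => SBO.smoothing m (v t))).toReal
  have hA : 0 ≤ A := ENNReal.toReal_nonneg
  have hB : 0 ≤ B := ENNReal.toReal_nonneg
  -- The constant does not depend on ε, so the bound with enlarged norms passes to the limit ε → 0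
  -- from the right, which recovers the infima.
  have hcont : Continuous fun ε : ℝ => (|SBO.incrementConst α β ν b K| + 1) * N⁻¹ *
      ((A + ε) ^ 2 * (B + ε) + (A + ε) ^ 4 + (A + ε) ^ 2 * (B + ε) ^ 2) := by fun_prop
  have hlim := (hcont.tendsto 0).mono_left (nhdsWithin_le_nhds (s := Ioi 0))
  simp only [add_zero] at hlim
  refine ge_of_tendsto hlim ?_
  filter_upwards [self_mem_nhdsWithin] with ε hε
  exact hsol.increments_le hm hs hs1 hN hν.le hb hδ.le hβ hε
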